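/- **Setting.** Let $0<\kappa<2\pi$, $\mathbb I:=(0,\kappa)$, $\widetilde{\mathcal D}:=(0,\infty)\times\mathbb I$, $\gamma\in\mathbb N_0$ and $\Theta,\theta\in\mathbb R$. All functions are complex-valued and functions that agree almost everywhere are identified. *Weighted Sobolev spaces on $\mathbb I$.* Let $\rho(\phi):=\min\{\phi,\kappa-\phi\}$ be the distance to the boundary. Fix $c>1$ and an approximate smooth resolution of unity $\xi=(\xi_\nu)_{\nu\in\mathbb Z}$ on $\mathbb I$, i.e. real-valued $\xi_\nu\in C_0^\infty(\mathbb I)$ (extended by zero) such that, for some $k_0\in\mathbb N$, $\operatorname{supp}\xi_\nu\subset\{\phi\in\mathbb I: c^{\nu-k_0}<\rho(\phi)<c^{\nu+k_0}\}$ for all $\nu$; for every $n\in\mathbb N_0$ there is $C_n$ with $|\xi_\nu^{(n)}|\le C_n c^{-n\nu}$ for all $\nu$; and $\sum_\nu\xi_\nu\ge\delta$ on $\mathbb I$ for some $\delta>0$. For $m\in\mathbb N_0$ and $\sigma\in\mathbb R$ the space $H^m_{2,\sigma}(\mathbb I)$ consists of all $f\in L_{1,\mathrm{loc}}(\mathbb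 I)$ with $$\|f\,|\,H^m_{2,\sigma}(\mathbb I)\|^2:=\sum_{\nu\in\mathbb Z}c^{\nu\sigma}\,\|(\xi_\nu f)(c^\nu\,\cdot)\,|\,H^m_2(\mathbb R)\|^2<\infty,$$ where $\|g\,|\,H^m_2(\mathbb R)\|=\|(1-\Delta)^{m/2}g\,|\,L_2(\mathbb R)\|$. Put $L_{2,\sigma}(\mathbb I):=H^0_{2,\sigma}(\mathbb I)$. (Up to equivalent norms these spaces do not depend on $c$ and $\xi$.) *The space $P^\gamma_{2,\Theta,\theta}(\widetilde{\mathcal D})$* consists of all $u\in L_{1,\mathrm{loc}}(\widetilde{\mathcal D})$ whose distributional derivatives $(rD_r)^ju$, $0\le j\le\gamma$, belong to $L_{1,\mathrm{loc}}(\widetilde{\mathcal D})$ and for which $$\|u\,|\,P^\gamma_{2,\Theta,\theta}(\widetilde{\mathcal D})\|:=\Big(\int_0^\infty r^{\theta-1}\sum_{j=0}^\gamma\|(rD_r)^ju(r,\cdot)\,|\,H^{\gamma-j}_{2,\Theta-1+2j}(\mathbb I)\|^2\,dr\Big)^{1/2}<\infty .$$ *The space $Y^\gamma_{2,\Theta,\theta}(\mathbb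 I)$.* Write $\Gamma:=\{\lambda\in\mathbb C:\operatorname{Re}\lambda=-\theta/2\}$. For $\sigma\in\mathbb R$ let $Y^0_{2,\sigma,\theta}(\mathbb I)$ be the space of all measurable $v:\Gamma\times\mathbb I\to\mathbb C$ with $\frac1{2\pi}\int_{\mathbb R}\|v(-\tfrac\theta2+it,\cdot)\,|\,L_{2,\sigma-1}(\mathbb I)\|^2\,dt<\infty$. Then $Y^\gamma_{2,\Theta,\theta}(\mathbb I)$ is the space of all $v$ such that for all $j,\alpha\in\mathbb N_0$ with $j+\alpha\le\gamma$ one has $\lambda^jD_\phi^\alpha v\in Y^0_{2,\Theta+2j+2\alpha,\theta}(\mathbb I)$ ($D_\phi^\alpha v(\lambda,\cdot)$ being the weak derivative on $\mathbb I$ for almost every $\lambda\in\Gamma$), with the norm $$\|v\,|\,Y^\gamma_{2,\Theta,\theta}(\mathbb I)\|:=\Big(\frac1{2\pi}\sum_{j=0}^\gamma\int_{\mathbb R}|\lambda|^{2j}\,\|v(\lambda,\cdot)\,|\,H^{\gamma-j}_{2,\Theta-1+2j}(\mathbb I)\|^2\,dt\Big)^{1/2},\qquad \lambda=-\tfrac\theta2+it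 .$$ *Mellin transform.* For $\psi\in C_0^\infty((0,\infty))$ let $(\mathcal M\psi)(\lambda):=\int_0^\infty r^{-\lambda-1}\psi(r)\,dr$. Let $\mathcal M_{\theta/2}$ denote its continuous extension to a map from $L_2((0,\infty),r^{\theta-1}dr)$ into the space of functions on $\Gamma$ that are square integrable with respect to $dt$, $\lambda=-\theta/2+it$. **Theorem.** The map $\mathcal M$ given by $$(\mathcal Mu)(\lambda,\phi):=\big(\mathcal M_{\theta/2}\,u(\cdot,\phi)\big)(\lambda),\qquad \lambda\in\Gamma,\ \text{for almost every }\phi\in\mathbb I,$$ is a linear bijection from $P^\gamma_{2,\Theta,\theta}(\widetilde{\mathcal D})$ onto $Y^\gamma_{2,\Theta,\theta}(\mathbb I)$ that is bounded and has a bounded inverse: there is a finite constant $C$ such that for all $u\in P^\gamma_{2,\Theta,\theta}(\widetilde{\mathcal D})$ $$\|\mathcal Mu\,|\,Y^\gamma_{2,\Theta,\theta}(\mathbb I)\|\le C\,\|u\,|\,P^\gamma_{2,\Theta,\theta}(\widetilde{\mathcal D})\|\quad\text{and}\quad\|u\,|\,P^\gamma_{2,\Theta,\theta}(\widetilde{\mathcal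 D})\|\le C\,\|\mathcal Mu\,|\,Y^\gamma_{2,\Theta,\theta}(\mathbb I)\| .$$ -/

import Mathlib

open MeasureTheory Set Filter Topology
open scoped ENNReal NNReal ContDiff FourierTransform

noncomputable section

/-! ## Test functions -/

/-- `ψ ∈ C₀^∞(U)`, extended by zero outside the open set `U`. -/
def IsTestFun {E : Type*} [NormedAddCommGroup E] [NormedSpace ℝ E] (U : Set E) (ψ : E → ℂ) :
    Prop :=
  ContDiff ℝ ∞ ψ ∧ HasCompactSupport ψ ∧ tsupport ψ ⊆ U

/-! ## The weighted Sobolev spaces `H^m_{2,Θ}(O)` on one-dimensional domains -/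

/-- An approximate smooth resolution of unity on the domain `O ⊆ ℝ`, subordinate to the
`c`-adic level sets of the distance to the boundary `∂O`. The functions are extended by zero
outside `O`. -/
structure ApproxResolution (c : ℝ) (O : Set ℝ) where
  /-- the functions `ξ_ν`, `ν ∈ ℤ` -/
  ξ : ℤ → ℝ → ℝ
  one_lt : 1 < c
  smooth : ∀ ν, ContDiff ℝ ∞ (ξ ν)
  supp : ∃ k₀ : ℕ, ∀ ν, tsupport (ξ ν) ⊆
    {x | x ∈ O ∧ c ^ (ν - (k₀ : ℤ)) < Metric.infDist x (frontier O) ∧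
      Metric.infDist x (frontier O) < c ^ (ν + (k₀ : ℤ))}
  deriv_bound : ∀ n : ℕ, ∃ C : ℝ, ∀ ν x, |iteratedDeriv n (ξ ν) x| ≤ C * c ^ (-((n : ℤ) * ν))
  lower_bound : ∃ δ : ℝ, 0 < δ ∧ ∀ x ∈ O, δ ≤ ∑' ν, ξ ν x

/-- The square of the norm of an integrable function `g` in the Bessel potential space
`H^m_2(ℝ)`, i.e. `‖(1 - Δ)^{m/2} g‖_{L₂}²`, computed on the Fourier side (Plancherel).
Mathlib's Fourier transform has the kernel `exp(-2πi x t)`, hence the symbol of `1 - Δ` is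
`1 + (2πt)²`. -/
def besselNormSq (m : ℕ) (g : ℝ → ℂ) : ℝ≥0∞ :=
  ∫⁻ t : ℝ, ENNReal.ofReal ((1 + (2 * Real.pi * t) ^ 2) ^ m) * ‖𝓕 g t‖ₑ ^ 2

/-- The localised and rescaled function `(ξ_ν f)(c^ν ·)`. -/
def dyadicPiece {c : ℝ} {O : Set ℝ} (R : ApproxResolution c O) (ν : ℤ) (f : ℝ → ℂ) : ℝ → ℂ :=
  fun x => (R.ξ ν (c ^ ν * x) : ℂ) * f (c ^ ν * x)

open Classical in
/-- The square of the norm of `f` in `H^m_{2,Θ}(O)`,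
`∑_ν c^{νΘ} ‖(ξ_ν f)(c^ν ·) | H^m_2(ℝ)‖²`; it is `∞` if `f` is not locally integrable on `O`
(for `m ≥ 0` all elements of `H^m_{2,Θ}(O)` are regular distributions). If `f` is locally
integrable and `O` is bounded, every `(ξ_ν f)(c^ν ·)` is integrable with compact support. -/
def sobNormSq {c : ℝ} {O : Set ℝ} (R : ApproxResolution c O) (m : ℕ) (Θ : ℝ) (f : ℝ → ℂ) :
    ℝ≥0∞ :=
  if LocallyIntegrableOn f O volume then
    ∑' ν : ℤ, ENNReal.ofReal (c ^ ((ν : ℝ) * Θ)) * besselNormSq m (dyadicPiece R ν f)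
  else ⊤

/-- `∫_A wt(s) ‖w(s,·) | H^m_{2,Θ}(O)‖² ds`. -/
def mixedNormSq {c : ℝ} {O : Set ℝ} (R : ApproxResolution c O) (A : Set ℝ) (wt : ℝ → ℝ≥0∞)
    (m : ℕ) (Θ : ℝ) (w : ℝ × ℝ → ℂ) : ℝ≥0∞ :=
  ∫⁻ s in A, wt s * sobNormSq R m Θ (fun φ => w (s, φ))

/-- Lebesgue measure on `A × (0,κ)`. -/
def cylMeasure (A : Set ℝ) (κ : ℝ) : Measure (ℝ × ℝ) :=
  (volume.restrict A).prod (volume.restrict (Ioo 0 κ))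

/-! ## Predicates for `P^γ_{2,Θ,θ}` -/

/-- The formal adjoint `ψ ↦ -∂_r(r ψ)` of `r ∂_r`. -/
def eulerAdj (ψ : ℝ × ℝ → ℂ) : ℝ × ℝ → ℂ :=
  fun x => -deriv (fun r : ℝ => (r : ℂ) * ψ (r, x.2)) x.1

/-- `w` is the (regular) distribution `(r D_r)^j u` on `(0,∞) × (0,κ)`. -/
def IsEulerDeriv (κ : ℝ) (j : ℕ) (u w : ℝ × ℝ → ℂ) : Prop :=
  LocallyIntegrableOn w (Ioi 0 ×ˢ Ioo 0 κ) volume ∧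
  ∀ ψ : ℝ × ℝ → ℂ, IsTestFun (Ioi 0 ×ˢ Ioo 0 κ) ψ →
    ∫ x in Ioi 0 ×ˢ Ioo 0 κ, w x * ψ x = ∫ x in Ioi 0 ×ˢ Ioo 0 κ, u x * (eulerAdj^[j] ψ) x

/-- The square of the norm of `P^γ_{2,Θ,θ}((0,∞) × (0,κ))`. The function `w = (r D_r)^j u` is
unique a.e.; the infimum is `∞` if `(r D_r)^j u` is not a regular distribution. -/
def pNormSq {c κ : ℝ} (R : ApproxResolution c (Ioo 0 κ)) (γ : ℕ) (Θ θ : ℝ)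
    (u : ℝ × ℝ → ℂ) : ℝ≥0∞ :=
  ∑ j ∈ Finset.range (γ + 1), ⨅ (w : ℝ × ℝ → ℂ) (_ : IsEulerDeriv κ j u w),
    mixedNormSq R (Ioi 0) (fun r => ENNReal.ofReal (r ^ (θ - 1))) (γ - j) (Θ - 1 + 2 * j) w

/-- Membership in `P^γ_{2,Θ,θ}((0,∞) × (0,κ))`. -/
def MemP {c κ : ℝ} (R : ApproxResolution c (Ioo 0 κ)) (γ : ℕ) (Θ θ : ℝ)
    (u : ℝ × ℝ → ℂ) : Prop :=
  LocallyIntegrableOn u (Ioi 0 ×ˢ Ioo 0 κ) volume ∧ pNormSq R γ Θ θ u < ⊤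

/-! ## Predicates for `Y^γ_{2,Θ,θ}`

A function on `Γ_{-θ/2} × (0,κ)` is written in the coordinates `(t, φ)`, `λ = -θ/2 + i t`. -/

/-- The point `-θ/2 + i t` of the line `Re λ = -θ/2`. -/
def linePt (θ t : ℝ) : ℂ := ((-θ / 2 : ℝ) : ℂ) + (t : ℂ) * Complex.I

/-- `g` is the `n`-th weak derivative of `f` on `O`. -/
def IsWeakDeriv (O : Set ℝ) (n : ℕ) (f g : ℝ → ℂ) : Prop :=
  LocallyIntegrableOn f O volume ∧ LocallyIntegrableOn g O volume ∧
  ∀ ψ : ℝ → ℂ, IsTestFun O ψ →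
    ∫ x in O, g x * ψ x = (-1) ^ n * ∫ x in O, f x * iteratedDeriv n ψ x

/-- Membership in `Y^0_{2,Θ,θ}((0,κ))`. -/
def MemY₀ {c κ : ℝ} (R : ApproxResolution c (Ioo 0 κ)) (Θ : ℝ) (v : ℝ × ℝ → ℂ) : Prop :=
  AEStronglyMeasurable v (cylMeasure univ κ) ∧
  mixedNormSq R univ (fun _ => ENNReal.ofReal (1 / (2 * Real.pi))) 0 (Θ - 1) v < ⊤

/-- Membership in `Y^γ_{2,Θ,θ}((0,κ))`: `v α` is the weak derivative `D_φ^α u`, and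
`λ^j D_φ^α u ∈ Y^0_{2,Θ+2j+2α,θ}((0,κ))` for `j + α ≤ γ`. -/
def MemY {c κ : ℝ} (R : ApproxResolution c (Ioo 0 κ)) (γ : ℕ) (Θ θ : ℝ)
    (u : ℝ × ℝ → ℂ) : Prop :=
  ∃ v : ℕ → ℝ × ℝ → ℂ, ∀ α ≤ γ,
    (∀ᵐ t : ℝ, IsWeakDeriv (Ioo 0 κ) α (fun φ => u (t, φ)) (fun φ => v α (t, φ))) ∧
    ∀ j : ℕ, j + α ≤ γ →
      MemY₀ R (Θ + 2 * j + 2 * α) (fun x => linePt θ x.1 ^ j * v α x)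

/-- The square of the norm of `Y^γ_{2,Θ,θ}((0,κ))`. -/
def yNormSq {c κ : ℝ} (R : ApproxResolution c (Ioo 0 κ)) (γ : ℕ) (Θ θ : ℝ)
    (u : ℝ × ℝ → ℂ) : ℝ≥0∞ :=
  ∑ j ∈ Finset.range (γ + 1),
    mixedNormSq R univ
      (fun t => ENNReal.ofReal (1 / (2 * Real.pi)) * ‖linePt θ t‖ₑ ^ (2 * j))
      (γ - j) (Θ - 1 + 2 * j) u

/-! ## Auxiliary facts showing that the spaces are vector spaces -/

theorem IsTestFun.integrable_mul {E : Type*} [NormedAddCommGroup E] [NormedSpace ℝ E]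
    [MeasurableSpace E] [BorelSpace E] {μ : Measure E} {U : Set E} {ψ f : E → ℂ}
    (hψ : IsTestFun U ψ) (hf : LocallyIntegrableOn f U μ) :
    Integrable (fun x => f x * ψ x) μ := by
  have hK : IsCompact (tsupport ψ) := hψ.2.1
  have h := (hf.integrableOn_compact_subset hψ.2.2 hK).mul_continuousOn
    hψ.1.continuous.continuousOn hK
  refine (integrableOn_iff_integrable_of_support_subset ?_).1 h
  intro x hx
  apply subset_tsupport
  intro h0
  exact hx (by simp [h0])

theorem IsTestFun.eulerAdj {U : Set (ℝ × ℝ)} {ψ : ℝ × ℝ → ℂ} (hψ : IsTestFun U ψ) :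
    IsTestFun U (eulerAdj ψ) := by
  have hs : ContDiff ℝ ∞ (fun x : ℝ × ℝ => ((x.1 : ℝ) : ℂ) * ψ x) :=
    (Complex.ofRealCLM.contDiff.comp contDiff_fst).mul hψ.1
  have he : _root_.eulerAdj ψ =
      fun x => -(fderiv ℝ (fun x : ℝ × ℝ => ((x.1 : ℝ) : ℂ) * ψ x) x (1, 0)) := by
    funext x
    have h1 : HasFDerivAt (fun x : ℝ × ℝ => ((x.1 : ℝ) : ℂ) * ψ x)
        (fderiv ℝ (fun x : ℝ × ℝ => ((x.1 : ℝ) : ℂ) * ψ x) x) (x.1, x.2) :=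
      (hs.differentiable (by simp) x).hasFDerivAt
    have h2 : HasDerivAt (fun r : ℝ => ((r, x.2) : ℝ × ℝ)) (1, 0) x.1 :=
      (hasDerivAt_id x.1).prodMk (hasDerivAt_const x.1 x.2)
    have h3 := h1.comp_hasDerivAt x.1 h2
    simp only [_root_.eulerAdj]
    rw [← h3.deriv]
    rfl
  have hsub : tsupport (_root_.eulerAdj ψ) ⊆ tsupport ψ := by
    refine closure_minimal ?_ (isClosed_tsupport ψ)
    intro x hx
    by_contra hn
    apply hx
    have h0 : (fun x : ℝ × ℝ => ((x.1 : ℝ) : ℂ) * ψ x) =ᶠ[𝓝 x] fun _ => 0 := by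
      filter_upwards [notMem_tsupport_iff_eventuallyEq.1 hn] with y hy
      simp [hy]
    rw [he]
    simp [h0.fderiv_eq]
  refine ⟨?_, ?_, hsub.trans hψ.2.2⟩
  · rw [he]
    exact ((hs.fderiv_right (m := (∞ : WithTop ℕ∞)) (by simp)).clm_apply contDiff_const).neg
  · exact hψ.2.1.of_isClosed_subset (isClosed_tsupport _) hsub

theorem IsTestFun.eulerAdj_iterate {U : Set (ℝ × ℝ)} {ψ : ℝ × ℝ → ℂ} (hψ : IsTestFun U ψ)
    (j : ℕ) : IsTestFun U (_root_.eulerAdj^[j] ψ) := by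
  induction j with
  | zero => exact hψ
  | succ j ih => rw [Function.iterate_succ_apply']; exact ih.eulerAdj

theorem IsTestFun.iteratedDeriv {U : Set ℝ} {ψ : ℝ → ℂ} (hψ : IsTestFun U ψ) (n : ℕ) :
    IsTestFun U (iteratedDeriv n ψ) := by
  have hsub : tsupport (_root_.iteratedDeriv n ψ) ⊆ tsupport ψ := by
    refine closure_minimal ?_ (isClosed_tsupport ψ)
    intro x hx
    by_contra hn
    apply hx
    have h0 : ψ =ᶠ[𝓝 x] fun _ => 0 := notMem_tsupport_iff_eventuallyEq.1 hn
    have := h0.iteratedDeriv_eq n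
    rw [this]
    simp
  refine ⟨?_, hψ.2.1.of_isClosed_subset (isClosed_tsupport _) hsub, hsub.trans hψ.2.2⟩
  rw [iteratedDeriv_eq_iterate]
  exact ContDiff.iterate_deriv n hψ.1

theorem IsEulerDeriv.add {κ : ℝ} {j : ℕ} {u₁ u₂ w₁ w₂ : ℝ × ℝ → ℂ}
    (hu₁ : LocallyIntegrableOn u₁ (Ioi 0 ×ˢ Ioo 0 κ) volume)
    (hu₂ : LocallyIntegrableOn u₂ (Ioi 0 ×ˢ Ioo 0 κ) volume)
    (h₁ : IsEulerDeriv κ j u₁ w₁) (h₂ : IsEulerDeriv κ j u₂ w₂) :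
    IsEulerDeriv κ j (u₁ + u₂) (w₁ + w₂) := by
  refine ⟨h₁.1.add h₂.1, fun ψ hψ => ?_⟩
  have hψj := hψ.eulerAdj_iterate j
  simp only [Pi.add_apply, add_mul]
  rw [integral_add (hψ.integrable_mul h₁.1).integrableOn (hψ.integrable_mul h₂.1).integrableOn,
    integral_add (hψj.integrable_mul hu₁).integrableOn (hψj.integrable_mul hu₂).integrableOn,
    h₁.2 ψ hψ, h₂.2 ψ hψ]

theorem IsEulerDeriv.smul {κ : ℝ} {j : ℕ} {u w : ℝ × ℝ → ℂ} (a : ℂ)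
    (h : IsEulerDeriv κ j u w) : IsEulerDeriv κ j (a • u) (a • w) := by
  refine ⟨h.1.smul a, fun ψ hψ => ?_⟩
  simp only [Pi.smul_apply, smul_eq_mul, mul_assoc]
  rw [integral_const_mul, integral_const_mul, h.2 ψ hψ]

theorem IsWeakDeriv.add {O : Set ℝ} {n : ℕ} {f₁ f₂ g₁ g₂ : ℝ → ℂ}
    (h₁ : IsWeakDeriv O n f₁ g₁) (h₂ : IsWeakDeriv O n f₂ g₂) :
    IsWeakDeriv O n (f₁ + f₂) (g₁ + g₂) := by
  refine ⟨h₁.1.add h₂.1, h₁.2.1.add h₂.2.1, fun ψ hψ => ?_⟩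
  have hψj := hψ.iteratedDeriv n
  simp only [Pi.add_apply, add_mul]
  rw [integral_add (hψ.integrable_mul h₁.2.1).integrableOn
      (hψ.integrable_mul h₂.2.1).integrableOn,
    integral_add (hψj.integrable_mul h₁.1).integrableOn (hψj.integrable_mul h₂.1).integrableOn,
    h₁.2.2 ψ hψ, h₂.2.2 ψ hψ, mul_add]

theorem IsWeakDeriv.smul {O : Set ℝ} {n : ℕ} {f g : ℝ → ℂ} (a : ℂ)
    (h : IsWeakDeriv O n f g) : IsWeakDeriv O n (a • f) (a • g) := by
  refine ⟨h.1.smul a, h.2.1.smul a, fun ψ hψ => ?_⟩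
  simp only [Pi.smul_apply, smul_eq_mul, mul_assoc]
  rw [integral_const_mul, integral_const_mul, h.2.2 ψ hψ]
  ring

theorem ApproxResolution.integrable_dyadicPiece {c κ : ℝ} (R : ApproxResolution c (Ioo 0 κ))
    (ν : ℤ) {f : ℝ → ℂ} (hf : LocallyIntegrableOn f (Ioo 0 κ) volume) :
    Integrable (dyadicPiece R ν f) := by
  obtain ⟨k₀, hk⟩ := R.supp
  have hsub : tsupport (R.ξ ν) ⊆ Ioo 0 κ := fun x hx => (hk ν hx).1
  have hcomp : IsCompact (tsupport (R.ξ ν)) :=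
    isCompact_Icc.of_isClosed_subset (isClosed_tsupport _) (hsub.trans Ioo_subset_Icc_self)
  have hc : c ^ ν ≠ 0 := zpow_ne_zero _ (by linarith [R.one_lt])
  have h1 : Integrable (fun x => (R.ξ ν x : ℂ) * f x) := by
    have h := (hf.integrableOn_compact_subset hsub hcomp).continuousOn_mul
      (Complex.continuous_ofReal.comp (R.smooth ν).continuous).continuousOn hcomp
    refine (integrableOn_iff_integrable_of_support_subset ?_).1 h
    intro x hx
    apply subset_tsupport
    intro h0
    exact hx (by simp [h0])
  exact h1.comp_mul_left' hc

theorem ApproxResolution.dyadicPiece_congr {c κ : ℝ} (R : ApproxResolution c (Ioo 0 κ))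
    (ν : ℤ) {f g : ℝ → ℂ} (h : f =ᵐ[volume.restrict (Ioo 0 κ)] g) :
    dyadicPiece R ν f =ᵐ[volume] dyadicPiece R ν g := by
  obtain ⟨k₀, hk⟩ := R.supp
  have hc : c ^ ν ≠ 0 := zpow_ne_zero _ (by linarith [R.one_lt])
  have h1 : ∀ᵐ x : ℝ, (R.ξ ν x : ℂ) * f x = (R.ξ ν x : ℂ) * g x := by
    filter_upwards [(ae_restrict_iff' measurableSet_Ioo).1 h] with x hx
    by_cases hxI : x ∈ Ioo 0 κ
    · rw [hx hxI]
    · have : R.ξ ν x = 0 := by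
        by_contra h0
        exact hxI (hk ν (subset_tsupport _ h0)).1
      simp [this]
  have hq : Measure.QuasiMeasurePreserving (fun x : ℝ => c ^ ν * x) volume volume := by
    refine ⟨by fun_prop, ?_⟩
    rw [Real.map_volume_mul_left hc]
    exact (Measure.AbsolutelyContinuous.refl volume).smul_left _
  filter_upwards [hq.ae h1] with x hx
  exact hx

theorem besselNormSq_congr (m : ℕ) {f g : ℝ → ℂ} (h : f =ᵐ[volume] g) :
    besselNormSq m f = besselNormSq m g := by
  have h2 : 𝓕 f = 𝓕 g := by
    funext t
    rw [Real.fourier_eq, Real.fourier_eq]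
    exact integral_congr_ae (by filter_upwards [h] with x hx; rw [hx])
  simp only [besselNormSq, h2]

theorem sobNormSq_congr {c κ : ℝ} (R : ApproxResolution c (Ioo 0 κ)) (m : ℕ) (Θ : ℝ)
    {f g : ℝ → ℂ} (h : f =ᵐ[volume.restrict (Ioo 0 κ)] g) :
    sobNormSq R m Θ f = sobNormSq R m Θ g := by
  have h2 : ∀ ν, besselNormSq m (dyadicPiece R ν f) = besselNormSq m (dyadicPiece R ν g) :=
    fun ν => besselNormSq_congr m (R.dyadicPiece_congr ν h)
  have h3 := locallyIntegrableOn_congr h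
  by_cases hf : LocallyIntegrableOn f (Ioo 0 κ) volume
  · simp only [sobNormSq, hf, h3.1 hf, h2]
  · have hg : ¬ LocallyIntegrableOn g (Ioo 0 κ) volume := fun hg => hf (h3.2 hg)
    simp only [sobNormSq, hf, hg, if_false]

theorem enorm_add_sq_le (a b : ℂ) : ‖a + b‖ₑ ^ 2 ≤ 2 * ‖a‖ₑ ^ 2 + 2 * ‖b‖ₑ ^ 2 := by
  have h1 : ‖a + b‖₊ ^ 2 ≤ 2 * ‖a‖₊ ^ 2 + 2 * ‖b‖₊ ^ 2 := by
    rw [← NNReal.coe_le_coe]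
    push_cast
    nlinarith [norm_add_le a b, norm_nonneg (a + b), norm_nonneg a, norm_nonneg b,
      sq_nonneg (‖a‖ - ‖b‖)]
  simp only [enorm_eq_nnnorm]
  exact_mod_cast h1

theorem besselNormSq_add_le (m : ℕ) {f g : ℝ → ℂ} (hf : Integrable f) (hg : Integrable g) :
    besselNormSq m (f + g) ≤ 2 * besselNormSq m f + 2 * besselNormSq m g := by
  have hm : Measurable fun t : ℝ =>
      2 * (ENNReal.ofReal ((1 + (2 * Real.pi * t) ^ 2) ^ m) * ‖𝓕 f t‖ₑ ^ 2) := by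
    have : Continuous (𝓕 f) := by
      change Continuous (VectorFourier.fourierIntegral Real.fourierChar volume (innerₗ ℝ) f)
      exact VectorFourier.fourierIntegral_continuous Real.continuous_fourierChar
        continuous_inner hf
    have h2 := this.measurable
    fun_prop
  unfold besselNormSq
  rw [← lintegral_const_mul' _ _ (by simp), ← lintegral_const_mul' _ _ (by simp),
    ← lintegral_add_left hm]
  refine lintegral_mono fun t => ?_
  have h : 𝓕 (f + g) t = 𝓕 f t + 𝓕 g t := by
    rw [Real.fourier_eq, Real.fourier_eq, Real.fourier_eq, ← integral_add]
    · simp only [Pi.add_apply, smul_add]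
    · exact (Real.fourierIntegral_convergent_iff t).2 hf
    · exact (Real.fourierIntegral_convergent_iff t).2 hg
  simp only [h]
  calc _ ≤ ENNReal.ofReal ((1 + (2 * Real.pi * t) ^ 2) ^ m) *
        (2 * ‖𝓕 f t‖ₑ ^ 2 + 2 * ‖𝓕 g t‖ₑ ^ 2) := by gcongr; exact enorm_add_sq_le _ _
    _ = _ := by ring

theorem besselNormSq_smul (m : ℕ) (a : ℂ) (f : ℝ → ℂ) :
    besselNormSq m (a • f) = ‖a‖ₑ ^ 2 * besselNormSq m f := by
  unfold besselNormSq
  rw [← lintegral_const_mul' _ _ (by simp)]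
  refine lintegral_congr fun t => ?_
  have h : 𝓕 (a • f) t = a * 𝓕 f t := by
    rw [Real.fourier_eq, Real.fourier_eq, ← integral_const_mul]
    refine integral_congr_ae (.of_forall fun x => ?_)
    simp only [Pi.smul_apply, smul_eq_mul, Circle.smul_def]
    ring
  rw [h, enorm_mul]
  ring

theorem sobNormSq_add_le {c κ : ℝ} (R : ApproxResolution c (Ioo 0 κ)) (m : ℕ) (Θ : ℝ)
    (f g : ℝ → ℂ) :
    sobNormSq R m Θ (f + g) ≤ 2 * sobNormSq R m Θ f + 2 * sobNormSq R m Θ g := by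
  by_cases hf : LocallyIntegrableOn f (Ioo 0 κ) volume
  swap
  · simp [sobNormSq, hf]
  by_cases hg : LocallyIntegrableOn g (Ioo 0 κ) volume
  swap
  · simp [sobNormSq, hg]
  have hfg := hf.add hg
  simp only [sobNormSq, hf, hg, hfg, if_true]
  rw [← ENNReal.tsum_mul_left, ← ENNReal.tsum_mul_left, ← ENNReal.tsum_add]
  refine ENNReal.tsum_le_tsum fun ν => ?_
  have h : dyadicPiece R ν (f + g) = dyadicPiece R ν f + dyadicPiece R ν g := by
    funext x; simp [dyadicPiece, mul_add]
  rw [h]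
  calc _ ≤ ENNReal.ofReal (c ^ ((ν : ℝ) * Θ)) * (2 * besselNormSq m (dyadicPiece R ν f) +
        2 * besselNormSq m (dyadicPiece R ν g)) := by
        gcongr
        exact besselNormSq_add_le m (R.integrable_dyadicPiece ν hf)
          (R.integrable_dyadicPiece ν hg)
    _ = _ := by ring

theorem sobNormSq_zero {c κ : ℝ} (R : ApproxResolution c (Ioo 0 κ)) (m : ℕ) (Θ : ℝ) :
    sobNormSq R m Θ (fun _ => 0) = 0 := by
  have h : LocallyIntegrableOn (fun _ : ℝ => (0 : ℂ)) (Ioo 0 κ) volume := locallyIntegrableOn_zero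
  have h2 : ∀ ν, dyadicPiece R ν (fun _ => 0) = (0 : ℂ) • (fun _ : ℝ => (0 : ℂ)) := by
    intro ν; funext x; simp [dyadicPiece]
  simp only [sobNormSq, h, if_true, h2, besselNormSq_smul]
  simp

theorem sobNormSq_smul_le {c κ : ℝ} (R : ApproxResolution c (Ioo 0 κ)) (m : ℕ) (Θ : ℝ)
    (a : ℂ) (f : ℝ → ℂ) :
    sobNormSq R m Θ (a • f) ≤ ‖a‖ₑ ^ 2 * sobNormSq R m Θ f := by
  by_cases ha : a = 0
  · subst ha
    have : (0 : ℂ) • f = fun _ => 0 := by funext x; simp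
    simp [this, sobNormSq_zero]
  by_cases hf : LocallyIntegrableOn f (Ioo 0 κ) volume
  swap
  · simp only [sobNormSq, hf, if_false]
    rw [ENNReal.mul_top (by simp [ha])]
    exact le_top
  have hfa := hf.smul a
  simp only [sobNormSq, hf, hfa, if_true]
  rw [← ENNReal.tsum_mul_left]
  refine ENNReal.tsum_le_tsum fun ν => ?_
  have h : dyadicPiece R ν (a • f) = a • dyadicPiece R ν f := by
    funext x; simp only [dyadicPiece, Pi.smul_apply, smul_eq_mul]; ring
  rw [h, besselNormSq_smul]
  exact le_of_eq (by ring)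

theorem ae_locallyIntegrableOn_slice {A I : Set ℝ} (hA : MeasurableSet A) (hI : IsOpen I)
    {f : ℝ × ℝ → ℂ} (hf : LocallyIntegrableOn f (A ×ˢ I) volume) :
    ∀ᵐ r ∂(volume.restrict A), LocallyIntegrableOn (fun φ => f (r, φ)) I volume := by
  obtain ⟨u, hu, hsu, hint⟩ := hf.exists_nat_integrableOn
  have hms : MeasurableSet (A ×ˢ I) := hA.prod hI.measurableSet
  have h1 : ∀ n, ∀ᵐ r : ℝ, Integrable (fun φ => (u n ∩ A ×ˢ I).indicator f (r, φ)) := by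
    intro n
    have hm : MeasurableSet (u n ∩ A ×ˢ I) := (hu n).measurableSet.inter hms
    have h2 : Integrable ((u n ∩ A ×ˢ I).indicator f) (volume.prod volume) := by
      rw [← Measure.volume_eq_prod]
      exact (integrable_indicator_iff hm).2 (hint n)
    exact h2.prod_right_ae
  rw [ae_restrict_iff' hA]
  filter_upwards [ae_all_iff.2 h1] with r hr hrA x hx
  obtain ⟨n, hn⟩ := mem_iUnion.1 (hsu (⟨hrA, hx⟩ : (r, x) ∈ A ×ˢ I))
  have ho : IsOpen ((fun φ : ℝ => (r, φ)) ⁻¹' u n ∩ I) :=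
    ((hu n).preimage (by fun_prop)).inter hI
  refine ⟨_, mem_nhdsWithin_of_mem_nhds (ho.mem_nhds ⟨hn, hx⟩), ?_⟩
  rw [← integrable_indicator_iff ho.measurableSet]
  refine (hr n).congr (.of_forall fun φ => ?_)
  by_cases h1 : (r, φ) ∈ u n <;> by_cases h2 : φ ∈ I <;>
    simp [indicator, h1, h2, hrA]

theorem measurable_besselNormSq_slice {c κ : ℝ} (R : ApproxResolution c (Ioo 0 κ)) (m : ℕ)
    (ν : ℤ) {w : ℝ × ℝ → ℂ} (hw : StronglyMeasurable w) :
    Measurable fun s => besselNormSq m (dyadicPiece R ν (fun φ => w (s, φ))) := by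
  have h1 : StronglyMeasurable fun p : ℝ × ℝ =>
      𝓕 (dyadicPiece R ν (fun φ => w (p.1, φ))) p.2 := by
    simp only [Real.fourier_eq', dyadicPiece]
    refine StronglyMeasurable.integral_prod_right' (ν := (volume : Measure ℝ))
      (f := fun q : (ℝ × ℝ) × ℝ => Complex.exp (((-2 * Real.pi * inner ℝ q.2 q.1.2 : ℝ) : ℂ)
        * Complex.I) • (((R.ξ ν (c ^ ν * q.2) : ℝ) : ℂ) * w (q.1.1, c ^ ν * q.2))) ?_
    have ha : Continuous fun q : (ℝ × ℝ) × ℝ =>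
        Complex.exp (((-2 * Real.pi * inner ℝ q.2 q.1.2 : ℝ) : ℂ) * Complex.I) := by fun_prop
    have hb : Continuous fun q : (ℝ × ℝ) × ℝ => ((R.ξ ν (c ^ ν * q.2) : ℝ) : ℂ) := by
      have := (R.smooth ν).continuous
      fun_prop
    have hg : Measurable fun q : (ℝ × ℝ) × ℝ => (q.1.1, c ^ ν * q.2) := by fun_prop
    exact ha.stronglyMeasurable.smul (hb.stronglyMeasurable.mul (hw.comp_measurable hg))
  have h2 := h1.measurable
  unfold besselNormSq
  refine Measurable.lintegral_prod_right' (ν := (volume : Measure ℝ))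
    (f := fun p : ℝ × ℝ => ENNReal.ofReal ((1 + (2 * Real.pi * p.2) ^ 2) ^ m) *
      ‖𝓕 (dyadicPiece R ν (fun φ => w (p.1, φ))) p.2‖ₑ ^ 2) ?_
  fun_prop

theorem aemeasurable_sobNormSq_slice {c κ : ℝ} (R : ApproxResolution c (Ioo 0 κ)) (m : ℕ)
    (Θ : ℝ) {A : Set ℝ} {w : ℝ × ℝ → ℂ} (hw : AEStronglyMeasurable w (cylMeasure A κ))
    (hl : ∀ᵐ s ∂(volume.restrict A),
      LocallyIntegrableOn (fun φ => w (s, φ)) (Ioo 0 κ) volume) :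
    AEMeasurable (fun s => sobNormSq R m Θ (fun φ => w (s, φ))) (volume.restrict A) := by
  refine ⟨fun s => ∑' ν : ℤ, ENNReal.ofReal (c ^ ((ν : ℝ) * Θ)) *
    besselNormSq m (dyadicPiece R ν (fun φ => hw.mk w (s, φ))), ?_, ?_⟩
  · exact Measurable.tsum fun ν =>
      (measurable_besselNormSq_slice R m ν hw.stronglyMeasurable_mk).const_mul _
  · filter_upwards [Measure.ae_ae_of_ae_prod hw.ae_eq_mk, hl] with s hs hls
    simp only [sobNormSq, hls, if_true]
    refine tsum_congr fun ν => ?_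
    rw [besselNormSq_congr m (R.dyadicPiece_congr ν hs)]

theorem mixedNormSq_congr {c κ : ℝ} (R : ApproxResolution c (Ioo 0 κ)) {A : Set ℝ}
    (wt : ℝ → ℝ≥0∞) (m : ℕ) (Θ : ℝ) {w w' : ℝ × ℝ → ℂ} (h : w =ᵐ[cylMeasure A κ] w') :
    mixedNormSq R A wt m Θ w = mixedNormSq R A wt m Θ w' := by
  refine lintegral_congr_ae ?_
  filter_upwards [Measure.ae_ae_of_ae_prod h] with s hs
  rw [sobNormSq_congr R m Θ hs]

theorem mixedNormSq_add_lt_top {c κ : ℝ} (R : ApproxResolution c (Ioo 0 κ)) {A : Set ℝ}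
    {wt : ℝ → ℝ≥0∞} (hwt : Measurable wt) {m : ℕ} {Θ : ℝ} {w w' : ℝ × ℝ → ℂ}
    (hw : AEStronglyMeasurable w (cylMeasure A κ))
    (hl : ∀ᵐ s ∂(volume.restrict A),
      LocallyIntegrableOn (fun φ => w (s, φ)) (Ioo 0 κ) volume)
    (h : mixedNormSq R A wt m Θ w < ⊤) (h' : mixedNormSq R A wt m Θ w' < ⊤) :
    mixedNormSq R A wt m Θ (w + w') < ⊤ := by
  have hm := aemeasurable_sobNormSq_slice R m Θ hw hl
  have hm2 : AEMeasurable (fun s => 2 * (wt s * sobNormSq R m Θ (fun φ => w (s, φ))))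
      (volume.restrict A) := (hwt.aemeasurable.mul hm).const_mul 2
  calc mixedNormSq R A wt m Θ (w + w')
      ≤ ∫⁻ s in A, 2 * (wt s * sobNormSq R m Θ (fun φ => w (s, φ))) +
          2 * (wt s * sobNormSq R m Θ (fun φ => w' (s, φ))) := by
        refine lintegral_mono fun s => ?_
        calc _ ≤ wt s * (2 * sobNormSq R m Θ (fun φ => w (s, φ)) +
              2 * sobNormSq R m Θ (fun φ => w' (s, φ))) := by
              gcongr
              exact sobNormSq_add_le R m Θ (fun φ => w (s, φ)) (fun φ => w' (s, φ))
          _ = _ := by ring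
    _ = 2 * mixedNormSq R A wt m Θ w + 2 * mixedNormSq R A wt m Θ w' := by
        rw [lintegral_add_left' hm2, lintegral_const_mul' _ _ (by simp),
          lintegral_const_mul' _ _ (by simp)]
        rfl
    _ < ⊤ := ENNReal.add_lt_top.2
        ⟨ENNReal.mul_lt_top (by simp) h, ENNReal.mul_lt_top (by simp) h'⟩

theorem mixedNormSq_smul_lt_top {c κ : ℝ} (R : ApproxResolution c (Ioo 0 κ)) {A : Set ℝ}
    {wt : ℝ → ℝ≥0∞} {m : ℕ} {Θ : ℝ} (a : ℂ) {w : ℝ × ℝ → ℂ}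
    (h : mixedNormSq R A wt m Θ w < ⊤) : mixedNormSq R A wt m Θ (a • w) < ⊤ := by
  calc mixedNormSq R A wt m Θ (a • w)
      ≤ ∫⁻ s in A, ‖a‖ₑ ^ 2 * (wt s * sobNormSq R m Θ (fun φ => w (s, φ))) := by
        refine lintegral_mono fun s => ?_
        calc _ ≤ wt s * (‖a‖ₑ ^ 2 * sobNormSq R m Θ (fun φ => w (s, φ))) := by
              gcongr
              exact sobNormSq_smul_le R m Θ a (fun φ => w (s, φ))
          _ = _ := by ring
    _ = ‖a‖ₑ ^ 2 * mixedNormSq R A wt m Θ w := lintegral_const_mul' _ _ (by simp)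
    _ < ⊤ := ENNReal.mul_lt_top (by simp) h

theorem mixedNormSq_zero {c κ : ℝ} (R : ApproxResolution c (Ioo 0 κ)) (A : Set ℝ)
    (wt : ℝ → ℝ≥0∞) (m : ℕ) (Θ : ℝ) : mixedNormSq R A wt m Θ 0 = 0 := by
  simp only [mixedNormSq, Pi.zero_apply, sobNormSq_zero]
  simp

theorem cylMeasure_Ioi (κ : ℝ) :
    cylMeasure (Ioi 0) κ = volume.restrict (Ioi 0 ×ˢ Ioo 0 κ) := by
  rw [cylMeasure, Measure.prod_restrict, Measure.volume_eq_prod]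

theorem pNormSq_lt_top_iff {c κ : ℝ} (R : ApproxResolution c (Ioo 0 κ)) (γ : ℕ) (Θ θ : ℝ)
    (u : ℝ × ℝ → ℂ) : pNormSq R γ Θ θ u < ⊤ ↔ ∀ j ∈ Finset.range (γ + 1), ∃ w,
      IsEulerDeriv κ j u w ∧ mixedNormSq R (Ioi 0) (fun r => ENNReal.ofReal (r ^ (θ - 1)))
        (γ - j) (Θ - 1 + 2 * j) w < ⊤ := by
  simp only [pNormSq, ENNReal.sum_lt_top, iInf_lt_iff, exists_prop]

theorem MemP.add {c κ : ℝ} {R : ApproxResolution c (Ioo 0 κ)} {γ : ℕ} {Θ θ : ℝ}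
    {u v : ℝ × ℝ → ℂ} (hu : MemP R γ Θ θ u) (hv : MemP R γ Θ θ v) :
    MemP R γ Θ θ (u + v) := by
  refine ⟨hu.1.add hv.1, (pNormSq_lt_top_iff ..).2 fun j hj => ?_⟩
  obtain ⟨w₁, h₁, hn₁⟩ := (pNormSq_lt_top_iff ..).1 hu.2 j hj
  obtain ⟨w₂, h₂, hn₂⟩ := (pNormSq_lt_top_iff ..).1 hv.2 j hj
  refine ⟨w₁ + w₂, h₁.add hu.1 hv.1 h₂, mixedNormSq_add_lt_top R (by fun_prop) ?_
    (ae_locallyIntegrableOn_slice measurableSet_Ioi isOpen_Ioo h₁.1) hn₁ hn₂⟩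
  rw [cylMeasure_Ioi]
  exact h₁.1.aestronglyMeasurable

theorem MemP.smul {c κ : ℝ} {R : ApproxResolution c (Ioo 0 κ)} {γ : ℕ} {Θ θ : ℝ}
    {u : ℝ × ℝ → ℂ} (a : ℂ) (hu : MemP R γ Θ θ u) : MemP R γ Θ θ (a • u) := by
  refine ⟨hu.1.smul a, (pNormSq_lt_top_iff ..).2 fun j hj => ?_⟩
  obtain ⟨w, h, hn⟩ := (pNormSq_lt_top_iff ..).1 hu.2 j hj
  exact ⟨a • w, h.smul a, mixedNormSq_smul_lt_top R a hn⟩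

theorem MemP.zero {c κ : ℝ} (R : ApproxResolution c (Ioo 0 κ)) (γ : ℕ) (Θ θ : ℝ) :
    MemP R γ Θ θ 0 := by
  have h0 : LocallyIntegrableOn (0 : ℝ × ℝ → ℂ) (Ioi 0 ×ˢ Ioo 0 κ) volume :=
    locallyIntegrableOn_zero
  refine ⟨h0, (pNormSq_lt_top_iff ..).2 fun j _ => ⟨0, ⟨h0, fun ψ _ => by simp⟩, ?_⟩⟩
  simp [mixedNormSq_zero]

theorem MemP.congr {c κ : ℝ} {R : ApproxResolution c (Ioo 0 κ)} {γ : ℕ} {Θ θ : ℝ}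
    {u v : ℝ × ℝ → ℂ} (h : u =ᵐ[cylMeasure (Ioi 0) κ] v) (hu : MemP R γ Θ θ u) :
    MemP R γ Θ θ v := by
  rw [cylMeasure_Ioi] at h
  refine ⟨hu.1.congr h, (pNormSq_lt_top_iff ..).2 fun j hj => ?_⟩
  obtain ⟨w, hw, hn⟩ := (pNormSq_lt_top_iff ..).1 hu.2 j hj
  refine ⟨w, ⟨hw.1, fun ψ hψ => (hw.2 ψ hψ).trans (integral_congr_ae ?_)⟩, hn⟩
  filter_upwards [h] with x hx
  rw [hx]

theorem MemY.add {c κ : ℝ} {R : ApproxResolution c (Ioo 0 κ)} {γ : ℕ} {Θ θ : ℝ}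
    {u u' : ℝ × ℝ → ℂ} (hu : MemY R γ Θ θ u) (hu' : MemY R γ Θ θ u') :
    MemY R γ Θ θ (u + u') := by
  obtain ⟨v, hv⟩ := hu
  obtain ⟨v', hv'⟩ := hu'
  refine ⟨fun α => v α + v' α, fun α hα => ⟨?_, fun j hj => ?_⟩⟩
  · filter_upwards [(hv α hα).1, (hv' α hα).1] with t h1 h2
    exact h1.add h2
  · obtain ⟨hm, hn⟩ := (hv α hα).2 j hj
    obtain ⟨hm', hn'⟩ := (hv' α hα).2 j hj
    have he : (fun x : ℝ × ℝ => linePt θ x.1 ^ j * (v α + v' α) x) =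
        (fun x => linePt θ x.1 ^ j * v α x) + (fun x => linePt θ x.1 ^ j * v' α x) := by
      funext x; simp [mul_add]
    rw [he]
    refine ⟨hm.add hm', mixedNormSq_add_lt_top R measurable_const hm ?_ hn hn'⟩
    rw [Measure.restrict_univ]
    filter_upwards [(hv α hα).1] with t ht
    exact ht.2.1.smul (linePt θ t ^ j)

theorem MemY.smul {c κ : ℝ} {R : ApproxResolution c (Ioo 0 κ)} {γ : ℕ} {Θ θ : ℝ}
    {u : ℝ × ℝ → ℂ} (a : ℂ) (hu : MemY R γ Θ θ u) : MemY R γ Θ θ (a • u) := by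
  obtain ⟨v, hv⟩ := hu
  refine ⟨fun α => a • v α, fun α hα => ⟨?_, fun j hj => ?_⟩⟩
  · filter_upwards [(hv α hα).1] with t h1
    exact h1.smul a
  · obtain ⟨hm, hn⟩ := (hv α hα).2 j hj
    have he : (fun x : ℝ × ℝ => linePt θ x.1 ^ j * (a • v α) x) =
        a • (fun x => linePt θ x.1 ^ j * v α x) := by
      funext x; simp only [Pi.smul_apply, smul_eq_mul]; ring
    rw [he]
    exact ⟨hm.const_smul a, mixedNormSq_smul_lt_top R a hn⟩

theorem MemY.zero {c κ : ℝ} (R : ApproxResolution c (Ioo 0 κ)) (γ : ℕ) (Θ θ : ℝ) :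
    MemY R γ Θ θ 0 := by
  refine ⟨fun _ => 0, fun α _ => ⟨.of_forall fun t => ⟨?_, ?_, fun ψ _ => ?_⟩, fun j _ => ?_⟩⟩
  · exact locallyIntegrableOn_zero
  · exact locallyIntegrableOn_zero
  · simp
  · have he : (fun x : ℝ × ℝ => linePt θ x.1 ^ j * (0 : ℝ × ℝ → ℂ) x) = 0 := by
      funext x; simp
    rw [he]
    exact ⟨aestronglyMeasurable_zero, by simp [mixedNormSq_zero]⟩

theorem MemY.congr {c κ : ℝ} {R : ApproxResolution c (Ioo 0 κ)} {γ : ℕ} {Θ θ : ℝ}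
    {u u' : ℝ × ℝ → ℂ} (h : u =ᵐ[cylMeasure univ κ] u') (hu : MemY R γ Θ θ u) :
    MemY R γ Θ θ u' := by
  obtain ⟨v, hv⟩ := hu
  refine ⟨v, fun α hα => ⟨?_, (hv α hα).2⟩⟩
  have h2 := Measure.ae_ae_of_ae_prod h
  rw [Measure.restrict_univ] at h2
  filter_upwards [(hv α hα).1, h2] with t h1 h3
  refine ⟨h1.1.congr h3, h1.2.1, fun ψ hψ => (h1.2.2 ψ hψ).trans ?_⟩
  congr 1
  refine integral_congr_ae ?_
  filter_upwards [h3] with x hx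
  rw [hx]

/-! ## The spaces and the Mellin transform -/

/-- The space `P^γ_{2,Θ,θ}((0,∞) × (0,κ))` of (classes of) locally integrable functions. -/
def PSpace {c κ : ℝ} (R : ApproxResolution c (Ioo 0 κ)) (γ : ℕ) (Θ θ : ℝ) :
    Submodule ℂ ((ℝ × ℝ) →ₘ[cylMeasure (Ioi 0) κ] ℂ) where
  carrier := {u | MemP R γ Θ θ u}
  add_mem' {u v} hu hv := (MemP.add hu hv).congr (AEEqFun.coeFn_add u v).symm
  zero_mem' := (MemP.zero R γ Θ θ).congr AEEqFun.coeFn_zero.symm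
  smul_mem' a u hu := (MemP.smul a hu).congr (AEEqFun.coeFn_smul a u).symm

/-- The space `Y^γ_{2,Θ,θ}((0,κ))` of (classes of) functions on `Γ_{-θ/2} × (0,κ)`. -/
def YSpace {c κ : ℝ} (R : ApproxResolution c (Ioo 0 κ)) (γ : ℕ) (Θ θ : ℝ) :
    Submodule ℂ ((ℝ × ℝ) →ₘ[cylMeasure univ κ] ℂ) where
  carrier := {u | MemY R γ Θ θ u}
  add_mem' {u v} hu hv := (MemY.add hu hv).congr (AEEqFun.coeFn_add u v).symm
  zero_mem' := (MemY.zero R γ Θ θ).congr AEEqFun.coeFn_zero.symm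
  smul_mem' a u hu := (MemY.smul a hu).congr (AEEqFun.coeFn_smul a u).symm

/-- The norm of `P^γ_{2,Θ,θ}((0,∞) × (0,κ))`. -/
def pNorm {c κ : ℝ} (R : ApproxResolution c (Ioo 0 κ)) (γ : ℕ) (Θ θ : ℝ)
    (u : ℝ × ℝ → ℂ) : ℝ≥0∞ :=
  pNormSq R γ Θ θ u ^ (1 / 2 : ℝ)

/-- The norm of `Y^γ_{2,Θ,θ}((0,κ))`. -/
def yNorm {c κ : ℝ} (R : ApproxResolution c (Ioo 0 κ)) (γ : ℕ) (Θ θ : ℝ)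
    (u : ℝ × ℝ → ℂ) : ℝ≥0∞ :=
  yNormSq R γ Θ θ u ^ (1 / 2 : ℝ)

/-- The Mellin transform `∫_0^∞ r^{-λ-1} ψ(r) dr` of a test function. -/
def mellinTest (ψ : ℝ → ℂ) (l : ℂ) : ℂ := ∫ r in Ioi (0 : ℝ), (r : ℂ) ^ (-l - 1) * ψ r

/-- `t ↦ g t` is the function `t ↦ (M_{θ/2} f)(-θ/2 + i t)`, where `M_{θ/2}` is the continuous
extension of the Mellin transform from `C₀^∞(0,∞)` to `L₂((0,∞), r^{θ-1} dr)`, with values in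
`L₂` of the line `Re λ = -θ/2`. -/
def IsMellinL2 (θ : ℝ) (f g : ℝ → ℂ) : Prop :=
  ∃ ψ : ℕ → ℝ → ℂ, (∀ n, IsTestFun (Ioi 0) (ψ n)) ∧
    Tendsto (fun n => ∫⁻ r in Ioi (0 : ℝ), ENNReal.ofReal (r ^ (θ - 1)) * ‖f r - ψ n r‖ₑ ^ 2)
      atTop (𝓝 0) ∧
    Tendsto (fun n => ∫⁻ t : ℝ, ‖g t - mellinTest (ψ n) (linePt θ t)‖ₑ ^ 2) atTop (𝓝 0)

/-- `v` is the Mellin transform of `u` with respect to the radial variable: for almost every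
`φ ∈ (0,κ)`, `v(·,φ)` is the Mellin transform of `u(·,φ)`. -/
def IsRadialMellin (κ θ : ℝ) (u v : ℝ × ℝ → ℂ) : Prop :=
  ∀ᵐ φ ∂(volume.restrict (Ioo 0 κ)), IsMellinL2 θ (fun r => u (r, φ)) (fun t => v (t, φ))

end

noncomputable section

open SchwartzMap

/-! ## Fourier pairs in `L₂(ℝ)` -/

/-! Put `r = e^x` and `U(x,φ) = e^{θx/2} u(e^x,φ)`. On the line `λ = -θ/2 + it` the Mellin transform
of `u(·,φ)` is the Fourier transform of `U(·,φ)` at the frequency `s = t/(2π)`. The weight `r^{θ-1}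
dr` becomes `dx` once `e^{θx/2}` has been absorbed into `U`, the measure `dt/(2π)` becomes `ds`, and
`rD_r` becomes `∂_x - θ/2`, whose Fourier symbol is `2πis - θ/2 = λ`. The theorem is therefore
Plancherel's theorem in `x` for functions with values in the Hilbert spaces `H^{γ-j}_{2,Θ-1+2j}`,
applied to `(rD_r)^j u` and `λ^j v` for every `j`. The two norms are even equal.

Vector-valued Plancherel is reduced to the scalar one. The squared norm of a slice is a weighted
superposition of `|∫ w(s,φ) b(φ) dφ|²`, where `b` runs through explicit test functions, the kernels
of the localised Fourier transforms in `φ`. Tonelli moves the integral over `s` inside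
(`lintegral_sobNormSq_eq`), and integration in `φ` against `b` commutes with the Fourier transform
in `x` (`isFourierPair_integral`). Together they give `IsRadialFourier.lintegral_sobNormSq`. A
finite norm implies square integrability on `ℝ × K` for compact `K ⊆ (0,κ)`
(`isLocL2_of_lintegral_sobNormSq_lt_top`), so that the transform exists for almost every `φ`.

The correspondence between `rD_r` and `λ` is needed in both directions:
`IsEulerDeriv.ae_eq_linePt_mul` for the map from `P` to `Y`, and
`isEulerDeriv_one_of_isRadialFourier` for its surjectivity.

Finally, `Y` is defined by weak derivatives in `φ` and not by its norm. That a measurable function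
belongs to `Y` exactly when its norm is finite is `memY_of_yNormSq_lt_top` together with
`MemY.yNormSq_lt_top`. This rests on the equivalence of the `H^m_{2,σ}` norm with a sum of weighted
`L₂` norms of derivatives, obtained from the comparison of cutoff families
`IsAdm.exists_famNormSq_le`, and on weak derivatives that are jointly measurable
(`exists_measurable_weakDeriv`). -/

theorem eLpNorm_two_sq {α E : Type*} [MeasurableSpace α] [NormedAddCommGroup E] (μ : Measure α)
    (f : α → E) : eLpNorm f 2 μ ^ 2 = ∫⁻ x, ‖f x‖ₑ ^ 2 ∂μ := by
  rw [eLpNorm_eq_lintegral_rpow_enorm_toReal (by simp) (by simp), ← ENNReal.rpow_natCast,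
    ← ENNReal.rpow_mul]
  simp

theorem memLp_two_iff_lintegral {α E : Type*} [MeasurableSpace α] [NormedAddCommGroup E]
    {μ : Measure α} {f : α → E} :
    MemLp f 2 μ ↔ AEStronglyMeasurable f μ ∧ ∫⁻ x, ‖f x‖ₑ ^ 2 ∂μ < ⊤ := by
  rw [MemLp, ← eLpNorm_two_sq, ENNReal.pow_lt_top_iff]
  simp

/-- `g` is the Fourier transform of `f` in the sense of `L₂(ℝ)`. -/
structure IsFourierPair (f g : ℝ → ℂ) : Prop where
  left : MemLp f 2
  right : MemLp g 2
  pairing : ∀ ψ : 𝓢(ℝ, ℂ), ∫ s, g s * ψ s = ∫ x, f x * 𝓕 ψ x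

theorem MeasureTheory.MemLp.integrable_mul_schwartz {f : ℝ → ℂ} (hf : MemLp f 2) (ψ : 𝓢(ℝ, ℂ)) :
    Integrable fun x => f x * ψ x :=
  hf.integrable_mul (ψ.memLp 2)

theorem exists_schwartzMap_eq {η : ℝ → ℂ} (hη : ContDiff ℝ ∞ η) (hc : HasCompactSupport η) :
    ∃ ψ : 𝓢(ℝ, ℂ), ∀ x, ψ x = η x :=
  ⟨hc.toSchwartzMap hη, fun _ => rfl⟩

theorem ae_eq_of_integral_mul_schwartz_eq {f g : ℝ → ℂ} (hf : LocallyIntegrable f)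
    (hg : LocallyIntegrable g) (h : ∀ ψ : 𝓢(ℝ, ℂ), ∫ x, f x * ψ x = ∫ x, g x * ψ x) :
    f =ᵐ[volume] g := by
  refine ae_eq_of_integral_contDiff_smul_eq hf hg fun η hη hc => ?_
  obtain ⟨ψ, hψ⟩ := exists_schwartzMap_eq (Complex.ofRealCLM.contDiff.comp hη)
    (hc.comp_left (g := ((↑) : ℝ → ℂ)) (by simp))
  have h3 := h ψ
  simp only [hψ] at h3
  simp only [Complex.real_smul]
  simpa only [mul_comm, Function.comp_apply, Complex.ofRealCLM_apply] using h3

theorem MeasureTheory.MemLp.locallyIntegrable_two {f : ℝ → ℂ} (hf : MemLp f 2) :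
    LocallyIntegrable f :=
  hf.locallyIntegrable (by norm_num)

theorem IsFourierPair.congr {f f' g g' : ℝ → ℂ} (h : IsFourierPair f g) (hf : f =ᵐ[volume] f')
    (hg : g =ᵐ[volume] g') : IsFourierPair f' g' := by
  refine ⟨h.left.ae_eq hf, h.right.ae_eq hg, fun ψ => ?_⟩
  have h1 : ∫ s, g' s * ψ s = ∫ s, g s * ψ s :=
    integral_congr_ae (hg.symm.mul (.refl _ (ψ : ℝ → ℂ)))
  rw [h1, h.pairing ψ]
  exact integral_congr_ae (hf.mul (.refl _ (𝓕 ψ : 𝓢(ℝ, ℂ))))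

theorem isFourierPair_Lp (f : Lp ℂ 2 (volume : Measure ℝ)) :
    IsFourierPair f (𝓕 f : Lp ℂ 2 (volume : Measure ℝ)) := by
  refine ⟨Lp.memLp _, Lp.memLp _, fun ψ => ?_⟩
  have h := congrArg (fun T : 𝓢'(ℝ, ℂ) => T ψ) (Lp.fourier_toTemperedDistribution_eq f)
  simp only [TemperedDistribution.fourier_apply, Lp.toTemperedDistribution_apply, smul_eq_mul] at h
  simpa only [mul_comm] using h.symm

theorem MeasureTheory.MemLp.exists_isFourierPair {f : ℝ → ℂ} (hf : MemLp f 2) :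
    ∃ g, IsFourierPair f g :=
  ⟨_, (isFourierPair_Lp (hf.toLp f)).congr hf.coeFn_toLp .rfl⟩

theorem IsFourierPair.unique {f f' g g' : ℝ → ℂ} (h : IsFourierPair f g)
    (h' : IsFourierPair f' g') (hf : f =ᵐ[volume] f') : g =ᵐ[volume] g' := by
  have h2 := h.congr hf .rfl
  exact ae_eq_of_integral_mul_schwartz_eq h.right.locallyIntegrable_two
    h'.right.locallyIntegrable_two fun ψ => by rw [h2.pairing, h'.pairing]

theorem IsFourierPair.lintegral_sq {f g : ℝ → ℂ} (h : IsFourierPair f g) :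
    ∫⁻ s, ‖g s‖ₑ ^ 2 = ∫⁻ x, ‖f x‖ₑ ^ 2 := by
  have h1 := (isFourierPair_Lp (h.left.toLp f)).unique h h.left.coeFn_toLp
  rw [← eLpNorm_two_sq, ← eLpNorm_two_sq, ← eLpNorm_congr_ae h1,
    ← eLpNorm_congr_ae h.left.coeFn_toLp]
  have h2 := Lp.norm_fourier_eq (h.left.toLp f)
  rw [Lp.norm_def, Lp.norm_def, ENNReal.toReal_eq_toReal_iff' (Lp.memLp _).2.ne
    (Lp.memLp _).2.ne] at h2
  rw [h2]

theorem IsFourierPair.sub {f f' g g' : ℝ → ℂ} (h : IsFourierPair f g)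
    (h' : IsFourierPair f' g') : IsFourierPair (f - f') (g - g') := by
  refine ⟨h.left.sub h'.left, h.right.sub h'.right, fun ψ => ?_⟩
  simp only [Pi.sub_apply, sub_mul]
  rw [integral_sub (h.right.integrable_mul_schwartz ψ) (h'.right.integrable_mul_schwartz ψ),
    integral_sub (h.left.integrable_mul_schwartz (𝓕 ψ)) (h'.left.integrable_mul_schwartz (𝓕 ψ)),
    h.pairing, h'.pairing]

theorem IsFourierPair.add {f f' g g' : ℝ → ℂ} (h : IsFourierPair f g)
    (h' : IsFourierPair f' g') : IsFourierPair (f + f') (g + g') := by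
  refine ⟨h.left.add h'.left, h.right.add h'.right, fun ψ => ?_⟩
  simp only [Pi.add_apply, add_mul]
  rw [integral_add (h.right.integrable_mul_schwartz ψ) (h'.right.integrable_mul_schwartz ψ),
    integral_add (h.left.integrable_mul_schwartz (𝓕 ψ)) (h'.left.integrable_mul_schwartz (𝓕 ψ)),
    h.pairing, h'.pairing]

theorem IsFourierPair.smul {f g : ℝ → ℂ} (a : ℂ) (h : IsFourierPair f g) :
    IsFourierPair (a • f) (a • g) := by
  refine ⟨h.left.const_smul a, h.right.const_smul a, fun ψ => ?_⟩
  simp only [Pi.smul_apply, smul_eq_mul, mul_assoc]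
  rw [integral_const_mul, integral_const_mul, h.pairing]

theorem integral_fourier_mul_schwartz {f : ℝ → ℂ} (hf : Integrable f) (ψ : 𝓢(ℝ, ℂ)) :
    ∫ s, 𝓕 f s * ψ s = ∫ x, f x * 𝓕 ψ x := by
  simpa using! VectorFourier.integral_bilin_fourierIntegral_eq_flip (.mul ℂ ℂ) (L := innerₗ ℝ)
    Real.continuous_fourierChar continuous_inner hf ψ.integrable

theorem continuous_fourier_of_integrable {f : ℝ → ℂ} (hf : Integrable f) : Continuous (𝓕 f) :=
  VectorFourier.fourierIntegral_continuous (L := innerₗ ℝ) Real.continuous_fourierChar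
    continuous_inner hf

theorem isFourierPair_of_integrable {f : ℝ → ℂ} (hf : Integrable f) (hf2 : MemLp f 2) :
    IsFourierPair f (𝓕 f) := by
  obtain ⟨g, hg⟩ := hf2.exists_isFourierPair
  refine hg.congr .rfl (ae_eq_of_integral_mul_schwartz_eq hg.right.locallyIntegrable_two
    (continuous_fourier_of_integrable hf).locallyIntegrable fun ψ => ?_)
  rw [hg.pairing, integral_fourier_mul_schwartz hf]

/-- Transforming a Schwartz function twice reflects it, and the pairing carries this over to `L₂`.
Later inversions of the transform on `L₂` iterate this lemma. -/
theorem IsFourierPair.symm {f g : ℝ → ℂ} (h : IsFourierPair f g) :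
    IsFourierPair g (fun x => f (-x)) := by
  have hmp : MeasurePreserving (fun x : ℝ => -x) volume volume :=
    Measure.measurePreserving_neg volume
  refine ⟨h.right, h.left.comp_measurePreserving hmp, fun ψ => ?_⟩
  have h1 := h.pairing (𝓕 ψ)
  rw [h1]
  have h2 : ∀ x, 𝓕 (𝓕 ψ) x = ψ (-x) := by
    intro x
    have : (𝓕⁻ (𝓕 ψ) : 𝓢(ℝ, ℂ)) (-x) = ψ (-x) := by rw [FourierTransform.fourierInv_fourier_eq]
    rw [← this, SchwartzMap.fourierInv_coe, Real.fourierInv_eq_fourier_neg, neg_neg]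
    rfl
  simp only [h2]
  rw [← integral_neg_eq_self]
  simp

/-- The reflected `L₂` transform of `𝓕 f` is square integrable and cannot be told from `f` by
Schwartz functions, so the two agree almost everywhere. -/
theorem memLp_two_of_fourier {f : ℝ → ℂ} (hf : Integrable f) (h : MemLp (𝓕 f) 2) :
    MemLp f 2 := by
  obtain ⟨g, hg⟩ := h.exists_isFourierPair
  have hg' := hg.symm
  have h2 : MemLp (fun x => g (-x)) 2 :=
    hg.right.comp_measurePreserving (Measure.measurePreserving_neg volume)
  refine h2.ae_eq (ae_eq_of_integral_mul_schwartz_eq h2.locallyIntegrable_two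
    hf.locallyIntegrable fun ψ => ?_)
  have hψ : ∀ x, ψ x = 𝓕 (𝓕⁻ ψ) x := by
    intro x; rw [FourierTransform.fourier_fourierInv_eq]
  have h6 : ∫ x, f x * ψ x = ∫ x, f x * 𝓕 (𝓕⁻ ψ) x :=
    integral_congr_ae (.of_forall fun x => by simp only [← hψ])
  rw [h6, ← integral_fourier_mul_schwartz hf (𝓕⁻ ψ)]
  have h3 := hg.pairing (𝓕⁻ (𝓕⁻ ψ))
  have h4 : (𝓕 (𝓕⁻ (𝓕⁻ ψ)) : 𝓢(ℝ, ℂ)) = 𝓕⁻ ψ := FourierTransform.fourier_fourierInv_eq _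
  rw [h4] at h3
  rw [← h3, ← integral_neg_eq_self (fun s => g s * (𝓕⁻ (𝓕⁻ ψ) : 𝓢(ℝ, ℂ)) s)]
  refine integral_congr_ae (.of_forall fun x => ?_)
  have h5 : ∀ x, (𝓕⁻ (𝓕⁻ ψ) : 𝓢(ℝ, ℂ)) x = ψ (-x) := by
    intro x
    rw [SchwartzMap.fourierInv_coe, Real.fourierInv_eq_fourier_neg, hψ (-x)]
    rfl
  have h7 := congrArg (fun z => g (-x) * z) (h5 (-x))
  simp only [neg_neg] at h7
  exact h7.symm

/-- Covers infinite values too: if either side is finite, `f` is square integrable. The Bessel norm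
of order zero can thus be read as an `L₂` norm with no finiteness assumption. -/
theorem lintegral_fourier_sq {f : ℝ → ℂ} (hf : Integrable f) :
    ∫⁻ s, ‖𝓕 f s‖ₑ ^ 2 = ∫⁻ x, ‖f x‖ₑ ^ 2 := by
  by_cases h : MemLp f 2
  · exact (isFourierPair_of_integrable hf h).lintegral_sq
  · have h2 : ¬ MemLp (𝓕 f) 2 := fun h2 => h (memLp_two_of_fourier hf h2)
    rw [memLp_two_iff_lintegral] at h h2
    have h3 := not_and.1 h hf.1
    have h4 := not_and.1 h2 (continuous_fourier_of_integrable hf).aestronglyMeasurable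
    rw [not_lt_top_iff.1 h3, not_lt_top_iff.1 h4]

theorem besselNormSq_zero_eq {f : ℝ → ℂ} (hf : Integrable f) :
    besselNormSq 0 f = ∫⁻ x, ‖f x‖ₑ ^ 2 := by
  rw [← lintegral_fourier_sq hf]
  simp [besselNormSq]

theorem fourierInv_derivCLM_apply (η : 𝓢(ℝ, ℂ)) (s : ℝ) :
    (𝓕⁻ (SchwartzMap.derivCLM ℂ ℂ η) : 𝓢(ℝ, ℂ)) s =
      -(2 * Real.pi * Complex.I * s) * (𝓕⁻ η : 𝓢(ℝ, ℂ)) s := by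
  rw [SchwartzMap.fourierInv_coe, SchwartzMap.fourierInv_coe, Real.fourierInv_eq_fourier_neg,
    Real.fourierInv_eq_fourier_neg]
  have h : ((SchwartzMap.derivCLM ℂ ℂ η : 𝓢(ℝ, ℂ)) : ℝ → ℂ) = deriv η := by
    ext x; simp
  rw [h, Real.fourier_deriv η.integrable η.differentiable
    (by rw [← h]; exact (SchwartzMap.derivCLM ℂ ℂ η).integrable)]
  push_cast
  simp only [smul_eq_mul]
  ring

/-! ## Weak derivatives on the real line and Bessel potential norms -/

/-- Weak derivatives are tested only with compactly supported functions. Cutting `η` off by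
`χ(x/(n+1))` and letting `n → ∞` admits Schwartz functions, by dominated convergence; the term with
`χ'` carries a factor `1/(n+1)` and disappears. -/
theorem IsWeakDeriv.integral_schwartz {f g : ℝ → ℂ} (h : IsWeakDeriv univ 1 f g)
    (hf : ∀ η : 𝓢(ℝ, ℂ), Integrable fun x => f x * η x)
    (hg : ∀ η : 𝓢(ℝ, ℂ), Integrable fun x => g x * η x) (η : 𝓢(ℝ, ℂ)) :
    ∫ x, g x * η x = -∫ x, f x * SchwartzMap.derivCLM ℂ ℂ η x := by
  let χ : ContDiffBump (0 : ℝ) := ⟨1, 2, by norm_num, by norm_num⟩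
  have hχ : ContDiff ℝ ∞ χ := χ.contDiff
  obtain ⟨C, hC⟩ : ∃ C, ∀ x, ‖deriv χ x‖ ≤ C :=
    ((hχ.continuous_deriv (by simp)).bounded_above_of_compact_support χ.hasCompactSupport.deriv)
  let a : ℕ → ℝ := fun n => ((n : ℝ) + 1)⁻¹
  have ha : ∀ n, 0 < a n := fun n => by positivity
  have ha1 : ∀ n, a n ≤ 1 := fun n => inv_le_one_of_one_le₀ (by simp)
  have ha0 : Tendsto a atTop (𝓝 0) := by
    simpa [a] using tendsto_one_div_add_atTop_nhds_zero_nat (𝕜 := ℝ)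
  have haz : ∀ x : ℝ, Tendsto (fun n => a n * x) atTop (𝓝 0) := fun x => by
    simpa using ha0.mul_const x
  let ψ : ℕ → ℝ → ℂ := fun n x => (χ (a n * x) : ℂ) * η x
  have hd : ∀ n x, HasDerivAt (ψ n)
      ((a n * deriv χ (a n * x) : ℝ) * η x + (χ (a n * x) : ℂ) * deriv η x) x := by
    intro n x
    have h1 : HasDerivAt (fun x => χ (a n * x)) (a n * deriv χ (a n * x)) x := by
      have h2 : HasDerivAt χ (deriv χ (a n * x)) (a n * x) :=
        (hχ.differentiable (by simp) _).hasDerivAt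
      have h3 : HasDerivAt (fun x => a n * x) (a n) x := by
        simpa using (hasDerivAt_id x).const_mul (a n)
      rw [mul_comm]
      exact h2.comp x h3
    exact h1.ofReal_comp.mul (η.hasDerivAt x)
  have hψ : ∀ n, IsTestFun univ (ψ n) := by
    intro n
    refine ⟨?_, ?_, subset_univ _⟩
    · exact (Complex.ofRealCLM.contDiff.comp (hχ.comp (contDiff_const.mul contDiff_id))).mul
        (η.smooth ⊤)
    · have h1 : HasCompactSupport fun x => χ (a n * x) :=
        χ.hasCompactSupport.comp_homeomorph (Homeomorph.mulLeft₀ (a n) (ha n).ne')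
      exact (h1.comp_left (g := ((↑) : ℝ → ℂ)) (by simp)).mul_right
  have hrel : ∀ n, ∫ x, g x * ψ n x = -∫ x, f x * deriv (ψ n) x := by
    intro n
    have := h.2.2 (ψ n) (hψ n)
    simpa [iteratedDeriv_one] using this
  have hχ0 : χ 0 = 1 := χ.one_of_mem_closedBall (by simp [χ])
  have hχx : ∀ x : ℝ, Tendsto (fun n => ((χ (a n * x) : ℝ) : ℂ)) atTop (𝓝 1) := by
    intro x
    have h1 : Tendsto (fun n => χ (a n * x)) atTop (𝓝 1) := by
      have := (hχ.continuous.tendsto 0).comp (haz x)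
      rwa [hχ0] at this
    have h2 := (Complex.continuous_ofReal.tendsto 1).comp h1
    rwa [Complex.ofReal_one] at h2
  have hl : Tendsto (fun n => ∫ x, g x * ψ n x) atTop (𝓝 (∫ x, g x * η x)) := by
    refine tendsto_integral_of_dominated_convergence (fun x => ‖g x * η x‖)
      (fun n => ?_) (hg η).norm (fun n => .of_forall fun x => ?_) (.of_forall fun x => ?_)
    · exact (locallyIntegrableOn_univ.1 h.2.1).aestronglyMeasurable.mul
        (hψ n).1.continuous.aestronglyMeasurable
    · simp only [ψ, norm_mul, Complex.norm_real, Real.norm_eq_abs, abs_of_nonneg χ.nonneg]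
      have h1 : χ (a n * x) ≤ 1 := χ.le_one
      have h2 : 0 ≤ χ (a n * x) := χ.nonneg
      gcongr
      nlinarith [norm_nonneg (η x)]
    · simpa [ψ] using ((hχx x).mul_const (η x)).const_mul (g x)
  have hr : Tendsto (fun n => ∫ x, f x * deriv (ψ n) x) atTop
      (𝓝 (∫ x, f x * SchwartzMap.derivCLM ℂ ℂ η x)) := by
    refine tendsto_integral_of_dominated_convergence
      (fun x => C * ‖f x * η x‖ + ‖f x * SchwartzMap.derivCLM ℂ ℂ η x‖)
      (fun n => ?_) (((hf η).norm.const_mul C).add (hf _).norm)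
      (fun n => .of_forall fun x => ?_) (.of_forall fun x => ?_)
    · exact (locallyIntegrableOn_univ.1 h.1).aestronglyMeasurable.mul
        ((hψ n).1.continuous_deriv (by simp)).aestronglyMeasurable
    · rw [(hd n x).deriv, mul_add]
      refine (norm_add_le _ _).trans (add_le_add ?_ ?_)
      · rw [norm_mul, norm_mul, norm_mul, Complex.norm_real, norm_mul]
        have h1 : ‖a n‖ * ‖deriv χ (a n * x)‖ ≤ 1 * C := by
          gcongr
          · rw [Real.norm_eq_abs, abs_of_pos (ha n)]; exact ha1 n
          · exact hC _
        calc _ ≤ ‖f x‖ * (1 * C * ‖η x‖) := by gcongr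
          _ = _ := by ring
      · simp only [norm_mul, Complex.norm_real, Real.norm_eq_abs, abs_of_nonneg χ.nonneg,
          SchwartzMap.derivCLM_apply]
        have h1 : χ (a n * x) ≤ 1 := χ.le_one
        have h2 : 0 ≤ χ (a n * x) := χ.nonneg
        gcongr
        nlinarith [norm_nonneg (deriv η x)]
    · simp only [(hd _ x).deriv, SchwartzMap.derivCLM_apply]
      refine Tendsto.const_mul _ ?_
      have h1 : Tendsto (fun n => (((a n * deriv χ (a n * x) : ℝ)) : ℂ)) atTop (𝓝 0) := by
        have h2 : Tendsto (fun n => a n * deriv χ (a n * x)) atTop (𝓝 0) := by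
          have := ha0.mul (((hχ.continuous_deriv (by simp)).tendsto 0).comp (haz x))
          simpa using this
        have h3 := (Complex.continuous_ofReal.tendsto 0).comp h2
        rwa [Complex.ofReal_zero] at h3
      simpa using (h1.mul_const (η x)).add ((hχx x).mul_const (deriv η x))
  refine tendsto_nhds_unique hl ?_
  simp only [hrel]
  exact hr.neg

theorem MeasureTheory.Integrable.integrable_mul_schwartz {f : ℝ → ℂ} (hf : Integrable f)
    (η : 𝓢(ℝ, ℂ)) : Integrable fun x => f x * η x :=
  hf.mul_bdd (c := ‖η.toBoundedContinuousFunction‖) η.continuous.aestronglyMeasurable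
    (.of_forall fun x => η.toBoundedContinuousFunction.norm_coe_le_norm x)

theorem IsWeakDeriv.fourier_eq {f g : ℝ → ℂ} (h : IsWeakDeriv univ 1 f g) (hf : Integrable f)
    (hg : Integrable g) : 𝓕 g =ᵐ[volume] fun s => 2 * Real.pi * Complex.I * s * 𝓕 f s := by
  have hc : Continuous fun s : ℝ => 2 * Real.pi * Complex.I * s * 𝓕 f s := by
    have := continuous_fourier_of_integrable hf
    fun_prop
  refine ae_eq_of_integral_mul_schwartz_eq
    (continuous_fourier_of_integrable hg).locallyIntegrable hc.locallyIntegrable fun ψ => ?_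
  rw [integral_fourier_mul_schwartz hg, h.integral_schwartz hf.integrable_mul_schwartz
    hg.integrable_mul_schwartz]
  -- Writing the test function as `𝓕⁻ η` turns its transform into `η`, so that `η'` appears in the
  -- pairing and `𝓕⁻ η'` supplies the factor `-2πis`.
  obtain ⟨η, rfl⟩ : ∃ η : 𝓢(ℝ, ℂ), 𝓕⁻ η = ψ := ⟨𝓕 ψ, FourierTransform.fourierInv_fourier_eq ψ⟩
  have h1 : (𝓕 (𝓕⁻ η) : 𝓢(ℝ, ℂ)) = η := FourierTransform.fourier_fourierInv_eq η
  have h2 : (𝓕 (𝓕⁻ (SchwartzMap.derivCLM ℂ ℂ η)) : 𝓢(ℝ, ℂ)) = SchwartzMap.derivCLM ℂ ℂ η :=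
    FourierTransform.fourier_fourierInv_eq _
  have h3 := integral_fourier_mul_schwartz hf (𝓕⁻ (SchwartzMap.derivCLM ℂ ℂ η))
  rw [h2] at h3
  rw [h1, ← h3, ← integral_neg]
  refine integral_congr_ae (.of_forall fun s => ?_)
  simp only [fourierInv_derivCLM_apply]
  ring

/-- Counterpart of `IsWeakDeriv.fourier_eq` for functions of the logarithmic radial variable, which
are square integrable but need not be integrable. -/
theorem IsWeakDeriv.isFourierPair_right {f g F : ℝ → ℂ} (h : IsWeakDeriv univ 1 f g)
    (hg : MemLp g 2) (hF : IsFourierPair f F) :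
    IsFourierPair g fun s => 2 * Real.pi * Complex.I * s * F s := by
  obtain ⟨G, hG⟩ := hg.exists_isFourierPair
  have hc : Continuous fun s : ℝ => 2 * Real.pi * Complex.I * s := by fun_prop
  have hl : LocallyIntegrable fun s : ℝ => 2 * Real.pi * Complex.I * s * F s := by
    rw [← locallyIntegrableOn_univ]
    exact (locallyIntegrableOn_univ.2 hF.right.locallyIntegrable_two).continuousOn_mul
      hc.continuousOn isOpen_univ.isLocallyClosed
  refine hG.congr .rfl (ae_eq_of_integral_mul_schwartz_eq hG.right.locallyIntegrable_two
    hl fun ψ => ?_)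
  rw [hG.pairing, h.integral_schwartz hF.left.integrable_mul_schwartz hg.integrable_mul_schwartz]
  obtain ⟨η, rfl⟩ : ∃ η : 𝓢(ℝ, ℂ), 𝓕⁻ η = ψ := ⟨𝓕 ψ, FourierTransform.fourierInv_fourier_eq ψ⟩
  have h1 : (𝓕 (𝓕⁻ η) : 𝓢(ℝ, ℂ)) = η := FourierTransform.fourier_fourierInv_eq η
  have h2 : (𝓕 (𝓕⁻ (SchwartzMap.derivCLM ℂ ℂ η)) : 𝓢(ℝ, ℂ)) = SchwartzMap.derivCLM ℂ ℂ η :=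
    FourierTransform.fourier_fourierInv_eq _
  have h3 := hF.pairing (𝓕⁻ (SchwartzMap.derivCLM ℂ ℂ η))
  rw [h2] at h3
  rw [h1, ← h3, ← integral_neg]
  refine integral_congr_ae (.of_forall fun s => ?_)
  simp only [fourierInv_derivCLM_apply]
  ring

/-- With `y = 2πt` this is `(1+y²)^{m+1} = (1+y²)^m + (1+y²)^m y²`; the second part is the weight
belonging to the derivative. Raising the order by one therefore gives an identity and not merely an
equivalence of norms. -/
theorem besselWeight_succ (m : ℕ) (t : ℝ) (z : ℂ) :
    ENNReal.ofReal ((1 + (2 * Real.pi * t) ^ 2) ^ (m + 1)) * ‖z‖ₑ ^ 2 =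
      ENNReal.ofReal ((1 + (2 * Real.pi * t) ^ 2) ^ m) * ‖z‖ₑ ^ 2 +
      ENNReal.ofReal ((1 + (2 * Real.pi * t) ^ 2) ^ m) *
        ‖2 * Real.pi * Complex.I * t * z‖ₑ ^ 2 := by
  have h1 : ‖2 * Real.pi * Complex.I * t * z‖ₑ ^ 2 =
      ENNReal.ofReal ((2 * Real.pi * t) ^ 2) * ‖z‖ₑ ^ 2 := by
    rw [enorm_mul, mul_pow]
    congr 1
    rw [← ofReal_norm, ← ENNReal.ofReal_pow (norm_nonneg _)]
    congr 1
    simp [mul_pow, abs_of_pos Real.pi_pos]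
  rw [h1, pow_succ, ENNReal.ofReal_mul (by positivity), ENNReal.ofReal_add (by norm_num)
    (by positivity), ENNReal.ofReal_one]
  ring

theorem measurable_besselIntegrand (m : ℕ) {h : ℝ → ℂ} (hh : Integrable h) :
    Measurable fun t : ℝ =>
      ENNReal.ofReal ((1 + (2 * Real.pi * t) ^ 2) ^ m) * ‖𝓕 h t‖ₑ ^ 2 := by
  have := (continuous_fourier_of_integrable hh).measurable
  fun_prop

theorem IsWeakDeriv.besselNormSq_succ {f g : ℝ → ℂ} (h : IsWeakDeriv univ 1 f g)
    (hf : Integrable f) (hg : Integrable g) (m : ℕ) :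
    besselNormSq (m + 1) f = besselNormSq m f + besselNormSq m g := by
  unfold besselNormSq
  rw [← lintegral_add_left (measurable_besselIntegrand m hf)]
  refine lintegral_congr_ae ?_
  filter_upwards [h.fourier_eq hf hg] with t ht
  rw [ht, besselWeight_succ]

theorem besselNormSq_mono {m n : ℕ} (h : m ≤ n) (f : ℝ → ℂ) :
    besselNormSq m f ≤ besselNormSq n f := by
  refine lintegral_mono fun t => ?_
  gcongr
  nlinarith [sq_nonneg (2 * Real.pi * t)]

/-- The derivative is built on the Fourier side: `2πis 𝓕f` is square integrable by assumption, hence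
is itself the transform of some `g` in `L₂`. -/
theorem exists_isWeakDeriv_of_besselNormSq_lt_top {f : ℝ → ℂ} (hf : Integrable f)
    (h : besselNormSq 1 f < ⊤) : ∃ g, MemLp g 2 ∧ IsWeakDeriv univ 1 f g := by
  have hc : Continuous fun s : ℝ => 2 * Real.pi * Complex.I * s * 𝓕 f s := by
    have := continuous_fourier_of_integrable hf
    fun_prop
  have hG : MemLp (fun s : ℝ => 2 * Real.pi * Complex.I * s * 𝓕 f s) 2 := by
    refine memLp_two_iff_lintegral.2 ⟨hc.aestronglyMeasurable, lt_of_le_of_lt ?_ h⟩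
    refine lintegral_mono fun t => ?_
    have := besselWeight_succ 0 t (𝓕 f t)
    simp only [zero_add] at this
    rw [this]
    simp
  have hG' := hG.comp_measurePreserving (Measure.measurePreserving_neg (volume : Measure ℝ))
  obtain ⟨g, hg⟩ := hG'.exists_isFourierPair
  have hp := hg.symm
  simp only [Function.comp_apply, neg_neg] at hp
  refine ⟨g, hp.left, locallyIntegrableOn_univ.2 hf.locallyIntegrable,
    locallyIntegrableOn_univ.2 hp.left.locallyIntegrable_two, fun ψ hψ => ?_⟩
  obtain ⟨η, hη⟩ := exists_schwartzMap_eq hψ.1 hψ.2.1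
  have h1 : (𝓕 (𝓕⁻ η) : 𝓢(ℝ, ℂ)) = η := FourierTransform.fourier_fourierInv_eq η
  have h2 : (𝓕 (𝓕⁻ (SchwartzMap.derivCLM ℂ ℂ η)) : 𝓢(ℝ, ℂ)) = SchwartzMap.derivCLM ℂ ℂ η :=
    FourierTransform.fourier_fourierInv_eq _
  have h3 := integral_fourier_mul_schwartz hf (𝓕⁻ (SchwartzMap.derivCLM ℂ ℂ η))
  rw [h2] at h3
  have h4 := hp.pairing (𝓕⁻ η)
  rw [h1] at h4
  obtain rfl : (η : ℝ → ℂ) = ψ := funext hη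
  simp only [setIntegral_univ, iteratedDeriv_one, pow_one, neg_one_mul]
  simp only [SchwartzMap.derivCLM_apply] at h3
  rw [← h3, ← h4, ← integral_neg]
  refine integral_congr_ae (.of_forall fun s => ?_)
  simp only [fourierInv_derivCLM_apply]
  ring

/-! ## Localisation of weak derivatives -/

/-- A smooth real-valued cutoff with compact support in `O`. -/
def IsCutoff (O : Set ℝ) (ζ : ℝ → ℝ) : Prop :=
  ContDiff ℝ ∞ ζ ∧ HasCompactSupport ζ ∧ tsupport ζ ⊆ O

theorem IsCutoff.isTestFun {O : Set ℝ} {ζ : ℝ → ℝ} (h : IsCutoff O ζ) :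
    IsTestFun O fun x => (ζ x : ℂ) := by
  refine ⟨Complex.ofRealCLM.contDiff.comp h.1,
    h.2.1.comp_left (g := ((↑) : ℝ → ℂ)) (by simp), ?_⟩
  exact (closure_mono fun x hx => by simpa using hx).trans h.2.2

theorem tsupport_deriv_subset' {ζ : ℝ → ℝ} : tsupport (deriv ζ) ⊆ tsupport ζ :=
  closure_minimal support_deriv_subset (isClosed_tsupport ζ)

theorem IsCutoff.deriv {O : Set ℝ} {ζ : ℝ → ℝ} (h : IsCutoff O ζ) : IsCutoff O (deriv ζ) :=
  ⟨((contDiff_infty_iff_deriv (𝕜 := ℝ)).1 h.1).2, h.2.1.deriv, tsupport_deriv_subset'.trans h.2.2⟩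

theorem IsCutoff.integrable_mul {O : Set ℝ} {ζ : ℝ → ℝ} {f : ℝ → ℂ} (h : IsCutoff O ζ)
    (hf : LocallyIntegrableOn f O) : Integrable fun x => (ζ x : ℂ) * f x := by
  simpa [mul_comm] using h.isTestFun.integrable_mul hf

theorem IsTestFun.mul_contDiff {O : Set ℝ} {ζ ψ : ℝ → ℂ} (h : IsTestFun O ζ)
    (hψ : ContDiff ℝ ∞ ψ) : IsTestFun O fun x => ζ x * ψ x :=
  ⟨h.1.mul hψ, h.2.1.mul_right, (tsupport_mul_subset_left).trans h.2.2⟩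

theorem setIntegral_mul_isTestFun {O : Set ℝ} {ψ : ℝ → ℂ} (h : IsTestFun O ψ) (f : ℝ → ℂ) :
    ∫ x in O, f x * ψ x = ∫ x, f x * ψ x :=
  setIntegral_eq_integral_of_forall_compl_eq_zero fun x hx => by
    rw [image_eq_zero_of_notMem_tsupport fun h' => hx (h.2.2 h'), mul_zero]

theorem IsWeakDeriv.integral_one {O : Set ℝ} {f g ψ : ℝ → ℂ} (h : IsWeakDeriv O 1 f g)
    (hψ : IsTestFun O ψ) : ∫ x, g x * ψ x = -∫ x, f x * _root_.deriv ψ x := by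
  have h1 := h.2.2 ψ hψ
  rw [setIntegral_mul_isTestFun hψ, setIntegral_mul_isTestFun (hψ.iteratedDeriv 1),
    iteratedDeriv_one] at h1
  simpa using h1

theorem integral_const_mul_comp_mul_left {a : ℝ} (ha : 0 < a) (F : ℝ → ℂ) :
    ∫ x, (a : ℂ) * F (a * x) = ∫ y, F y := by
  rw [integral_const_mul, Measure.integral_comp_mul_left, abs_of_pos (inv_pos.2 ha),
    Complex.real_smul, ← mul_assoc, ← Complex.ofReal_mul, mul_inv_cancel₀ ha.ne']
  simp

theorem IsWeakDeriv.comp_mul_left {f g : ℝ → ℂ} (h : IsWeakDeriv univ 1 f g) {a : ℝ}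
    (ha : 0 < a) : IsWeakDeriv univ 1 (fun x => f (a * x)) (fun x => a * g (a * x)) := by
  have hl : ∀ {F : ℝ → ℂ}, LocallyIntegrableOn F univ →
      LocallyIntegrableOn (fun x => F (a * x)) univ := by
    intro F hF
    rw [locallyIntegrableOn_univ] at hF ⊢
    rw [locallyIntegrable_iff] at hF ⊢
    intro K hK
    have hK' : IsCompact ((fun x => a * x) '' K) := hK.image (by fun_prop)
    have h1 := hF _ hK'
    rw [← integrable_indicator_iff hK'.measurableSet] at h1
    have h2 := h1.comp_mul_left' ha.ne'
    rw [← integrable_indicator_iff hK.measurableSet]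
    refine h2.congr (.of_forall fun x => ?_)
    have h3 : a * x ∈ (fun x => a * x) '' K ↔ x ∈ K :=
      (mul_right_injective₀ ha.ne').mem_set_image
    by_cases hx : x ∈ K
    · simp [indicator, h3.2 hx, hx]
    · have h4 : a * x ∉ (fun x => a * x) '' K := fun h => hx (h3.1 h)
      change ((fun x => a * x) '' K).indicator F (a * x) = _
      rw [indicator_of_notMem h4, indicator_of_notMem hx]
  refine ⟨hl h.1, (hl h.2.1).smul (a : ℂ), fun ψ hψ => ?_⟩
  have hΨ : IsTestFun univ fun y => ψ (a⁻¹ * y) := by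
    refine ⟨hψ.1.comp (contDiff_const.mul contDiff_id), ?_, subset_univ _⟩
    exact hψ.2.1.comp_homeomorph (Homeomorph.mulLeft₀ a⁻¹ (inv_pos.2 ha).ne')
  have hΨd : ∀ y, _root_.deriv (fun y => ψ (a⁻¹ * y)) y =
      ((a⁻¹ : ℝ) : ℂ) * _root_.deriv ψ (a⁻¹ * y) := by
    intro y
    rw [deriv_comp_mul_left]
    simp
  have h1 := h.integral_one hΨ
  have hinv : ∀ x, a⁻¹ * (a * x) = x := fun x => by field_simp
  have h2 := integral_const_mul_comp_mul_left ha fun y => g y * ψ (a⁻¹ * y)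
  have h3 := integral_const_mul_comp_mul_left ha fun y =>
    f y * (((a⁻¹ : ℝ) : ℂ) * _root_.deriv ψ (a⁻¹ * y))
  simp only [hinv] at h2 h3
  simp only [setIntegral_univ, iteratedDeriv_one, pow_one, neg_one_mul, mul_assoc]
  rw [h2, h1]
  simp only [hΨd]
  rw [← h3]
  congr 1
  refine integral_congr_ae (.of_forall fun x => ?_)
  have : (a : ℂ) ≠ 0 := by exact_mod_cast ha.ne'
  push_cast
  field_simp

theorem IsWeakDeriv.cutoff {O : Set ℝ} {f g : ℝ → ℂ} {ζ : ℝ → ℝ}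
    (h : IsWeakDeriv O 1 f g) (hζ : IsCutoff O ζ) :
    IsWeakDeriv univ 1 (fun x => (ζ x : ℂ) * f x)
      (fun x => ((_root_.deriv ζ x : ℝ) : ℂ) * f x + (ζ x : ℂ) * g x) := by
  have i1 := hζ.integrable_mul h.1
  have i2 := hζ.deriv.integrable_mul h.1
  have i3 := hζ.integrable_mul h.2.1
  refine ⟨locallyIntegrableOn_univ.2 i1.locallyIntegrable,
    locallyIntegrableOn_univ.2 (i2.add i3).locallyIntegrable, fun ψ hψ => ?_⟩
  have h1 := h.integral_one (hζ.isTestFun.mul_contDiff hψ.1)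
  have hdd : ∀ y, _root_.deriv (fun y => (ζ y : ℂ) * ψ y) y =
      ((_root_.deriv ζ y : ℝ) : ℂ) * ψ y + (ζ y : ℂ) * _root_.deriv ψ y := fun y =>
    ((hζ.1.differentiable (by simp) y).hasDerivAt.ofReal_comp.mul
      (hψ.1.differentiable (by simp) y).hasDerivAt).deriv
  have iΨ : ∀ {F : ℝ → ℂ} {ξ : ℝ → ℝ}, IsCutoff O ξ → LocallyIntegrableOn F O →
      ∀ {φ : ℝ → ℂ}, ContDiff ℝ ∞ φ → Integrable fun y => ((ξ y : ℂ) * F y) * φ y := by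
    intro F ξ hξ hF φ hφ
    exact ((hξ.isTestFun.mul_contDiff hφ).integrable_mul hF).congr (.of_forall fun y => by ring)
  have hψ' : ContDiff ℝ ∞ (_root_.deriv ψ) := ((contDiff_infty_iff_deriv (𝕜 := ℝ)).1 hψ.1).2
  simp only [setIntegral_univ, iteratedDeriv_one, pow_one, neg_one_mul, add_mul]
  rw [integral_add (iΨ hζ.deriv h.1 hψ.1) (iΨ hζ h.2.1 hψ.1)]
  have h6 : ∫ y, (ζ y : ℂ) * g y * ψ y = ∫ y, g y * ((ζ y : ℂ) * ψ y) :=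
    integral_congr_ae (.of_forall fun y => by ring)
  rw [h6, h1]
  simp only [hdd]
  have h7 : ∫ y, f y * (((_root_.deriv ζ y : ℝ) : ℂ) * ψ y + (ζ y : ℂ) * _root_.deriv ψ y) =
      (∫ y, ((_root_.deriv ζ y : ℝ) : ℂ) * f y * ψ y) +
      ∫ y, (ζ y : ℂ) * f y * _root_.deriv ψ y := by
    rw [← integral_add (iΨ hζ.deriv h.1 hψ.1) (iΨ hζ h.1 hψ')]
    exact integral_congr_ae (.of_forall fun y => by ring)
  rw [h7]
  ring

theorem IsWeakDeriv.ae_eq_zero {f g : ℝ → ℂ} (h : IsWeakDeriv univ 1 f g) {U : Set ℝ}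
    (hU : IsOpen U) (hf : ∀ x ∈ U, f x = 0) : ∀ᵐ x, x ∈ U → g x = 0 := by
  refine hU.ae_eq_zero_of_integral_contDiff_smul_eq_zero
    (h.2.1.mono_set (subset_univ _)) fun η hη hc hs => ?_
  have hζ : IsCutoff U η := ⟨hη, hc, hs⟩
  have hζ' : IsCutoff univ η := ⟨hη, hc, subset_univ _⟩
  have h1 := h.integral_one hζ'.isTestFun
  simp only [Complex.real_smul]
  simp only [mul_comm] at h1 ⊢
  rw [h1, neg_eq_zero]
  refine integral_eq_zero_of_ae (.of_forall fun x => ?_)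
  by_cases hx : x ∈ U
  · simp [hf x hx]
  · have h2 : (fun x => (η x : ℂ)) =ᶠ[𝓝 x] fun _ => 0 :=
      notMem_tsupport_iff_eventuallyEq.1 fun h' => hx (hζ.isTestFun.2.2 h')
    simp [h2.deriv_eq]

theorem IsWeakDeriv.trans {O : Set ℝ} {n : ℕ} {f g h : ℝ → ℂ} (h₁ : IsWeakDeriv O n f g)
    (h₂ : IsWeakDeriv O 1 g h) : IsWeakDeriv O (n + 1) f h := by
  refine ⟨h₁.1, h₂.2.1, fun ψ hψ => ?_⟩
  rw [h₂.2.2 ψ hψ, h₁.2.2 _ (hψ.iteratedDeriv 1), iteratedDeriv_one, iteratedDeriv_succ',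
    pow_succ]
  ring

theorem IsWeakDeriv.of_trans {O : Set ℝ} {n : ℕ} {f g h : ℝ → ℂ} (h₁ : IsWeakDeriv O 1 f g)
    (h₂ : IsWeakDeriv O (n + 1) f h) : IsWeakDeriv O n g h := by
  refine ⟨h₁.2.1, h₂.2.1, fun ψ hψ => ?_⟩
  rw [h₂.2.2 ψ hψ, h₁.2.2 _ (hψ.iteratedDeriv n), iteratedDeriv_one, iteratedDeriv_succ,
    pow_succ]
  ring

theorem IsWeakDeriv.ae_eq {O : Set ℝ} (hO : IsOpen O) {n : ℕ} {f f' g g' : ℝ → ℂ}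
    (h : IsWeakDeriv O n f g) (h' : IsWeakDeriv O n f' g')
    (hf : f =ᵐ[volume.restrict O] f') : g =ᵐ[volume.restrict O] g' := by
  have h1 : ∀ᵐ x, x ∈ O → (g - g') x = 0 := by
    refine hO.ae_eq_zero_of_integral_contDiff_smul_eq_zero (h.2.1.sub h'.2.1) fun η hη hc hs => ?_
    have hζ : IsCutoff O η := ⟨hη, hc, hs⟩
    have h2 := h.2.2 _ hζ.isTestFun
    have h3 := h'.2.2 _ hζ.isTestFun
    rw [setIntegral_mul_isTestFun hζ.isTestFun] at h2 h3
    have h4 : ∫ x in O, f x * iteratedDeriv n (fun x => (η x : ℂ)) x =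
        ∫ x in O, f' x * iteratedDeriv n (fun x => (η x : ℂ)) x := by
      refine integral_congr_ae ?_
      filter_upwards [hf] with x hx
      rw [hx]
    rw [h4, ← h3] at h2
    simp only [Complex.real_smul, Pi.sub_apply, mul_sub]
    simp only [mul_comm] at h2 ⊢
    rw [integral_sub, h2, sub_self]
    · simpa only [mul_comm] using hζ.isTestFun.integrable_mul h.2.1
    · simpa only [mul_comm] using hζ.isTestFun.integrable_mul h'.2.1
  rw [EventuallyEq, ae_restrict_iff' hO.measurableSet]
  filter_upwards [h1] with x hx hxO
  exact sub_eq_zero.1 (hx hxO)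

theorem isWeakDeriv_zero_iff {O : Set ℝ} {f : ℝ → ℂ} (hf : LocallyIntegrableOn f O) :
    IsWeakDeriv O 0 f f :=
  ⟨hf, hf, fun ψ _ => by simp⟩

/-! ## Admissible families of cutoffs -/

/-- The shell `{c^(ν-k) < dist(x,∂(0,κ)) < c^(ν+k)}` of `(0,κ)`. -/
def shell (c κ : ℝ) (k : ℕ) (ν : ℤ) : Set ℝ :=
  {x | x ∈ Ioo 0 κ ∧ c ^ (ν - (k : ℤ)) < Metric.infDist x (frontier (Ioo 0 κ)) ∧
      Metric.infDist x (frontier (Ioo 0 κ)) < c ^ (ν + (k : ℤ))}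

/-- A family of cutoffs adapted to the shells, with scale-invariant derivative bounds. -/
structure IsAdm (c κ : ℝ) (k : ℕ) (ζ : ℤ → ℝ → ℝ) : Prop where
  smooth : ∀ ν, ContDiff ℝ ∞ (ζ ν)
  supp : ∀ ν, tsupport (ζ ν) ⊆ shell c κ k ν
  bound : ∀ n : ℕ, ∃ C : ℝ, ∀ ν x, |iteratedDeriv n (ζ ν) x| ≤ C * c ^ (-((n : ℤ) * ν))

theorem ApproxResolution.exists_isAdm {c κ : ℝ} (R : ApproxResolution c (Ioo 0 κ)) :
    ∃ k, IsAdm c κ k R.ξ := by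
  obtain ⟨k, hk⟩ := R.supp
  exact ⟨k, R.smooth, hk, R.deriv_bound⟩

theorem IsAdm.isCutoff {c κ : ℝ} {k : ℕ} {ζ : ℤ → ℝ → ℝ} (h : IsAdm c κ k ζ) (ν : ℤ) :
    IsCutoff (Ioo 0 κ) (ζ ν) := by
  have hs : tsupport (ζ ν) ⊆ Ioo 0 κ := fun x hx => (h.supp ν hx).1
  exact ⟨h.smooth ν, isCompact_Icc.of_isClosed_subset (isClosed_tsupport _)
    (hs.trans Ioo_subset_Icc_self), hs⟩

/-- The family `c^ν ζ_ν'`. -/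
def scaledDeriv (c : ℝ) (ζ : ℤ → ℝ → ℝ) : ℤ → ℝ → ℝ := fun ν x => c ^ ν * deriv (ζ ν) x

/-- The factor `c^ν` offsets the extra `c^{-ν}` in the bound for one more derivative, so the
derivatives again form an admissible family on the same shells. This closure drives the inductions
on the order. -/
theorem IsAdm.scaled_deriv {c κ : ℝ} (hc : 1 < c) {k : ℕ} {ζ : ℤ → ℝ → ℝ}
    (h : IsAdm c κ k ζ) : IsAdm c κ k (scaledDeriv c ζ) := by
  have hc0 : 0 < c := by linarith
  refine ⟨fun ν => contDiff_const.mul (h.isCutoff ν).deriv.1, fun ν => ?_, fun n => ?_⟩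
  · exact (tsupport_mul_subset_right.trans tsupport_deriv_subset').trans (h.supp ν)
  · obtain ⟨C, hC⟩ := h.bound (n + 1)
    refine ⟨C, fun ν x => ?_⟩
    have h1 : iteratedDeriv n (scaledDeriv c ζ ν) x =
        c ^ ν * iteratedDeriv (n + 1) (ζ ν) x := by
      rw [iteratedDeriv_succ']
      exact iteratedDeriv_const_mul_field (c ^ ν) (deriv (ζ ν))
    have hp : 0 < c ^ ν := zpow_pos hc0 ν
    rw [h1, abs_mul, abs_of_pos hp]
    calc _ ≤ c ^ ν * (C * c ^ (-(((n + 1 : ℕ) : ℤ) * ν))) := by gcongr; exact hC ν x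
      _ = C * (c ^ ν * c ^ (-(((n + 1 : ℕ) : ℤ) * ν))) := by ring
      _ = _ := by
        rw [← zpow_add₀ hc0.ne']
        congr 2
        push_cast
        ring

/-- `∑_ν c^{νσ} ‖(ζ_ν f)(c^ν ·) | H^m_2(ℝ)‖²`. -/
def famNormSq (c : ℝ) (ζ : ℤ → ℝ → ℝ) (m : ℕ) (σ : ℝ) (f : ℝ → ℂ) : ℝ≥0∞ :=
  ∑' ν : ℤ, ENNReal.ofReal (c ^ ((ν : ℝ) * σ)) *
    besselNormSq m (fun x => (ζ ν (c ^ ν * x) : ℂ) * f (c ^ ν * x))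

theorem sobNormSq_eq_famNormSq {c κ : ℝ} (R : ApproxResolution c (Ioo 0 κ)) (m : ℕ) (σ : ℝ)
    {f : ℝ → ℂ} (hf : LocallyIntegrableOn f (Ioo 0 κ)) :
    sobNormSq R m σ f = famNormSq c R.ξ m σ f := by
  simp only [sobNormSq, hf, if_true]
  rfl

theorem famNormSq_mono (c : ℝ) (ζ : ℤ → ℝ → ℝ) {m n : ℕ} (h : m ≤ n) (σ : ℝ) (f : ℝ → ℂ) :
    famNormSq c ζ m σ f ≤ famNormSq c ζ n σ f :=
  ENNReal.tsum_le_tsum fun _ => mul_le_mul_right (besselNormSq_mono h _) _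

/-! ### Geometry of the shells -/

theorem shell_index_lt {c κ : ℝ} (hc : 1 < c) {k : ℕ} {ν μ : ℤ} {x : ℝ}
    (h : x ∈ shell c κ k ν) (h' : x ∈ shell c κ k μ) : ν < μ + 2 * k := by
  have := (zpow_lt_zpow_iff_right₀ hc).1 (h.2.1.trans h'.2.2)
  omega

/-- On a compact subset the distance to the boundary lies between two positive constants, so only
finitely many shells meet it and sums over `ν` become finite sums. -/
theorem exists_finset_shell {c κ : ℝ} (hc : 1 < c) (k : ℕ) {K : Set ℝ} (hK : IsCompact K)
    (hKI : K ⊆ Ioo 0 κ) : ∃ F : Finset ℤ, ∀ ν ∉ F, ∀ x ∈ K, x ∉ shell c κ k ν := by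
  rcases K.eq_empty_or_nonempty with rfl | hne
  · exact ⟨∅, by simp⟩
  have hκ : 0 < κ := by obtain ⟨x, hx⟩ := hne; exact (hKI hx).1.trans (hKI hx).2
  have hfr := frontier_Ioo hκ
  have hcont : Continuous fun x : ℝ => Metric.infDist x (frontier (Ioo 0 κ)) :=
    Metric.continuous_infDist_pt _
  obtain ⟨a, haK, ha⟩ := hK.exists_isMinOn hne hcont.continuousOn
  obtain ⟨b, hbK, hb⟩ := hK.exists_isMaxOn hne hcont.continuousOn
  have hpos : 0 < Metric.infDist a (frontier (Ioo 0 κ)) := by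
    refine (isClosed_frontier.notMem_iff_infDist_pos ?_).1 ?_
    · rw [hfr]; exact ⟨0, by simp⟩
    · rw [hfr]
      rintro (h | h)
      · exact (hKI haK).1.ne' h
      · exact (hKI haK).2.ne h
  obtain ⟨n, hn⟩ := pow_unbounded_of_one_lt (Metric.infDist b (frontier (Ioo 0 κ))) hc
  obtain ⟨n', hn'⟩ := pow_unbounded_of_one_lt (Metric.infDist a (frontier (Ioo 0 κ)))⁻¹ hc
  refine ⟨Finset.Icc (-(n' : ℤ) - k) (n + k), fun ν hν x hx hs => hν ?_⟩
  have h1 : c ^ (ν - (k : ℤ)) < c ^ (n : ℤ) := by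
    rw [zpow_natCast]; exact (hs.2.1.trans_le (hb hx)).trans hn
  have h2 : c ^ (-(n' : ℤ)) < c ^ (ν + (k : ℤ)) := by
    rw [zpow_neg, zpow_natCast]
    exact (inv_lt_of_inv_lt₀ hpos hn').trans ((show _ ≤ _ from ha hx).trans_lt hs.2.2)
  have h3 := (zpow_lt_zpow_iff_right₀ hc).1 h1
  have h4 := (zpow_lt_zpow_iff_right₀ hc).1 h2
  rw [Finset.mem_Icc]
  omega

theorem IsAdm.eq_zero {c κ : ℝ} {k : ℕ} {ζ : ℤ → ℝ → ℝ} (h : IsAdm c κ k ζ) {ν : ℤ} {x : ℝ}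
    (hx : x ∉ shell c κ k ν) : ζ ν x = 0 :=
  image_eq_zero_of_notMem_tsupport fun h' => hx (h.supp ν h')

theorem IsAdm.tsum_eq {c κ : ℝ} {k : ℕ} {ζ : ℤ → ℝ → ℝ} (h : IsAdm c κ k ζ)
    {F : Finset ℤ} {x : ℝ} (hF : ∀ ν ∉ F, x ∉ shell c κ k ν) :
    ∑' ν, ζ ν x = ∑ ν ∈ F, ζ ν x :=
  tsum_eq_sum fun ν hν => h.eq_zero (hF ν hν)

theorem mem_Icc_of_shell {c κ : ℝ} (hc : 1 < c) {k : ℕ} {ν μ : ℤ} {x : ℝ}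
    (h : x ∈ shell c κ k ν) (h' : x ∈ shell c κ k μ) :
    ν ∈ Finset.Icc (μ - 2 * k) (μ + 2 * k) := by
  rw [Finset.mem_Icc]
  have h1 := shell_index_lt hc h h'
  have h2 := shell_index_lt hc h' h
  omega

/-- At most `4k+1` functions are non-zero at a given point, so a sum of at least `δ` forces one of
them to be at least `δ/(4k+1)`. -/
theorem ApproxResolution.exists_lower {c κ : ℝ} (R : ApproxResolution c (Ioo 0 κ)) :
    ∃ δ : ℝ, 0 < δ ∧ ∀ x ∈ Ioo 0 κ, ∃ μ, δ ≤ |R.ξ μ x| := by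
  obtain ⟨δ, hδ, h⟩ := R.lower_bound
  obtain ⟨k, hk⟩ := R.exists_isAdm
  refine ⟨δ / (4 * k + 1), by positivity, fun x hx => ?_⟩
  by_contra! hcon
  have h1 := h x hx
  have hex : ∃ μ, x ∈ shell c κ k μ := by
    by_contra! hno
    rw [hk.tsum_eq (F := ∅) (fun ν _ => hno ν), Finset.sum_empty] at h1
    linarith
  obtain ⟨μ, hμ⟩ := hex
  have hF : ∀ ν ∉ Finset.Icc (μ - 2 * k) (μ + 2 * k), x ∉ shell c κ k ν :=
    fun ν hν hs => hν (mem_Icc_of_shell R.one_lt hs hμ)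
  rw [hk.tsum_eq hF] at h1
  have h2 : ∑ ν ∈ Finset.Icc (μ - 2 * (k : ℤ)) (μ + 2 * k), R.ξ ν x <
      ∑ ν ∈ Finset.Icc (μ - 2 * (k : ℤ)) (μ + 2 * k), δ / (4 * k + 1) := by
    refine Finset.sum_lt_sum_of_nonempty ⟨μ, by simp⟩ fun ν _ => ?_
    exact (le_abs_self _).trans_lt (hcon ν)
  rw [Finset.sum_const, Int.card_Icc, nsmul_eq_mul] at h2
  have h3 : ((μ + 2 * (k : ℤ) + 1 - (μ - 2 * k)).toNat : ℝ) = 4 * k + 1 := by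
    have : (μ + 2 * (k : ℤ) + 1 - (μ - 2 * k)).toNat = 4 * k + 1 := by omega
    rw [this]; push_cast; ring
  rw [h3, mul_div_cancel₀ _ (by positivity)] at h2
  linarith

/-! ### The case of order zero -/

/-- The density of the norm `famNormSq` of order zero. -/
def famWt (c : ℝ) (ζ : ℤ → ℝ → ℝ) (σ : ℝ) (φ : ℝ) : ℝ≥0∞ :=
  ∑' ν : ℤ, ENNReal.ofReal (c ^ ((ν : ℝ) * (σ - 1))) * ‖ζ ν φ‖ₑ ^ 2

theorem measurable_famWt {c κ : ℝ} {k : ℕ} {ζ : ℤ → ℝ → ℝ} (h : IsAdm c κ k ζ) (σ : ℝ) :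
    Measurable (famWt c ζ σ) :=
  Measurable.tsum fun ν => by
    have := (h.smooth ν).continuous.measurable
    fun_prop

theorem lintegral_comp_const_mul {a : ℝ} (ha : 0 < a) (f : ℝ → ℝ≥0∞) :
    ∫⁻ x, f (a * x) = ENNReal.ofReal a⁻¹ * ∫⁻ x, f x := by
  have h1 := lintegral_map_equiv (μ := volume) f (Homeomorph.mulLeft₀ a ha.ne').toMeasurableEquiv
  have h2 : Measure.map (Homeomorph.mulLeft₀ a ha.ne').toMeasurableEquiv volume =
      ENNReal.ofReal |a⁻¹| • volume := Real.map_volume_mul_left ha.ne'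
  rw [h2, lintegral_smul_measure, abs_of_pos (inv_pos.2 ha)] at h1
  exact h1.symm

theorem enorm_ofReal_complex (x : ℝ) : ‖(x : ℂ)‖ₑ = ‖x‖ₑ := by
  rw [← ofReal_norm, ← ofReal_norm, Complex.norm_real]

theorem IsAdm.integrable_piece {c κ : ℝ} (hc : 1 < c) {k : ℕ} {ζ : ℤ → ℝ → ℝ}
    (h : IsAdm c κ k ζ) {f : ℝ → ℂ} (hf : LocallyIntegrableOn f (Ioo 0 κ)) (ν : ℤ) :
    Integrable fun x => (ζ ν (c ^ ν * x) : ℂ) * f (c ^ ν * x) :=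
  ((h.isCutoff ν).integrable_mul hf).comp_mul_left' (zpow_pos (by linarith) ν).ne'

/-- Plancherel makes each summand an `L₂` norm, and undoing the dilation costs a Jacobian `c^{-ν}`,
whence the exponent `ν(σ-1)` in `famWt`. -/
theorem IsAdm.famNormSq_zero_eq {c κ : ℝ} (hc : 1 < c) {k : ℕ} {ζ : ℤ → ℝ → ℝ}
    (h : IsAdm c κ k ζ) (σ : ℝ) {f : ℝ → ℂ} (hf : LocallyIntegrableOn f (Ioo 0 κ)) :
    famNormSq c ζ 0 σ f = ∫⁻ φ in Ioo 0 κ, famWt c ζ σ φ * ‖f φ‖ₑ ^ 2 := by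
  have hc0 : 0 < c := by linarith
  have h0 : ∫⁻ φ in Ioo 0 κ, famWt c ζ σ φ * ‖f φ‖ₑ ^ 2 = ∫⁻ φ, famWt c ζ σ φ * ‖f φ‖ₑ ^ 2 := by
    refine setLIntegral_eq_of_support_subset fun φ hφ => ?_
    by_contra hn
    apply hφ
    have : famWt c ζ σ φ = 0 := by
      rw [famWt]
      refine ENNReal.tsum_eq_zero.2 fun ν => ?_
      rw [h.eq_zero (fun hs => hn hs.1)]
      simp
    simp [this]
  rw [h0]
  simp only [famWt, ← ENNReal.tsum_mul_right]
  rw [lintegral_tsum]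
  · refine tsum_congr fun ν => ?_
    rw [besselNormSq_zero_eq (h.integrable_piece hc hf ν),
      lintegral_comp_const_mul (zpow_pos hc0 ν) (fun y => ‖(ζ ν y : ℂ) * f y‖ₑ ^ 2), ← mul_assoc,
      ← ENNReal.ofReal_mul (by positivity), ← lintegral_const_mul' _ _ (by simp)]
    refine lintegral_congr fun φ => ?_
    rw [enorm_mul, mul_pow, ← mul_assoc, enorm_ofReal_complex]
    congr 3
    rw [← zpow_neg, ← Real.rpow_intCast, ← Real.rpow_add hc0]
    congr 1
    push_cast
    ring
  · intro ν
    have h1 := ((h.isCutoff ν).integrable_mul hf).aestronglyMeasurable.enorm.pow_const 2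
    refine (h1.const_mul (ENNReal.ofReal (c ^ ((ν : ℝ) * (σ - 1))))).congr
      (.of_forall fun φ => ?_)
    simp only [enorm_mul, mul_pow, enorm_ofReal_complex, mul_assoc]

theorem IsAdm.exists_famWt_le {c κ : ℝ} (R : ApproxResolution c (Ioo 0 κ)) {k : ℕ}
    (hk : IsAdm c κ k R.ξ) {ζ : ℤ → ℝ → ℝ} (h : IsAdm c κ k ζ) (σ : ℝ) :
    ∃ C : ℝ≥0, ∀ φ, famWt c ζ σ φ ≤ C * famWt c R.ξ σ φ := by
  have hc := R.one_lt
  have hc0 : 0 < c := by linarith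
  obtain ⟨δ, hδ, hlow⟩ := R.exists_lower
  obtain ⟨B, hB⟩ := h.bound 0
  simp only [iteratedDeriv_zero, Nat.cast_zero, zero_mul, neg_zero, zpow_zero, mul_one] at hB
  have hB0 : 0 ≤ B := (abs_nonneg _).trans (hB 0 0)
  -- All indices active at `φ` differ by less than `2k` from an index `μ` with `|ξ_μ(φ)| ≥ δ`. The
  -- power of `c` pays for the change of index, `B²/δ²` for the change of cutoff; `4k+1` bounds the
  -- number of summands.
  let D : ℝ := c ^ (2 * (k : ℝ) * |σ - 1|) * B ^ 2 / δ ^ 2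
  have hD : 0 ≤ D := by positivity
  refine ⟨(4 * k + 1 : ℕ) * D.toNNReal, fun φ => ?_⟩
  by_cases hφ : φ ∈ Ioo 0 κ
  swap
  · have : famWt c ζ σ φ = 0 := by
      refine ENNReal.tsum_eq_zero.2 fun ν => ?_
      rw [h.eq_zero (fun hs => hφ hs.1)]
      simp
    rw [this]
    exact zero_le
  obtain ⟨μ, hμ⟩ := hlow φ hφ
  have hsμ : φ ∈ shell c κ k μ := by
    by_contra hn
    rw [hk.eq_zero hn, abs_zero] at hμ
    linarith
  have hterm : ∀ ν : ℤ, ENNReal.ofReal (c ^ ((ν : ℝ) * (σ - 1))) * ‖ζ ν φ‖ₑ ^ 2 ≤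
      D.toNNReal * famWt c R.ξ σ φ := by
    intro ν
    by_cases hsν : φ ∈ shell c κ k ν
    swap
    · rw [h.eq_zero hsν]; simp
    have h1 : ENNReal.ofReal (c ^ ((μ : ℝ) * (σ - 1))) * ‖R.ξ μ φ‖ₑ ^ 2 ≤ famWt c R.ξ σ φ :=
      ENNReal.le_tsum (f := fun ν : ℤ =>
        ENNReal.ofReal (c ^ ((ν : ℝ) * (σ - 1))) * ‖R.ξ ν φ‖ₑ ^ 2) μ
    refine le_trans ?_ (mul_le_mul_right h1 _)
    have e : ∀ z : ℝ, ‖z‖ₑ ^ 2 = ENNReal.ofReal (|z| ^ 2) := fun z => by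
      rw [← ofReal_norm, ← ENNReal.ofReal_pow (norm_nonneg _), Real.norm_eq_abs]
    rw [e, e, ← ENNReal.ofReal_mul (by positivity), ← ENNReal.ofReal_mul (by positivity),
      show (D.toNNReal : ℝ≥0∞) = ENNReal.ofReal D from rfl, ← ENNReal.ofReal_mul hD]
    apply ENNReal.ofReal_le_ofReal
    have h2 : c ^ ((ν : ℝ) * (σ - 1)) ≤
        c ^ (2 * (k : ℝ) * |σ - 1|) * c ^ ((μ : ℝ) * (σ - 1)) := by
      rw [← Real.rpow_add hc0]
      refine Real.rpow_le_rpow_of_exponent_le hc.le ?_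
      have h3 : |(ν : ℝ) - μ| ≤ 2 * k := by
        have h4 := shell_index_lt hc hsν hsμ
        have h5 := shell_index_lt hc hsμ hsν
        have h4' : (ν : ℝ) < μ + 2 * k := by exact_mod_cast h4
        have h5' : (μ : ℝ) < ν + 2 * k := by exact_mod_cast h5
        rw [abs_le]; constructor <;> linarith
      have h6 : ((ν : ℝ) - μ) * (σ - 1) ≤ 2 * k * |σ - 1| :=
        (le_abs_self _).trans (by rw [abs_mul]; gcongr)
      linarith
    have h7 : |ζ ν φ| ^ 2 ≤ B ^ 2 := by gcongr; exact hB ν φ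
    have h8 : 1 ≤ |R.ξ μ φ| ^ 2 / δ ^ 2 := by
      rw [one_le_div (by positivity)]; gcongr
    calc c ^ ((ν : ℝ) * (σ - 1)) * |ζ ν φ| ^ 2
        ≤ (c ^ (2 * (k : ℝ) * |σ - 1|) * c ^ ((μ : ℝ) * (σ - 1))) * B ^ 2 := by gcongr
      _ ≤ (c ^ (2 * (k : ℝ) * |σ - 1|) * c ^ ((μ : ℝ) * (σ - 1))) * B ^ 2 *
          (|R.ξ μ φ| ^ 2 / δ ^ 2) := le_mul_of_one_le_right (by positivity) h8
      _ = D * (c ^ ((μ : ℝ) * (σ - 1)) * |R.ξ μ φ| ^ 2) := by simp only [D]; ring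
  have hsum : famWt c ζ σ φ = ∑ ν ∈ Finset.Icc (μ - 2 * (k : ℤ)) (μ + 2 * k),
      ENNReal.ofReal (c ^ ((ν : ℝ) * (σ - 1))) * ‖ζ ν φ‖ₑ ^ 2 := by
    refine tsum_eq_sum fun ν hν => ?_
    rw [h.eq_zero (fun hs => hν (mem_Icc_of_shell hc hs hsμ))]
    simp
  rw [hsum]
  refine (Finset.sum_le_card_nsmul _ _ _ fun ν _ => hterm ν).trans (le_of_eq ?_)
  rw [Int.card_Icc, nsmul_eq_mul]
  have : (μ + 2 * (k : ℤ) + 1 - (μ - 2 * k)).toNat = 4 * k + 1 := by omega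
  rw [this]
  push_cast
  ring

/-- Only finitely many weights `c^{ν(σ-1)}` are involved on a compact set. The bound turns a finite
weighted norm into local square integrability. -/
theorem ApproxResolution.exists_famWt_lower {c κ : ℝ} (R : ApproxResolution c (Ioo 0 κ))
    (σ : ℝ) {K : Set ℝ} (hK : IsCompact K) (hKI : K ⊆ Ioo 0 κ) :
    ∃ ε : ℝ≥0, 0 < ε ∧ ∀ φ ∈ K, (ε : ℝ≥0∞) ≤ famWt c R.ξ σ φ := by
  have hc := R.one_lt
  have hc0 : 0 < c := by linarith
  obtain ⟨δ, hδ, hlow⟩ := R.exists_lower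
  obtain ⟨k, hk⟩ := R.exists_isAdm
  obtain ⟨F, hF⟩ := exists_finset_shell hc k hK hKI
  obtain ⟨m, hm, hmF⟩ : ∃ m : ℝ, 0 < m ∧ ∀ ν ∈ F, m ≤ c ^ ((ν : ℝ) * (σ - 1)) := by
    rcases F.eq_empty_or_nonempty with rfl | hne
    · exact ⟨1, one_pos, by simp⟩
    · obtain ⟨a, _, ha⟩ := F.exists_min_image (fun ν : ℤ => c ^ ((ν : ℝ) * (σ - 1))) hne
      exact ⟨_, by positivity, ha⟩
  refine ⟨(m * δ ^ 2).toNNReal, by simp only [Real.toNNReal_pos]; positivity, fun φ hφ => ?_⟩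
  obtain ⟨μ, hμ⟩ := hlow φ (hKI hφ)
  have hμF : μ ∈ F := by
    by_contra hn
    rw [hk.eq_zero (hF μ hn φ hφ), abs_zero] at hμ
    linarith
  have h1 : ENNReal.ofReal (c ^ ((μ : ℝ) * (σ - 1))) * ‖R.ξ μ φ‖ₑ ^ 2 ≤ famWt c R.ξ σ φ :=
    ENNReal.le_tsum (f := fun ν : ℤ =>
      ENNReal.ofReal (c ^ ((ν : ℝ) * (σ - 1))) * ‖R.ξ ν φ‖ₑ ^ 2) μ
  refine le_trans ?_ h1
  rw [← ofReal_norm, ← ENNReal.ofReal_pow (norm_nonneg _), Real.norm_eq_abs,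
    ← ENNReal.ofReal_mul (by positivity)]
  change ENNReal.ofReal _ ≤ _
  apply ENNReal.ofReal_le_ofReal
  have := hmF μ hμF
  gcongr

theorem ApproxResolution.famWt_ne_zero {c κ : ℝ} (R : ApproxResolution c (Ioo 0 κ))
    (σ : ℝ) {φ : ℝ} (hφ : φ ∈ Ioo 0 κ) : famWt c R.ξ σ φ ≠ 0 := by
  obtain ⟨ε, hε, h⟩ := R.exists_famWt_lower σ isCompact_singleton (singleton_subset_iff.2 hφ)
  exact ((ENNReal.coe_pos.2 hε).trans_le (h φ rfl)).ne'

/-! ## Weighted Sobolev norms and weak derivatives -/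

theorem besselNormSq_sub_le (m : ℕ) {f g : ℝ → ℂ} (hf : Integrable f) (hg : Integrable g) :
    besselNormSq m (f - g) ≤ 2 * besselNormSq m f + 2 * besselNormSq m g := by
  have h := besselNormSq_add_le m hf (hg.smul (-1 : ℂ))
  rw [besselNormSq_smul] at h
  simpa [sub_eq_add_neg] using h

/-! ### Gaining and losing one derivative in the weighted norms. -/

section Step

variable {c κ : ℝ} {k : ℕ} {ζ : ℤ → ℝ → ℝ} {f g : ℝ → ℂ}

/-- The weak derivative of a rescaled localised piece. -/
theorem IsAdm.isWeakDeriv_piece (hc : 1 < c) (h : IsAdm c κ k ζ)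
    (hfg : IsWeakDeriv (Ioo 0 κ) 1 f g) (ν : ℤ) :
    IsWeakDeriv univ 1 (fun x => (ζ ν (c ^ ν * x) : ℂ) * f (c ^ ν * x))
      ((fun x => (scaledDeriv c ζ ν (c ^ ν * x) : ℂ) * f (c ^ ν * x)) +
        ((c ^ ν : ℝ) : ℂ) • fun x => (ζ ν (c ^ ν * x) : ℂ) * g (c ^ ν * x)) := by
  have h1 := (hfg.cutoff (h.isCutoff ν)).comp_mul_left (zpow_pos (by linarith : 0 < c) ν)
  convert h1 using 1
  funext x
  simp only [Pi.add_apply, Pi.smul_apply, smul_eq_mul, scaledDeriv]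
  push_cast
  ring

/-- Differentiating a piece dilated by `c^ν` produces a factor `c^ν`, whose square is exactly the
shift of the weight from `σ` to `σ + 2`. -/
theorem ofReal_rpow_mul_enorm_zpow_sq (hc : 1 < c) (ν : ℤ) (σ : ℝ) :
    ENNReal.ofReal (c ^ ((ν : ℝ) * σ)) * ‖((c ^ ν : ℝ) : ℂ)‖ₑ ^ 2 =
      ENNReal.ofReal (c ^ ((ν : ℝ) * (σ + 2))) := by
  have hc0 : 0 < c := by linarith
  have hp : 0 < c ^ ν := zpow_pos hc0 ν
  rw [enorm_ofReal_complex, ← ofReal_norm, ← ENNReal.ofReal_pow (norm_nonneg _), Real.norm_eq_abs,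
    abs_of_pos hp, ← ENNReal.ofReal_mul (by positivity)]
  congr 1
  rw [← Real.rpow_intCast, ← Real.rpow_natCast, ← Real.rpow_mul hc0.le, ← Real.rpow_add hc0]
  congr 1
  push_cast
  ring

/-- The exact formula `IsWeakDeriv.besselNormSq_succ` is applied to each piece, whose derivative
splits by the Leibniz rule. Here that derivative is bounded by its two terms; in
`IsAdm.famNormSq_deriv_le` it is solved for the term containing `g`. -/
theorem IsAdm.famNormSq_succ_le (hc : 1 < c) (h : IsAdm c κ k ζ)
    (hfg : IsWeakDeriv (Ioo 0 κ) 1 f g) (m : ℕ) (σ : ℝ) :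
    famNormSq c ζ (m + 1) σ f ≤ famNormSq c ζ m σ f +
      (2 * famNormSq c (scaledDeriv c ζ) m σ f + 2 * famNormSq c ζ m (σ + 2) g) := by
  simp only [famNormSq]
  rw [← ENNReal.tsum_mul_left, ← ENNReal.tsum_mul_left, ← ENNReal.tsum_add, ← ENNReal.tsum_add]
  refine ENNReal.tsum_le_tsum fun ν => ?_
  have i1 := h.integrable_piece hc hfg.1 ν
  have i2 := (h.scaled_deriv hc).integrable_piece hc hfg.1 ν
  have i3 := (h.integrable_piece hc hfg.2.1 ν).smul ((c ^ ν : ℝ) : ℂ)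
  rw [(h.isWeakDeriv_piece hc hfg ν).besselNormSq_succ i1 (i2.add i3) m, mul_add,
    ← ofReal_rpow_mul_enorm_zpow_sq hc]
  gcongr
  refine (mul_le_mul_right (besselNormSq_add_le m i2 i3) _).trans (le_of_eq ?_)
  rw [besselNormSq_smul]
  ring

theorem IsAdm.famNormSq_deriv_le (hc : 1 < c) (h : IsAdm c κ k ζ)
    (hfg : IsWeakDeriv (Ioo 0 κ) 1 f g) (m : ℕ) (σ : ℝ) :
    famNormSq c ζ m (σ + 2) g ≤
      2 * famNormSq c ζ (m + 1) σ f + 2 * famNormSq c (scaledDeriv c ζ) m σ f := by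
  simp only [famNormSq]
  rw [← ENNReal.tsum_mul_left, ← ENNReal.tsum_mul_left, ← ENNReal.tsum_add]
  refine ENNReal.tsum_le_tsum fun ν => ?_
  have i1 := h.integrable_piece hc hfg.1 ν
  have i2 := (h.scaled_deriv hc).integrable_piece hc hfg.1 ν
  have i3 := (h.integrable_piece hc hfg.2.1 ν).smul ((c ^ ν : ℝ) : ℂ)
  rw [(h.isWeakDeriv_piece hc hfg ν).besselNormSq_succ i1 (i2.add i3) m,
    ← ofReal_rpow_mul_enorm_zpow_sq hc, mul_assoc, ← besselNormSq_smul]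
  have h1 := besselNormSq_sub_le m (i2.add i3) i2
  rw [add_sub_cancel_left] at h1
  refine (mul_le_mul_right h1 _).trans ?_
  rw [mul_add, ← mul_assoc, ← mul_assoc, mul_comm _ 2, mul_assoc, mul_assoc]
  gcongr
  exact le_add_self

end Step

theorem isTestFun_div {ψ : ℝ → ℂ} {O : Set ℝ} (hψ : IsTestFun O ψ) {Ξ : ℝ → ℝ}
    (hΞ : ContDiff ℝ ∞ Ξ) (h0 : ∀ x ∈ tsupport ψ, Ξ x ≠ 0) :
    IsTestFun O fun x => ψ x / (Ξ x : ℂ) := by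
  have hs : tsupport (fun x => ψ x / (Ξ x : ℂ)) ⊆ tsupport ψ := by
    refine closure_mono fun x hx => ?_
    simp only [Function.mem_support] at hx ⊢
    intro h
    simp [h] at hx
  refine ⟨?_, hψ.2.1.of_isClosed_subset (isClosed_tsupport _) hs, hs.trans hψ.2.2⟩
  rw [contDiff_iff_contDiffAt]
  intro x
  by_cases hx : x ∈ tsupport ψ
  · have h1 : ContDiffAt ℝ ∞ (fun x => (Ξ x : ℂ)) x :=
      (Complex.ofRealCLM.contDiff.comp hΞ).contDiffAt
    simp only [div_eq_mul_inv]
    exact hψ.1.contDiffAt.mul (h1.inv (by simpa using h0 x hx))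
  · have h1 := notMem_tsupport_iff_eventuallyEq.1 hx
    have h2 : (fun x => ψ x / (Ξ x : ℂ)) =ᶠ[𝓝 x] fun _ => 0 := by
      filter_upwards [h1] with y hy
      simp [hy]
    exact contDiffAt_const.congr_of_eventuallyEq h2

/-- Gluing the weak derivatives of the localised pieces. -/
theorem ApproxResolution.exists_isWeakDeriv_of_pieces {c κ : ℝ}
    (R : ApproxResolution c (Ioo 0 κ)) {f : ℝ → ℂ} (hf : LocallyIntegrableOn f (Ioo 0 κ))
    (h : ∀ ν, ∃ q, IsWeakDeriv univ 1 (fun x => (R.ξ ν x : ℂ) * f x) q) :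
    ∃ g, IsWeakDeriv (Ioo 0 κ) 1 f g := by
  obtain ⟨k, hk⟩ := R.exists_isAdm
  choose q hq using h
  obtain ⟨δ, hδ, hlow⟩ := R.lower_bound
  -- Formally `T ν = ξ_ν f'`, so that division by `∑ ξ_ν` recovers `f'`. The indicator alters `q ν`
  -- only on a null set, but makes the sum over `ν` locally finite at every point.
  let T : ℤ → ℝ → ℂ := fun ν x =>
    (tsupport (R.ξ ν)).indicator (q ν) x - ((deriv (R.ξ ν) x : ℝ) : ℂ) * f x
  let g : ℝ → ℂ := fun x => (∑' ν, T ν x) / ((∑' ν, R.ξ ν x : ℝ) : ℂ)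
  have hT0 : ∀ {ν x}, x ∉ shell c κ k ν → T ν x = 0 := by
    intro ν x hx
    have h1 : x ∉ tsupport (R.ξ ν) := fun h' => hx (hk.supp ν h')
    have h2 : deriv (R.ξ ν) x = 0 :=
      image_eq_zero_of_notMem_tsupport fun h' => h1 (tsupport_deriv_subset' h')
    simp [T, h1, h2]
  have hg : ∀ {F : Finset ℤ} {x : ℝ}, (∀ ν ∉ F, x ∉ shell c κ k ν) →
      g x = (∑ ν ∈ F, T ν x) / ((∑ ν ∈ F, R.ξ ν x : ℝ) : ℂ) := by
    intro F x hF
    simp only [g]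
    rw [hk.tsum_eq hF, tsum_eq_sum fun ν hν => hT0 (hF ν hν)]
  have hpos : ∀ {F : Finset ℤ} {x : ℝ}, x ∈ Ioo 0 κ → (∀ ν ∉ F, x ∉ shell c κ k ν) →
      (∑ ν ∈ F, R.ξ ν x) ≠ 0 := by
    intro F x hx hF
    have := hlow x hx
    rw [hk.tsum_eq hF] at this
    linarith
  have hsm : ∀ F : Finset ℤ, ContDiff ℝ ∞ fun x => ∑ ν ∈ F, R.ξ ν x :=
    fun F => ContDiff.sum fun ν _ => R.smooth ν
  have hql : ∀ ν, LocallyIntegrable (q ν) := fun ν => locallyIntegrableOn_univ.1 (hq ν).2.1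
  refine ⟨g, hf, ?_, fun ψ hψ => ?_⟩
  · rw [locallyIntegrableOn_iff isOpen_Ioo.isLocallyClosed]
    intro K hKI hK
    obtain ⟨F, hF⟩ := exists_finset_shell R.one_lt k hK hKI
    have h1 : IntegrableOn (fun x => ∑ ν ∈ F, T ν x) K := by
      refine integrable_finsetSum _ fun ν _ => ?_
      refine Integrable.sub ?_ ?_
      · exact ((hql ν).integrableOn_isCompact hK).integrable.indicator
          (isClosed_tsupport _).measurableSet
      · exact ((hk.isCutoff ν).deriv.integrable_mul hf).integrableOn
    have hcont : ContinuousOn (fun x => (((∑ ν ∈ F, R.ξ ν x : ℝ) : ℂ))⁻¹) K := by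
      refine ContinuousOn.inv₀ ?_ fun x hx => ?_
      · exact (Complex.continuous_ofReal.comp (hsm F).continuous).continuousOn
      · exact_mod_cast hpos (hKI hx) (fun ν hν => hF ν hν x hx)
    refine (h1.mul_continuousOn hcont hK).congr_fun (fun x hx => ?_) hK.measurableSet
    simp only
    rw [hg (fun ν hν => hF ν hν x hx), div_eq_mul_inv]
  · obtain ⟨F, hF⟩ := exists_finset_shell R.one_lt k hψ.2.1 hψ.2.2
    have h0 : ∀ x ∈ tsupport ψ, (∑ ν ∈ F, R.ξ ν x) ≠ 0 := fun x hx =>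
      hpos (hψ.2.2 hx) fun ν hν => hF ν hν x hx
    have hχ := isTestFun_div hψ (hsm F) h0
    -- Dividing by the sum of the cutoffs, which does not vanish on the support of `ψ`, writes `ψ =
    -- ∑ ξ_ν χ`, and each piece can then be tested with the same `χ`.
    set χ : ℝ → ℂ := fun x => ψ x / ((∑ ν ∈ F, R.ξ ν x : ℝ) : ℂ) with hχdef
    have hχu : IsTestFun univ χ := ⟨hχ.1, hχ.2.1, subset_univ _⟩
    have hψχ : ψ = fun x => ∑ ν ∈ F, (R.ξ ν x : ℂ) * χ x := by
      funext x
      rw [← Finset.sum_mul]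
      by_cases hx : x ∈ tsupport ψ
      · have : (∑ ν ∈ F, (R.ξ ν x : ℂ)) ≠ 0 := by exact_mod_cast h0 x hx
        simp only [hχdef]
        push_cast
        field_simp
      · simp [hχdef, image_eq_zero_of_notMem_tsupport hx]
    have hgψ : ∀ x, g x * ψ x = ∑ ν ∈ F, T ν x * χ x := by
      intro x
      by_cases hx : x ∈ tsupport ψ
      · rw [hg (fun ν hν => hF ν hν x hx), ← Finset.sum_mul]
        simp only [hχdef]
        ring
      · simp [hχdef, image_eq_zero_of_notMem_tsupport hx]
    have hae : ∀ ν, (fun x => T ν x * χ x) =ᵐ[volume]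
        fun x => q ν x * χ x - ((deriv (R.ξ ν) x : ℝ) : ℂ) * f x * χ x := by
      intro ν
      have h1 := (hq ν).ae_eq_zero (isClosed_tsupport (R.ξ ν)).isOpen_compl fun x hx => by
        rw [image_eq_zero_of_notMem_tsupport hx]; simp
      filter_upwards [h1] with x hx
      by_cases hxs : x ∈ tsupport (R.ξ ν)
      · simp only [T, indicator_of_mem hxs]; ring
      · simp only [T, indicator_of_notMem hxs, hx hxs]; ring
    have i1 : ∀ ν, Integrable fun x => q ν x * χ x := fun ν => hχu.integrable_mul (hq ν).2.1
    have i2 : ∀ {ξ : ℝ → ℝ} {φ : ℝ → ℂ}, IsCutoff (Ioo 0 κ) ξ → ContDiff ℝ ∞ φ →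
        Integrable fun x => (ξ x : ℂ) * f x * φ x := by
      intro ξ φ hξ hφ
      exact ((hξ.isTestFun.mul_contDiff hφ).integrable_mul hf).congr (.of_forall fun y => by ring)
    have hχ' : ContDiff ℝ ∞ (deriv χ) := ((contDiff_infty_iff_deriv (𝕜 := ℝ)).1 hχ.1).2
    rw [setIntegral_mul_isTestFun hψ, setIntegral_mul_isTestFun (hψ.iteratedDeriv 1),
      iteratedDeriv_one, pow_one, neg_one_mul]
    have hdψ : ∀ x, deriv ψ x =
        ∑ ν ∈ F, (((deriv (R.ξ ν) x : ℝ) : ℂ) * χ x + (R.ξ ν x : ℂ) * deriv χ x) := by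
      intro x
      have := HasDerivAt.fun_sum (u := F) (A := fun ν x => (R.ξ ν x : ℂ) * χ x) (x := x)
        fun ν _ => (((R.smooth ν).differentiable (by simp) x).hasDerivAt.ofReal_comp.mul
          (hχ.1.differentiable (by simp) x).hasDerivAt)
      rw [← this.deriv, ← hψχ]
    simp only [hgψ, hdψ, Finset.mul_sum]
    rw [integral_finsetSum _ fun ν _ => ((i1 ν).sub
      (i2 (hk.isCutoff ν).deriv hχ.1)).congr (hae ν).symm, integral_finsetSum, ← Finset.sum_neg_distrib]
    · refine Finset.sum_congr rfl fun ν _ => ?_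
      rw [integral_congr_ae (hae ν), integral_sub (i1 ν) (i2 (hk.isCutoff ν).deriv hχ.1),
        (hq ν).integral_one hχu]
      have h2 : ∫ x, f x * (((deriv (R.ξ ν) x : ℝ) : ℂ) * χ x + (R.ξ ν x : ℂ) * deriv χ x) =
          (∫ x, ((deriv (R.ξ ν) x : ℝ) : ℂ) * f x * χ x) + ∫ x, (R.ξ ν x : ℂ) * f x * deriv χ x := by
        rw [← integral_add (i2 (hk.isCutoff ν).deriv hχ.1) (i2 (hk.isCutoff ν) hχ')]
        exact integral_congr_ae (.of_forall fun x => by ring)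
      rw [h2]
      ring
    · intro ν _
      exact ((i2 (hk.isCutoff ν).deriv hχ.1).add (i2 (hk.isCutoff ν) hχ')).congr
        (.of_forall fun x => by simp only [Pi.add_apply]; ring)

theorem ApproxResolution.exists_isWeakDeriv {c κ : ℝ} (R : ApproxResolution c (Ioo 0 κ))
    {σ : ℝ} {f : ℝ → ℂ} (hf : LocallyIntegrableOn f (Ioo 0 κ))
    (h : famNormSq c R.ξ 1 σ f < ⊤) : ∃ g, IsWeakDeriv (Ioo 0 κ) 1 f g := by
  obtain ⟨k, hk⟩ := R.exists_isAdm
  have hc0 : 0 < c := by linarith [R.one_lt]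
  refine R.exists_isWeakDeriv_of_pieces hf fun ν => ?_
  have h1 : besselNormSq 1 (fun x => (R.ξ ν (c ^ ν * x) : ℂ) * f (c ^ ν * x)) < ⊤ := by
    by_contra hn
    have h2 := (ENNReal.le_tsum (f := fun ν : ℤ => ENNReal.ofReal (c ^ ((ν : ℝ) * σ)) *
      besselNormSq 1 (fun x => (R.ξ ν (c ^ ν * x) : ℂ) * f (c ^ ν * x))) ν).trans_lt h
    rw [not_lt_top_iff.1 hn, ENNReal.mul_top] at h2
    · exact lt_irrefl _ h2
    · simp only [ne_eq, ENNReal.ofReal_eq_zero, not_le]; positivity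
  obtain ⟨p, _, hp⟩ := exists_isWeakDeriv_of_besselNormSq_lt_top
    (hk.integrable_piece R.one_lt hf ν) h1
  have hpos := zpow_pos hc0 ν
  have h2 := hp.comp_mul_left (inv_pos.2 hpos)
  have h3 : ∀ x, c ^ ν * ((c ^ ν)⁻¹ * x) = x := fun x => by field_simp
  simp only [h3] at h2
  exact ⟨_, h2⟩

/-- Induction on `m`, for all admissible families and all weights at once: order `m+1` is traded for
order `m` of `f`, with the families `ζ` and `scaledDeriv c ζ`, and of its derivative `g`. The latter
is brought back to `f` by `IsAdm.famNormSq_deriv_le`. -/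
theorem IsAdm.exists_famNormSq_le {c κ : ℝ} (R : ApproxResolution c (Ioo 0 κ)) {k : ℕ}
    (hk : IsAdm c κ k R.ξ) (m : ℕ) : ∀ {ζ : ℤ → ℝ → ℝ}, IsAdm c κ k ζ → ∀ σ : ℝ,
    ∃ C : ℝ≥0, ∀ f : ℝ → ℂ, LocallyIntegrableOn f (Ioo 0 κ) →
      famNormSq c ζ m σ f ≤ C * famNormSq c R.ξ m σ f := by
  have hc := R.one_lt
  induction m with
  | zero =>
    intro ζ h σ
    obtain ⟨C, hC⟩ := IsAdm.exists_famWt_le R hk h σ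
    refine ⟨C, fun f hf => ?_⟩
    rw [h.famNormSq_zero_eq hc σ hf, hk.famNormSq_zero_eq hc σ hf, ← lintegral_const_mul' _ _ (by simp)]
    refine lintegral_mono fun φ => ?_
    rw [← mul_assoc]
    gcongr
    exact hC φ
  | succ m ih =>
    intro ζ h σ
    obtain ⟨C₁, h₁⟩ := ih h σ
    obtain ⟨C₂, h₂⟩ := ih (h.scaled_deriv hc) σ
    obtain ⟨C₃, h₃⟩ := ih h (σ + 2)
    obtain ⟨C₄, h₄⟩ := ih (hk.scaled_deriv hc) σ
    -- The summand `1` keeps the constant non-zero, since `0 * ⊤ = 0` would spoil the case of an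
    -- infinite right-hand side. Only a finite norm guarantees that the derivative used below
    -- exists.
    refine ⟨C₁ + (2 * C₂ + 2 * (C₃ * (2 + 2 * C₄))) + 1, fun f hf => ?_⟩
    by_cases htop : famNormSq c R.ξ (m + 1) σ f = ⊤
    · rw [htop, ENNReal.mul_top (by simp)]
      exact le_top
    obtain ⟨g, hg⟩ := R.exists_isWeakDeriv hf
      ((famNormSq_mono c R.ξ (by omega : 1 ≤ m + 1) σ f).trans_lt (lt_top_iff_ne_top.2 htop))
    have hm := famNormSq_mono c R.ξ (by omega : m ≤ m + 1) σ f
    set N := famNormSq c R.ξ (m + 1) σ f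
    have e1 : famNormSq c ζ m σ f ≤ C₁ * N := (h₁ f hf).trans (by gcongr)
    have e2 : famNormSq c (scaledDeriv c ζ) m σ f ≤ C₂ * N := (h₂ f hf).trans (by gcongr)
    have e4 : famNormSq c (scaledDeriv c R.ξ) m σ f ≤ C₄ * N :=
      (h₄ f hf).trans (by gcongr)
    have e3 : famNormSq c ζ m (σ + 2) g ≤ C₃ * (2 * N + 2 * (C₄ * N)) :=
      (h₃ g hg.2.1).trans (by
        gcongr
        exact (hk.famNormSq_deriv_le hc hg m σ).trans (by gcongr))
    calc famNormSq c ζ (m + 1) σ f ≤ _ := h.famNormSq_succ_le hc hg m σ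
      _ ≤ C₁ * N + (2 * (C₂ * N) + 2 * (C₃ * (2 * N + 2 * (C₄ * N)))) := by gcongr
      _ ≤ C₁ * N + (2 * (C₂ * N) + 2 * (C₃ * (2 * N + 2 * (C₄ * N)))) + N := le_self_add
      _ = _ := by push_cast; ring

theorem ApproxResolution.exists_sobNormSq_deriv_le {c κ : ℝ} (R : ApproxResolution c (Ioo 0 κ))
    (m : ℕ) (σ : ℝ) : ∃ C : ℝ≥0, ∀ f g : ℝ → ℂ, IsWeakDeriv (Ioo 0 κ) 1 f g →
      sobNormSq R m (σ + 2) g ≤ C * sobNormSq R (m + 1) σ f := by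
  obtain ⟨k, hk⟩ := R.exists_isAdm
  obtain ⟨C, hC⟩ := IsAdm.exists_famNormSq_le R hk m (hk.scaled_deriv R.one_lt) σ
  refine ⟨2 + 2 * C, fun f g h => ?_⟩
  rw [sobNormSq_eq_famNormSq R _ _ h.1, sobNormSq_eq_famNormSq R _ _ h.2.1]
  refine (hk.famNormSq_deriv_le R.one_lt h m σ).trans ?_
  calc _ ≤ 2 * famNormSq c R.ξ (m + 1) σ f + 2 * (C * famNormSq c R.ξ (m + 1) σ f) := by
        gcongr
        exact (hC f h.1).trans (mul_le_mul_right (famNormSq_mono c R.ξ m.le_succ σ f) _)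
    _ = _ := by push_cast; ring

theorem ApproxResolution.exists_sobNormSq_succ_le {c κ : ℝ} (R : ApproxResolution c (Ioo 0 κ))
    (m : ℕ) (σ : ℝ) : ∃ C : ℝ≥0, ∀ f g : ℝ → ℂ, IsWeakDeriv (Ioo 0 κ) 1 f g →
      sobNormSq R (m + 1) σ f ≤ C * (sobNormSq R m σ f + sobNormSq R m (σ + 2) g) := by
  obtain ⟨k, hk⟩ := R.exists_isAdm
  obtain ⟨C, hC⟩ := IsAdm.exists_famNormSq_le R hk m (hk.scaled_deriv R.one_lt) σ
  refine ⟨3 + 2 * C, fun f g h => ?_⟩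
  rw [sobNormSq_eq_famNormSq R _ _ h.1, sobNormSq_eq_famNormSq R _ _ h.1,
    sobNormSq_eq_famNormSq R _ _ h.2.1]
  refine (hk.famNormSq_succ_le R.one_lt h m σ).trans ?_
  set A := famNormSq c R.ξ m σ f
  set B := famNormSq c R.ξ m (σ + 2) g
  calc _ ≤ A + (2 * (C * A) + 2 * B) := by gcongr; exact hC f h.1
    _ ≤ (A + (2 * (C * A) + 2 * B)) + (2 * A + B + 2 * (C * B)) := le_self_add
    _ = (3 + 2 * C) * (A + B) := by ring
    _ = _ := by push_cast; ring

theorem sobNormSq_mono {c κ : ℝ} (R : ApproxResolution c (Ioo 0 κ)) {m n : ℕ} (h : m ≤ n)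
    (σ : ℝ) (f : ℝ → ℂ) : sobNormSq R m σ f ≤ sobNormSq R n σ f := by
  by_cases hf : LocallyIntegrableOn f (Ioo 0 κ)
  · rw [sobNormSq_eq_famNormSq R _ _ hf, sobNormSq_eq_famNormSq R _ _ hf]
    exact famNormSq_mono c R.ξ h σ f
  · simp [sobNormSq, hf]

theorem locallyIntegrableOn_of_sobNormSq_ne_top {c κ : ℝ} {R : ApproxResolution c (Ioo 0 κ)}
    {m : ℕ} {σ : ℝ} {f : ℝ → ℂ} (h : sobNormSq R m σ f ≠ ⊤) :
    LocallyIntegrableOn f (Ioo 0 κ) := by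
  by_contra hf
  simp [sobNormSq, hf] at h

/-- Elements of `H^m_{2,σ}` have weak derivatives of order `α ≤ m` in `H^{m-α}_{2,σ+2α}`. -/
theorem ApproxResolution.exists_sobNormSq_iteratedDeriv_le {c κ : ℝ}
    (R : ApproxResolution c (Ioo 0 κ)) (m : ℕ) (σ : ℝ) (α : ℕ) (hα : α ≤ m) :
    ∃ C : ℝ≥0, ∀ f : ℝ → ℂ, sobNormSq R m σ f < ⊤ → ∃ g, IsWeakDeriv (Ioo 0 κ) α f g ∧
      sobNormSq R (m - α) (σ + 2 * α) g ≤ C * sobNormSq R m σ f := by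
  induction α with
  | zero =>
    refine ⟨1, fun f hf => ⟨f, isWeakDeriv_zero_iff
      (locallyIntegrableOn_of_sobNormSq_ne_top hf.ne), ?_⟩⟩
    simp
  | succ α ih =>
    obtain ⟨C, hC⟩ := ih (by omega)
    obtain ⟨C', hC'⟩ := R.exists_sobNormSq_deriv_le (m - (α + 1)) (σ + 2 * α)
    refine ⟨C' * C, fun f hf => ?_⟩
    obtain ⟨g, hg, hgn⟩ := hC f hf
    have e : m - (α + 1) + 1 = m - α := by omega
    have hfin : famNormSq c R.ξ 1 (σ + 2 * α) g < ⊤ := by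
      rw [← sobNormSq_eq_famNormSq R _ _ hg.2.1]
      exact ((sobNormSq_mono R (by omega : 1 ≤ m - α) _ g).trans hgn).trans_lt
        (ENNReal.mul_lt_top (by simp) hf)
    obtain ⟨h, hh⟩ := R.exists_isWeakDeriv hg.2.1 hfin
    refine ⟨h, hg.trans hh, ?_⟩
    have h1 := hC' g h hh
    rw [e] at h1
    have e2 : σ + 2 * ((α + 1 : ℕ) : ℝ) = σ + 2 * α + 2 := by push_cast; ring
    rw [e2]
    calc _ ≤ _ := h1
      _ ≤ C' * (C * sobNormSq R m σ f) := by gcongr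
      _ = _ := by push_cast; ring

/-- The norm of `H^m_{2,σ}` is controlled by the weighted `L₂` norms of the weak derivatives. -/
theorem ApproxResolution.exists_sobNormSq_le_sum {c κ : ℝ} (R : ApproxResolution c (Ioo 0 κ))
    (m : ℕ) : ∀ σ : ℝ, ∃ C : ℝ≥0, ∀ (f : ℝ → ℂ) (g : ℕ → ℝ → ℂ),
      (∀ α ≤ m, IsWeakDeriv (Ioo 0 κ) α f (g α)) →
      sobNormSq R m σ f ≤ C * ∑ α ∈ Finset.range (m + 1), sobNormSq R 0 (σ + 2 * α) (g α) := by
  have h0 : ∀ {f g : ℝ → ℂ}, IsWeakDeriv (Ioo 0 κ) 0 f g → f =ᵐ[volume.restrict (Ioo 0 κ)] g :=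
    fun h => (isWeakDeriv_zero_iff h.1).ae_eq isOpen_Ioo h .rfl
  induction m with
  | zero =>
    intro σ
    refine ⟨1, fun f g h => ?_⟩
    simp [sobNormSq_congr R 0 σ (h0 (h 0 le_rfl))]
  | succ m ih =>
    intro σ
    obtain ⟨C, hC⟩ := R.exists_sobNormSq_succ_le m σ
    obtain ⟨C₁, h₁⟩ := ih σ
    obtain ⟨C₂, h₂⟩ := ih (σ + 2)
    refine ⟨C * (C₁ + C₂), fun f g h => ?_⟩
    have hd := h 1 (by omega)
    have e1 := h₁ f g fun α hα => h α (by omega)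
    -- The derivatives of `g 1` are the shifted sequence, and raising the weight by `2` matches the
    -- shift of `α` by one.
    have e2 := h₂ (g 1) (fun α => g (α + 1)) fun α hα => hd.of_trans (h (α + 1) (by omega))
    have e3 : ∑ α ∈ Finset.range (m + 1), sobNormSq R 0 (σ + 2 * α) (g α) ≤
        ∑ α ∈ Finset.range (m + 1 + 1), sobNormSq R 0 (σ + 2 * α) (g α) :=
      Finset.sum_le_sum_of_subset (by simp)
    have e4 : ∑ α ∈ Finset.range (m + 1), sobNormSq R 0 (σ + 2 + 2 * α) (g (α + 1)) ≤
        ∑ α ∈ Finset.range (m + 1 + 1), sobNormSq R 0 (σ + 2 * α) (g α) := by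
      rw [Finset.sum_range_succ' _ (m + 1)]
      refine le_trans (le_of_eq (Finset.sum_congr rfl fun α _ => ?_)) le_self_add
      congr 1
      push_cast
      ring
    set S := ∑ α ∈ Finset.range (m + 1 + 1), sobNormSq R 0 (σ + 2 * α) (g α)
    calc _ ≤ _ := hC f (g 1) hd
      _ ≤ C * (C₁ * S + C₂ * S) := by
        gcongr
        · exact e1.trans (by gcongr)
        · exact e2.trans (by gcongr)
      _ = _ := by push_cast; ring

/-! ## Jointly measurable weak derivatives and the space `Y` -/

/-- A compact exhaustion of `(0,κ)`. -/
def innerIcc (κ : ℝ) (m : ℕ) : Set ℝ := Icc ((m : ℝ) + 1)⁻¹ (κ - ((m : ℝ) + 1)⁻¹)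

theorem isCompact_innerIcc (κ : ℝ) (m : ℕ) : IsCompact (innerIcc κ m) := isCompact_Icc

theorem innerIcc_subset (κ : ℝ) (m : ℕ) : innerIcc κ m ⊆ Ioo 0 κ := by
  have h : (0 : ℝ) < ((m : ℝ) + 1)⁻¹ := by positivity
  exact fun x hx => ⟨h.trans_le hx.1, hx.2.trans_lt (by linarith)⟩

theorem exists_innerIcc_mem_nhds {κ φ : ℝ} (hφ : φ ∈ Ioo 0 κ) : ∃ m, innerIcc κ m ∈ 𝓝 φ := by
  have h1 : Tendsto (fun m : ℕ => ((m : ℝ) + 1)⁻¹) atTop (𝓝 0) := by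
    simpa using tendsto_one_div_add_atTop_nhds_zero_nat (𝕜 := ℝ)
  have h2 : ∀ᶠ m : ℕ in atTop, ((m : ℝ) + 1)⁻¹ < min φ (κ - φ) :=
    h1.eventually_lt_const (lt_min hφ.1 (sub_pos.2 hφ.2))
  obtain ⟨m, hm⟩ := h2.exists
  refine ⟨m, Icc_mem_nhds (hm.trans_le (min_le_left _ _)) ?_⟩
  have := hm.trans_le (min_le_right _ _)
  linarith

theorem locallyIntegrableOn_Ioo_iff {κ : ℝ} {f : ℝ → ℂ} :
    LocallyIntegrableOn f (Ioo 0 κ) ↔ ∀ m, IntegrableOn f (innerIcc κ m) := by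
  refine ⟨fun h m => h.integrableOn_compact_subset (innerIcc_subset κ m) (isCompact_innerIcc κ m),
    fun h φ hφ => ?_⟩
  obtain ⟨m, hm⟩ := exists_innerIcc_mem_nhds hφ
  exact ⟨_, mem_nhdsWithin_of_mem_nhds hm, h m⟩

/-- With all `n` derivatives moved onto a mollifier, the mollified weak derivative is the integral
`w k` of `v` itself, jointly measurable whether or not a weak derivative exists. On every slice that
has one, Lebesgue differentiation identifies the limit almost everywhere. -/
theorem exists_measurable_weakDeriv (κ : ℝ) (n : ℕ) {v : ℝ × ℝ → ℂ} (hv : StronglyMeasurable v) :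
    ∃ w : ℝ × ℝ → ℂ, StronglyMeasurable w ∧ ∀ t g,
      IsWeakDeriv (Ioo 0 κ) n (fun φ => v (t, φ)) g →
        (fun φ => w (t, φ)) =ᵐ[volume.restrict (Ioo 0 κ)] g := by
  let b : ℕ → ContDiffBump (0 : ℝ) := fun k =>
    ⟨((k : ℝ) + 1)⁻¹, 2 * ((k : ℝ) + 1)⁻¹, by positivity, by
      have : (0 : ℝ) < ((k : ℝ) + 1)⁻¹ := by positivity
      linarith⟩
  have hb0 : Tendsto (fun k => (b k).rOut) atTop (𝓝 0) := by
    have := (tendsto_one_div_add_atTop_nhds_zero_nat (𝕜 := ℝ)).const_mul 2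
    simpa [b] using this
  let η : ℕ → ℝ → ℂ := fun k x => ((b k).normed volume x : ℂ)
  have hη : ∀ k, ContDiff ℝ ∞ (η k) := fun k =>
    Complex.ofRealCLM.contDiff.comp ((b k).contDiff_normed (n := ⊤))
  let w : ℕ → ℝ × ℝ → ℂ := fun k p =>
    ∫ y in Ioo 0 κ, v (p.1, y) * iteratedDeriv n (η k) (p.2 - y)
  have hw : ∀ k, StronglyMeasurable (w k) := by
    intro k
    refine StronglyMeasurable.integral_prod_right' (ν := volume.restrict (Ioo 0 κ))
      (f := fun q : (ℝ × ℝ) × ℝ => v (q.1.1, q.2) * iteratedDeriv n (η k) (q.1.2 - q.2)) ?_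
    have h1 : Measurable fun q : (ℝ × ℝ) × ℝ => (q.1.1, q.2) := by fun_prop
    have h2 : Continuous fun q : (ℝ × ℝ) × ℝ => iteratedDeriv n (η k) (q.1.2 - q.2) :=
      ((hη k).continuous_iteratedDeriv n (by exact_mod_cast le_top)).comp (by fun_prop)
    exact (hv.comp_measurable h1).mul h2.stronglyMeasurable
  refine ⟨fun p => limUnder atTop fun k => w k p, StronglyMeasurable.limUnder hw,
    fun t g hg => ?_⟩
  -- `g` need not be integrable up to the boundary, so it is truncated to a compact interval; near
  -- an interior point, mollifiers of small support do not see the truncation.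
  have hJ : ∀ m, LocallyIntegrable ((innerIcc κ m).indicator g) := fun m =>
    ((integrable_indicator_iff (isCompact_innerIcc κ m).measurableSet).2
      (locallyIntegrableOn_Ioo_iff.1 hg.2.1 m)).locallyIntegrable
  have hconv : ∀ m, ∀ᵐ φ, Tendsto (fun k => convolution ((b k).normed volume)
      ((innerIcc κ m).indicator g) (ContinuousLinearMap.lsmul ℝ ℝ) volume φ) atTop
      (𝓝 ((innerIcc κ m).indicator g φ)) := fun m =>
    ContDiffBump.ae_convolution_tendsto_right_of_locallyIntegrable (K := 2) hb0
      (.of_forall fun k => le_of_eq rfl) (hJ m)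
  rw [EventuallyEq, ae_restrict_iff' measurableSet_Ioo]
  filter_upwards [ae_all_iff.2 hconv] with φ hφ hφI
  obtain ⟨m, hm⟩ := exists_innerIcc_mem_nhds hφI
  have h1 := hφ m
  rw [indicator_of_mem (mem_of_mem_nhds hm)] at h1
  refine Tendsto.limUnder_eq (h1.congr' ?_)
  obtain ⟨r, hr, hrm⟩ := Metric.nhds_basis_closedBall.mem_iff.1 hm
  filter_upwards [hb0.eventually_lt_const hr] with k hk
  have hsupp : ∀ y, y ∉ innerIcc κ m → (b k).normed volume (φ - y) = 0 := by
    intro y hy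
    rw [← Function.notMem_support, (b k).support_normed_eq]
    intro h
    apply hy
    apply hrm
    rw [mem_ball_zero_iff, Real.norm_eq_abs, abs_sub_comm] at h
    rw [Metric.mem_closedBall, Real.dist_eq]
    exact (h.trans hk).le
  have htest : IsTestFun (Ioo 0 κ) fun y => η k (φ - y) := by
    have hs : tsupport (fun y => η k (φ - y)) ⊆ innerIcc κ m := by
      refine closure_minimal (fun y hy => ?_) (isCompact_innerIcc κ m).isClosed
      by_contra hn
      exact hy (by simp [η, hsupp y hn])
    exact ⟨(hη k).comp (contDiff_const.sub contDiff_id),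
      (isCompact_innerIcc κ m).of_isClosed_subset (isClosed_tsupport _) hs,
      hs.trans (innerIcc_subset κ m)⟩
  have h2 := hg.2.2 _ htest
  -- The reflection `y ↦ φ - y` contributes `(-1)^n`, which cancels the sign in the definition of
  -- the weak derivative.
  rw [iteratedDeriv_comp_const_sub] at h2
  have h3 : ∫ y in Ioo 0 κ, v (t, y) * ((-1 : ℝ) ^ n • iteratedDeriv n (η k) (φ - y)) =
      (-1) ^ n * w k (t, φ) := by
    simp only [w]
    rw [← integral_const_mul]
    refine integral_congr_ae (.of_forall fun y => ?_)
    simp only [Complex.real_smul]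
    push_cast
    ring
  rw [h3, ← mul_assoc, ← mul_pow] at h2
  simp only [mul_neg, mul_one, neg_neg, one_pow, one_mul] at h2
  rw [← h2, setIntegral_mul_isTestFun htest, convolution_eq_swap]
  refine integral_congr_ae (.of_forall fun y => ?_)
  simp only [ContinuousLinearMap.lsmul_apply, Complex.real_smul]
  by_cases hy : y ∈ innerIcc κ m
  · rw [indicator_of_mem hy, mul_comm]
  · simp [η, hsupp y hy]

section Slices

variable {c κ : ℝ} (R : ApproxResolution c (Ioo 0 κ)) (m : ℕ) (σ : ℝ)

/-- No integrability is assumed: the set of parameters whose slice is locally integrable is itself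
measurable, by the compact exhaustion, and elsewhere the norm is `⊤`. -/
theorem measurable_sobNormSq_slice {w : ℝ × ℝ → ℂ} (hw : StronglyMeasurable w) :
    Measurable fun s => sobNormSq R m σ fun φ => w (s, φ) := by
  have h1 : MeasurableSet {s | LocallyIntegrableOn (fun φ => w (s, φ)) (Ioo 0 κ)} := by
    have h2 : {s | LocallyIntegrableOn (fun φ => w (s, φ)) (Ioo 0 κ)} =
        ⋂ m, {s | ∫⁻ φ in innerIcc κ m, ‖w (s, φ)‖ₑ < ⊤} := by
      ext s
      have h3 : Measurable fun φ : ℝ => ((s, φ) : ℝ × ℝ) := by fun_prop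
      simp only [mem_ofPred_eq, mem_iInter, locallyIntegrableOn_Ioo_iff]
      refine forall_congr' fun m => ?_
      exact ⟨fun h => h.2, fun h => ⟨(hw.comp_measurable h3).aestronglyMeasurable, h⟩⟩
    rw [h2]
    refine MeasurableSet.iInter fun m => measurableSet_lt ?_ measurable_const
    exact Measurable.lintegral_prod_right' (ν := volume.restrict (innerIcc κ m))
      (f := fun p : ℝ × ℝ => ‖w p‖ₑ) hw.enorm
  unfold sobNormSq
  exact Measurable.ite h1 (Measurable.tsum fun ν =>
    (measurable_besselNormSq_slice R m ν hw).const_mul _) measurable_const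

theorem aemeasurable_sobNormSq_slice_of_cyl {A : Set ℝ} {w : ℝ × ℝ → ℂ}
    (hw : AEStronglyMeasurable w (cylMeasure A κ)) :
    AEMeasurable (fun s => sobNormSq R m σ fun φ => w (s, φ)) (volume.restrict A) := by
  refine ⟨_, measurable_sobNormSq_slice R m σ hw.stronglyMeasurable_mk, ?_⟩
  filter_upwards [Measure.ae_ae_of_ae_prod hw.ae_eq_mk] with s hs
  exact sobNormSq_congr R m σ hs

theorem sobNormSq_smul {a : ℂ} (ha : a ≠ 0) (f : ℝ → ℂ) :
    sobNormSq R m σ (a • f) = ‖a‖ₑ ^ 2 * sobNormSq R m σ f := by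
  refine le_antisymm (sobNormSq_smul_le R m σ a f) ?_
  have h := sobNormSq_smul_le R m σ a⁻¹ (a • f)
  rw [smul_smul, inv_mul_cancel₀ ha, one_smul] at h
  calc ‖a‖ₑ ^ 2 * sobNormSq R m σ f ≤ ‖a‖ₑ ^ 2 * (‖a⁻¹‖ₑ ^ 2 * sobNormSq R m σ (a • f)) := by
        gcongr
    _ = (‖a‖ₑ * ‖a⁻¹‖ₑ) ^ 2 * sobNormSq R m σ (a • f) := by ring
    _ = _ := by rw [← enorm_mul, mul_inv_cancel₀ ha]; simp

end Slices

/-- For `θ = 0` the line passes through the origin. That point has to be set aside, because a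
vanishing factor `λ^j` would turn an infinite norm into `0`. -/
theorem linePt_ne_zero (θ : ℝ) : ∀ᵐ t : ℝ, linePt θ t ≠ 0 := by
  have h : ∀ᵐ t : ℝ, t ≠ 0 := by simp [ae_iff]
  filter_upwards [h] with t ht h0
  have := congrArg Complex.im h0
  simp [linePt] at this
  exact ht this

theorem continuous_linePt (θ : ℝ) : Continuous (linePt θ) := by
  unfold linePt
  fun_prop

theorem enorm_pow_sq (z : ℂ) (j : ℕ) : ‖z ^ j‖ₑ ^ 2 = ‖z‖ₑ ^ (2 * j) := by
  rw [enorm_pow, ← pow_mul, mul_comm]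

/-! ### Membership in `Y` as finiteness of the norm. -/

section MemY

variable {c κ : ℝ} (R : ApproxResolution c (Ioo 0 κ)) (γ : ℕ) (Θ θ : ℝ)

/-- Almost every slice has finite norm and hence weak derivatives, and these are assembled into
jointly measurable functions. Since `α ≤ γ - j`, the bound for `λ^j D_φ^α v` comes from the `j`-th
summand of the norm alone. -/
theorem memY_of_yNormSq_lt_top {v : ℝ × ℝ → ℂ} (hv : AEStronglyMeasurable v (cylMeasure univ κ))
    (h : yNormSq R γ Θ θ v < ⊤) : MemY R γ Θ θ v := by
  have hcongr : yNormSq R γ Θ θ v = yNormSq R γ Θ θ (hv.mk v) :=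
    Finset.sum_congr rfl fun j _ => mixedNormSq_congr R _ _ _ hv.ae_eq_mk
  rw [hcongr] at h
  refine MemY.congr hv.ae_eq_mk.symm ?_
  have hv' : StronglyMeasurable (hv.mk v) := hv.stronglyMeasurable_mk
  generalize hv.mk v = v' at h hv'
  have hterm : ∀ j ≤ γ, ∀ᵐ t : ℝ, sobNormSq R (γ - j) (Θ - 1 + 2 * j) (fun φ => v' (t, φ)) < ⊤ := by
    intro j hj
    have h1 : mixedNormSq R univ
        (fun t => ENNReal.ofReal (1 / (2 * Real.pi)) * ‖linePt θ t‖ₑ ^ (2 * j))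
        (γ - j) (Θ - 1 + 2 * j) v' < ⊤ :=
      ENNReal.sum_lt_top.1 h j (Finset.mem_range.2 (by omega))
    rw [mixedNormSq, Measure.restrict_univ] at h1
    have hm := measurable_sobNormSq_slice R (γ - j) (Θ - 1 + 2 * j) hv'
    have hl := (continuous_linePt θ).measurable
    have h2 := ae_lt_top (by fun_prop) h1.ne
    filter_upwards [h2, linePt_ne_zero θ] with t ht hne
    refine lt_top_iff_ne_top.2 fun htop => ?_
    rw [htop, ENNReal.mul_top] at ht
    · exact lt_irrefl _ ht
    · simp [hne, Real.pi_pos]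
  choose w hw hwd using fun α => exists_measurable_weakDeriv κ α hv'
  have hweak : ∀ α ≤ γ, ∀ᵐ t : ℝ,
      IsWeakDeriv (Ioo 0 κ) α (fun φ => v' (t, φ)) (fun φ => w α (t, φ)) := by
    intro α hα
    obtain ⟨C, hC⟩ := R.exists_sobNormSq_iteratedDeriv_le γ (Θ - 1) α hα
    filter_upwards [hterm 0 (by omega)] with t ht
    obtain ⟨g, hg, _⟩ := hC _ (by simpa using ht)
    have he := hwd α t g hg
    refine ⟨hg.1, hg.2.1.congr he.symm, fun ψ hψ => ?_⟩
    rw [← hg.2.2 ψ hψ]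
    refine integral_congr_ae ?_
    filter_upwards [he] with x hx
    rw [hx]
  refine ⟨w, fun α hα => ⟨hweak α hα, fun j hj => ⟨?_, ?_⟩⟩⟩
  · have hl : Continuous fun x : ℝ × ℝ => linePt θ x.1 ^ j :=
      ((continuous_linePt θ).comp continuous_fst).pow j
    exact (hl.stronglyMeasurable.mul (hw α)).aestronglyMeasurable
  · obtain ⟨C, hC⟩ := R.exists_sobNormSq_iteratedDeriv_le (γ - j) (Θ - 1 + 2 * j) α (by omega)
    have h1 : mixedNormSq R univ
        (fun t => ENNReal.ofReal (1 / (2 * Real.pi)) * ‖linePt θ t‖ₑ ^ (2 * j))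
        (γ - j) (Θ - 1 + 2 * j) v' < ⊤ :=
      ENNReal.sum_lt_top.1 h j (Finset.mem_range.2 (by omega))
    refine lt_of_le_of_lt ?_ (ENNReal.mul_lt_top (ENNReal.coe_lt_top (r := C)) h1)
    rw [mixedNormSq, mixedNormSq, ← lintegral_const_mul' _ _ (by simp), Measure.restrict_univ]
    refine lintegral_mono_ae ?_
    filter_upwards [hterm j (by omega), hweak α hα] with t ht hwt
    obtain ⟨g, hg, hgn⟩ := hC _ ht
    have he := hwt.ae_eq isOpen_Ioo hg .rfl
    have h2 := sobNormSq_smul_le R 0 (Θ + 2 * j + 2 * α - 1) (linePt θ t ^ j)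
      fun φ => w α (t, φ)
    have h3 : sobNormSq R 0 (Θ + 2 * j + 2 * α - 1) (fun φ => w α (t, φ)) ≤
        C * sobNormSq R (γ - j) (Θ - 1 + 2 * j) fun φ => v' (t, φ) := by
      rw [sobNormSq_congr R 0 _ he]
      have e : Θ + 2 * j + 2 * α - 1 = Θ - 1 + 2 * j + 2 * α := by ring
      rw [e]
      exact (sobNormSq_mono R (Nat.zero_le _) _ g).trans hgn
    rw [enorm_pow_sq] at h2
    calc _ ≤ ENNReal.ofReal (1 / (2 * Real.pi)) * (‖linePt θ t‖ₑ ^ (2 * j) *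
          (C * sobNormSq R (γ - j) (Θ - 1 + 2 * j) fun φ => v' (t, φ))) := by
          gcongr
          exact h2.trans (by gcongr)
      _ = _ := by ring

/-- The slicewise bound by derivatives, multiplied by `|λ|^{2j}`, is integrated along the line; the
measurability contained in `MemY₀` allows the sum to be exchanged with the integral. -/
theorem MemY.yNormSq_lt_top {v : ℝ × ℝ → ℂ} (h : MemY R γ Θ θ v) : yNormSq R γ Θ θ v < ⊤ := by
  obtain ⟨w, hw⟩ := h
  refine ENNReal.sum_lt_top.2 fun j hj => ?_
  have hj' : j ≤ γ := by simpa [Nat.lt_succ_iff] using hj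
  obtain ⟨C, hC⟩ := R.exists_sobNormSq_le_sum (γ - j) (Θ - 1 + 2 * j)
  have hall : ∀ᵐ t : ℝ, ∀ α ≤ γ,
      IsWeakDeriv (Ioo 0 κ) α (fun φ => v (t, φ)) (fun φ => w α (t, φ)) := by
    rw [ae_all_iff]
    intro α
    by_cases hα : α ≤ γ
    · filter_upwards [(hw α hα).1] with t ht _ using ht
    · exact .of_forall fun t h => absurd h hα
  have hfin : ∑ α ∈ Finset.range (γ - j + 1), mixedNormSq R univ
      (fun _ => ENNReal.ofReal (1 / (2 * Real.pi))) 0 (Θ + 2 * j + 2 * α - 1)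
      (fun x => linePt θ x.1 ^ j * w α x) < ⊤ := by
    refine ENNReal.sum_lt_top.2 fun α hα => ?_
    have hα' : α < γ - j + 1 := by simpa using hα
    exact ((hw α (by omega)).2 j (by omega)).2
  refine lt_of_le_of_lt ?_ (ENNReal.mul_lt_top (ENNReal.coe_lt_top (r := C)) hfin)
  simp only [mixedNormSq]
  rw [← lintegral_finsetSum', ← lintegral_const_mul' _ _ (by simp), Measure.restrict_univ]
  · refine lintegral_mono_ae ?_
    filter_upwards [hall, linePt_ne_zero θ] with t ht hne
    have h1 := hC _ (fun α => fun φ => w α (t, φ)) fun α hα => ht α (by omega)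
    calc _ ≤ ENNReal.ofReal (1 / (2 * Real.pi)) * ‖linePt θ t‖ₑ ^ (2 * j) *
          (C * ∑ α ∈ Finset.range (γ - j + 1),
            sobNormSq R 0 (Θ - 1 + 2 * j + 2 * α) fun φ => w α (t, φ)) := by gcongr
      _ = C * ∑ α ∈ Finset.range (γ - j + 1), ENNReal.ofReal (1 / (2 * Real.pi)) *
          (‖linePt θ t‖ₑ ^ (2 * j) * sobNormSq R 0 (Θ - 1 + 2 * j + 2 * α) fun φ => w α (t, φ)) := by
        rw [← Finset.mul_sum, ← Finset.mul_sum]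
        ring
      _ = _ := by
        congr 1
        refine Finset.sum_congr rfl fun α _ => ?_
        have e : Θ + 2 * j + 2 * α - 1 = Θ - 1 + 2 * j + 2 * α := by ring
        rw [← enorm_pow_sq, ← sobNormSq_smul R 0 _ (pow_ne_zero j hne), e]
        rfl
  · intro α hα
    have hα' : α < γ - j + 1 := by simpa using hα
    exact (aemeasurable_sobNormSq_slice_of_cyl R _ _ ((hw α (by omega)).2 j (by omega)).1).const_mul _

end MemY

/-! ## The Fourier transform in the first of two variables -/

theorem ae_ae_of_ae_prod_swap {α β : Type*} [MeasurableSpace α] [MeasurableSpace β]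
    {μ : Measure α} {ν : Measure β} [SFinite μ] [SFinite ν] {P : α × β → Prop}
    (h : ∀ᵐ p ∂μ.prod ν, P p) : ∀ᵐ y ∂ν, ∀ᵐ x ∂μ, P (x, y) := by
  have h1 : ∀ᵐ p ∂ν.prod μ, P p.swap :=
    (Measure.measurePreserving_swap (μ := ν) (ν := μ)).quasiMeasurePreserving.ae h
  exact Measure.ae_ae_of_ae_prod h1

theorem ae_eq_prod_of_ae_ae_swap {α β : Type*} [MeasurableSpace α] [MeasurableSpace β]
    {μ : Measure α} {ν : Measure β} [SFinite μ] [SFinite ν] {f g : α × β → ℂ}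
    (hf : AEStronglyMeasurable f (μ.prod ν)) (hg : AEStronglyMeasurable g (μ.prod ν))
    (h : ∀ᵐ y ∂ν, ∀ᵐ x ∂μ, f (x, y) = g (x, y)) : f =ᵐ[μ.prod ν] g := by
  have hm : AEMeasurable (fun p => ‖(f - g) p‖ₑ) (μ.prod ν) := (hf.sub hg).enorm
  have h2 : ∫⁻ p, ‖(f - g) p‖ₑ ∂μ.prod ν = 0 := by
    rw [lintegral_prod_symm _ hm, lintegral_congr_ae (g := fun _ => 0)]
    · simp
    filter_upwards [h] with y h1
    rw [lintegral_congr_ae (g := fun _ => 0)]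
    · simp
    filter_upwards [h1] with s hs
    simp [hs]
  rw [lintegral_eq_zero_iff' hm] at h2
  filter_upwards [h2] with p hp
  simpa [sub_eq_zero] using hp

/-- The scheme of `exists_measurable_weakDeriv` on the Fourier side: the mollified transform is an
integral of `W` against the transform `F k` of a translated mollifier, hence measurable in `(s,y)`,
and it converges to the `L₂` transform for almost every `s`. One function `Z` thus serves all `y`.
-/
theorem exists_measurable_fourier {Y : Type*} [MeasurableSpace Y] {W : ℝ × Y → ℂ}
    (hW : StronglyMeasurable W) : ∃ Z : ℝ × Y → ℂ, StronglyMeasurable Z ∧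
      ∀ y, MemLp (fun x => W (x, y)) 2 → IsFourierPair (fun x => W (x, y)) fun s => Z (s, y) := by
  let b : ℕ → ContDiffBump (0 : ℝ) := fun k =>
    ⟨((k : ℝ) + 1)⁻¹, 2 * ((k : ℝ) + 1)⁻¹, by positivity, by
      have : (0 : ℝ) < ((k : ℝ) + 1)⁻¹ := by positivity
      linarith⟩
  have hb0 : Tendsto (fun k => (b k).rOut) atTop (𝓝 0) := by
    have := (tendsto_one_div_add_atTop_nhds_zero_nat (𝕜 := ℝ)).const_mul 2
    simpa [b] using this
  let η : ℕ → ℝ → ℂ := fun k x => ((b k).normed volume x : ℂ)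
  have hη : ∀ k, ContDiff ℝ ∞ (η k) := fun k =>
    Complex.ofRealCLM.contDiff.comp ((b k).contDiff_normed (n := ⊤))
  have hηc : ∀ k, HasCompactSupport (η k) := fun k =>
    (b k).hasCompactSupport_normed.comp_left (g := ((↑) : ℝ → ℂ)) (by simp)
  let F : ℕ → ℝ × ℝ → ℂ := fun k p => 𝓕 (fun σ => η k (p.2 - σ)) p.1
  have hF : ∀ k, StronglyMeasurable (F k) := by
    intro k
    simp only [F, Real.fourier_eq']
    refine StronglyMeasurable.integral_prod_right' (ν := (volume : Measure ℝ))
      (f := fun q : (ℝ × ℝ) × ℝ => Complex.exp (((-2 * Real.pi * inner ℝ q.2 q.1.1 : ℝ) : ℂ)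
        * Complex.I) • η k (q.1.2 - q.2)) ?_
    have hc := (hη k).continuous
    have : Continuous fun q : (ℝ × ℝ) × ℝ => Complex.exp
        (((-2 * Real.pi * inner ℝ q.2 q.1.1 : ℝ) : ℂ) * Complex.I) • η k (q.1.2 - q.2) := by
      fun_prop
    exact this.stronglyMeasurable
  let w : ℕ → ℝ × Y → ℂ := fun k p => ∫ x, W (x, p.2) * F k (x, p.1)
  have hw : ∀ k, StronglyMeasurable (w k) := by
    intro k
    refine StronglyMeasurable.integral_prod_right' (ν := (volume : Measure ℝ))
      (f := fun q : (ℝ × Y) × ℝ => W (q.2, q.1.2) * F k (q.2, q.1.1)) ?_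
    have h1 : Measurable fun q : (ℝ × Y) × ℝ => (q.2, q.1.2) := by fun_prop
    have h2 : Measurable fun q : (ℝ × Y) × ℝ => (q.2, q.1.1) := by fun_prop
    exact (hW.comp_measurable h1).mul ((hF k).comp_measurable h2)
  refine ⟨fun p => limUnder atTop fun k => w k p, StronglyMeasurable.limUnder hw, fun y hy => ?_⟩
  obtain ⟨g, hg⟩ := hy.exists_isFourierPair
  refine hg.congr .rfl ?_
  have hconv : ∀ᵐ s, Tendsto (fun k => convolution ((b k).normed volume)
      g (ContinuousLinearMap.lsmul ℝ ℝ) volume s) atTop (𝓝 (g s)) :=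
    ContDiffBump.ae_convolution_tendsto_right_of_locallyIntegrable (K := 2) hb0
      (.of_forall fun k => le_of_eq rfl) hg.right.locallyIntegrable_two
  filter_upwards [hconv] with s hs
  refine (Tendsto.limUnder_eq (hs.congr fun k => ?_)).symm
  obtain ⟨ψ, hψ⟩ := exists_schwartzMap_eq (η := fun σ => η k (s - σ))
    ((hη k).comp (contDiff_const.sub contDiff_id))
    ((hηc k).comp_homeomorph (Homeomorph.subLeft s))
  have h1 := hg.pairing ψ
  have h2 : ∀ x, 𝓕 ψ x = F k (x, s) := fun x => by
    rw [SchwartzMap.fourier_coe]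
    exact congrArg (fun f : ℝ → ℂ => 𝓕 f x) (funext hψ)
  simp only [h2, hψ] at h1
  rw [convolution_eq_swap]
  simp only [w]
  rw [← h1]
  refine integral_congr_ae (.of_forall fun σ => ?_)
  simp only [ContinuousLinearMap.lsmul_apply, Complex.real_smul, η]
  ring

theorem sq_lintegral_le {α : Type*} [MeasurableSpace α] {μ : Measure α} {f : α → ℂ}
    (hf : AEStronglyMeasurable f μ) :
    (∫⁻ x, ‖f x‖ₑ ∂μ) ^ 2 ≤ (∫⁻ x, ‖f x‖ₑ ^ 2 ∂μ) * μ univ := by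
  have h := eLpNorm_le_eLpNorm_mul_rpow_measure_univ (p := 1) (q := 2) (by norm_num) hf
  rw [eLpNorm_one_eq_lintegral_enorm] at h
  calc _ ≤ (eLpNorm f 2 μ * μ univ ^ (1 / (1 : ℝ≥0∞).toReal - 1 / (2 : ℝ≥0∞).toReal)) ^ 2 := by
        gcongr
    _ = _ := by
      rw [mul_pow, eLpNorm_two_sq, ← ENNReal.rpow_natCast, ← ENNReal.rpow_mul]
      norm_num

/-! ### Integration in a parameter commutes with the Fourier transform. -/

section Joint

variable {Y : Type*} [MeasurableSpace Y] {μ : Measure Y} [IsFiniteMeasure μ] {W Z : ℝ × Y → ℂ}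

theorem memLp_two_integral_right (hW : MemLp W 2 (volume.prod μ)) :
    MemLp (fun x => ∫ y, W (x, y) ∂μ) 2 := by
  rw [memLp_two_iff_lintegral] at hW ⊢
  refine ⟨hW.1.integral_prod_right', ?_⟩
  have h1 : AEMeasurable (fun p => ‖W p‖ₑ ^ 2) (volume.prod μ) := hW.1.enorm.pow_const 2
  calc ∫⁻ x, ‖∫ y, W (x, y) ∂μ‖ₑ ^ 2 ≤ ∫⁻ x, (∫⁻ y, ‖W (x, y)‖ₑ ^ 2 ∂μ) * μ univ := by
        refine lintegral_mono_ae ?_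
        filter_upwards [hW.1.prodMk_left] with x hx
        exact (pow_le_pow_left' (enorm_integral_le_lintegral_enorm _) 2).trans (sq_lintegral_le hx)
    _ = (∫⁻ p, ‖W p‖ₑ ^ 2 ∂(volume.prod μ)) * μ univ := by
        rw [lintegral_mul_const' _ _ (measure_ne_top _ _), lintegral_prod _ h1]
    _ < ⊤ := ENNReal.mul_lt_top hW.2 (measure_lt_top _ _)

theorem lintegral_prod_eq_of_isFourierPair (hW : AEStronglyMeasurable W (volume.prod μ))
    (hZ : AEStronglyMeasurable Z (volume.prod μ))
    (h : ∀ᵐ y ∂μ, IsFourierPair (fun x => W (x, y)) fun s => Z (s, y)) :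
    ∫⁻ p, ‖Z p‖ₑ ^ 2 ∂(volume.prod μ) = ∫⁻ p, ‖W p‖ₑ ^ 2 ∂(volume.prod μ) := by
  rw [lintegral_prod_symm _ (hW.enorm.pow_const 2), lintegral_prod_symm _ (hZ.enorm.pow_const 2)]
  refine lintegral_congr_ae ?_
  filter_upwards [h] with y hy using hy.lintegral_sq

/-- The pairing is integrated over `y` and Fubini applies on both sides. Since `μ` is finite,
Cauchy–Schwarz keeps the integrals over `y` in `L₂`. -/
theorem isFourierPair_integral (hW : MemLp W 2 (volume.prod μ))
    (hZ : AEStronglyMeasurable Z (volume.prod μ))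
    (h : ∀ᵐ y ∂μ, IsFourierPair (fun x => W (x, y)) fun s => Z (s, y)) :
    IsFourierPair (fun x => ∫ y, W (x, y) ∂μ) fun s => ∫ y, Z (s, y) ∂μ := by
  have hZ2 : MemLp Z 2 (volume.prod μ) := by
    rw [memLp_two_iff_lintegral] at hW ⊢
    exact ⟨hZ, by rw [lintegral_prod_eq_of_isFourierPair hW.1 hZ h]; exact hW.2⟩
  refine ⟨memLp_two_integral_right hW, memLp_two_integral_right hZ2, fun ψ => ?_⟩
  have key : ∀ {V : ℝ × Y → ℂ} (_ : MemLp V 2 (volume.prod μ)) (χ : 𝓢(ℝ, ℂ)),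
      ∫ x, (∫ y, V (x, y) ∂μ) * χ x = ∫ y, (∫ x, V (x, y) * χ x) ∂μ := by
    intro V hV χ
    have h1 : Integrable (fun p : ℝ × Y => V p * χ p.1) (volume.prod μ) :=
      hV.integrable_mul ((χ.memLp 2).comp_fst μ)
    rw [← integral_integral_swap (f := fun x y => V (x, y) * χ x) h1]
    refine integral_congr_ae (.of_forall fun x => ?_)
    exact (integral_mul_const _ _).symm
  rw [key hZ2 ψ, key hW (𝓕 ψ)]
  refine integral_congr_ae ?_
  filter_upwards [h] with y hy using hy.pairing ψ

end Joint

theorem cylMeasure_univ (κ : ℝ) :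
    cylMeasure univ κ = (volume : Measure ℝ).prod (volume.restrict (Ioo 0 κ)) := by
  rw [cylMeasure, Measure.restrict_univ]

/-- `V(·,φ)` is the Fourier transform of `U(·,φ)` for almost every `φ ∈ (0,κ)`. -/
structure IsRadialFourier (κ : ℝ) (U V : ℝ × ℝ → ℂ) : Prop where
  left : AEStronglyMeasurable U (cylMeasure univ κ)
  right : AEStronglyMeasurable V (cylMeasure univ κ)
  slice : ∀ᵐ φ ∂volume.restrict (Ioo 0 κ),
    IsFourierPair (fun x => U (x, φ)) fun s => V (s, φ)

theorem exists_isRadialFourier {κ : ℝ} {U : ℝ × ℝ → ℂ}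
    (hU : AEStronglyMeasurable U (cylMeasure univ κ))
    (h : ∀ᵐ φ ∂volume.restrict (Ioo 0 κ), ∫⁻ x, ‖U (x, φ)‖ₑ ^ 2 < ⊤) :
    ∃ V, IsRadialFourier κ U V := by
  obtain ⟨Z, hZ, hZU⟩ := exists_measurable_fourier hU.stronglyMeasurable_mk
  refine ⟨Z, hU, hZ.aestronglyMeasurable, ?_⟩
  have h1 : ∀ᵐ p ∂(volume : Measure ℝ).prod (volume.restrict (Ioo 0 κ)), U p = hU.mk U p := by
    rw [← cylMeasure_univ]
    exact hU.ae_eq_mk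
  filter_upwards [ae_ae_of_ae_prod_swap h1, h] with φ h1 h2
  have hm : Measurable fun x : ℝ => (x, φ) := by fun_prop
  refine (hZU φ ?_).congr (EventuallyEq.symm h1) .rfl
  refine (memLp_two_iff_lintegral.2 ⟨?_, h2⟩).ae_eq h1
  exact (hU.stronglyMeasurable_mk.comp_measurable hm).aestronglyMeasurable.congr (EventuallyEq.symm h1)

theorem IsRadialFourier.unique {κ : ℝ} {U U' V V' : ℝ × ℝ → ℂ} (h : IsRadialFourier κ U V)
    (h' : IsRadialFourier κ U' V') (hU : U =ᵐ[cylMeasure univ κ] U') :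
    V =ᵐ[cylMeasure univ κ] V' := by
  have hae : ∀ᵐ φ ∂volume.restrict (Ioo 0 κ), ∀ᵐ s, V (s, φ) = V' (s, φ) := by
    rw [cylMeasure_univ] at hU
    filter_upwards [h.slice, h'.slice, ae_ae_of_ae_prod_swap hU] with φ h1 h2 h3
    exact h1.unique h2 h3
  have h1 := h.right
  have h2 := h'.right
  rw [cylMeasure_univ] at h1 h2 ⊢
  exact ae_eq_prod_of_ae_ae_swap h1 h2 hae

theorem IsRadialFourier.congr {κ : ℝ} {U U' V V' : ℝ × ℝ → ℂ} (h : IsRadialFourier κ U V)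
    (hU : U =ᵐ[cylMeasure univ κ] U') (hV : V =ᵐ[cylMeasure univ κ] V') :
    IsRadialFourier κ U' V' := by
  refine ⟨h.left.congr hU, h.right.congr hV, ?_⟩
  rw [cylMeasure_univ] at hU hV
  filter_upwards [h.slice, ae_ae_of_ae_prod_swap hU, ae_ae_of_ae_prod_swap hV] with φ h1 h2 h3
  exact h1.congr h2 h3

theorem IsRadialFourier.symm {κ : ℝ} {U V : ℝ × ℝ → ℂ} (h : IsRadialFourier κ U V) :
    IsRadialFourier κ V fun p => U (-p.1, p.2) := by
  refine ⟨h.right, ?_, ?_⟩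
  · have h1 := h.left
    rw [cylMeasure_univ] at h1 ⊢
    exact h1.comp_quasiMeasurePreserving
      ((Measure.measurePreserving_neg (volume : Measure ℝ)).prod
        (.id (volume.restrict (Ioo 0 κ)))).quasiMeasurePreserving
  · filter_upwards [h.slice] with φ hφ using hφ.symm

/-! ## Testing slices against the kernels of the localised Fourier transforms -/

section Swap

variable {c κ : ℝ} (R : ApproxResolution c (Ioo 0 κ))

/-- The kernel of `f ↦ 𝓕((ξ_ν f)(c^ν ·))(τ)`. -/
def ApproxResolution.kernel (ν : ℤ) (τ φ : ℝ) : ℂ :=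
  (((c ^ ν)⁻¹ : ℝ) : ℂ) * (R.ξ ν φ : ℂ) *
    Complex.exp (((-2 * Real.pi * (((c ^ ν)⁻¹ * φ) * τ) : ℝ) : ℂ) * Complex.I)

theorem ApproxResolution.continuous_kernel (ν : ℤ) :
    Continuous fun q : ℝ × ℝ => R.kernel ν q.1 q.2 := by
  have h1 := (R.smooth ν).continuous
  unfold ApproxResolution.kernel
  fun_prop

theorem ApproxResolution.isTestFun_kernel (ν : ℤ) (τ : ℝ) :
    IsTestFun (Ioo 0 κ) (R.kernel ν τ) := by
  obtain ⟨k, hk⟩ := R.exists_isAdm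
  have h1 : ContDiff ℝ ∞ fun φ : ℝ => (((c ^ ν)⁻¹ : ℝ) : ℂ) *
      Complex.exp (((-2 * Real.pi * (((c ^ ν)⁻¹ * φ) * τ) : ℝ) : ℂ) * Complex.I) := by
    have h2 : ContDiff ℝ ∞ fun φ : ℝ => -2 * Real.pi * (((c ^ ν)⁻¹ * φ) * τ) := by fun_prop
    exact contDiff_const.mul
      (((Complex.ofRealCLM.contDiff.comp h2).mul contDiff_const).cexp)
  have h3 := (hk.isCutoff ν).isTestFun.mul_contDiff h1
  convert h3 using 2 with φ
  rw [ApproxResolution.kernel]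
  ring

theorem ApproxResolution.fourier_dyadicPiece (ν : ℤ) (f : ℝ → ℂ) (τ : ℝ) :
    𝓕 (dyadicPiece R ν f) τ = ∫ φ in Ioo 0 κ, f φ * R.kernel ν τ φ := by
  have hc : 0 < c ^ ν := zpow_pos (by linarith [R.one_lt]) ν
  rw [setIntegral_mul_isTestFun (R.isTestFun_kernel ν τ), Real.fourier_eq',
    ← integral_const_mul_comp_mul_left hc fun φ => f φ * R.kernel ν τ φ]
  refine integral_congr_ae (.of_forall fun x => ?_)
  have h1 : ((c : ℂ) ^ ν) ≠ 0 := by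
    have := hc.ne'
    exact_mod_cast this
  simp only [dyadicPiece, ApproxResolution.kernel, smul_eq_mul]
  rw [inv_mul_cancel_left₀ hc.ne']
  have h2 : (inner ℝ x τ : ℝ) = x * τ := by simp [mul_comm]
  rw [h2]
  push_cast
  field_simp

/-- By Tonelli the integrated norm is built from the numbers `∫ |∫ w(s,φ) b(φ) dφ|² ds`, each `b`
being a test function. Scalar Plancherel for every single `b` then suffices. -/
theorem lintegral_sobNormSq_eq (m : ℕ) (σ : ℝ) {w : ℝ × ℝ → ℂ}
    (hw : AEStronglyMeasurable w (cylMeasure univ κ))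
    (hl : ∀ᵐ s : ℝ, LocallyIntegrableOn (fun φ => w (s, φ)) (Ioo 0 κ)) :
    ∫⁻ s, sobNormSq R m σ (fun φ => w (s, φ)) =
      ∑' ν : ℤ, ENNReal.ofReal (c ^ ((ν : ℝ) * σ)) *
        ∫⁻ τ : ℝ, ENNReal.ofReal ((1 + (2 * Real.pi * τ) ^ 2) ^ m) *
          ∫⁻ s, ‖∫ φ in Ioo 0 κ, w (s, φ) * R.kernel ν τ φ‖ₑ ^ 2 := by
  have he : ∀ᵐ s : ℝ, (fun φ => w (s, φ)) =ᵐ[volume.restrict (Ioo 0 κ)]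
      fun φ => hw.mk w (s, φ) := by
    have := Measure.ae_ae_of_ae_prod hw.ae_eq_mk
    rwa [Measure.restrict_univ] at this
  have hm := hw.stronglyMeasurable_mk
  have hint : ∀ᵐ s : ℝ, ∀ ν τ, ∫ φ in Ioo 0 κ, w (s, φ) * R.kernel ν τ φ =
      ∫ φ in Ioo 0 κ, hw.mk w (s, φ) * R.kernel ν τ φ := by
    filter_upwards [he] with s hs ν τ
    refine integral_congr_ae ?_
    filter_upwards [hs] with φ hφ
    rw [hφ]
  have hG : ∀ ν, StronglyMeasurable fun p : ℝ × ℝ =>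
      ∫ φ in Ioo 0 κ, hw.mk w (p.1, φ) * R.kernel ν p.2 φ := by
    intro ν
    refine StronglyMeasurable.integral_prod_right' (ν := volume.restrict (Ioo 0 κ))
      (f := fun q : (ℝ × ℝ) × ℝ => hw.mk w (q.1.1, q.2) * R.kernel ν q.1.2 q.2) ?_
    have h1 : Measurable fun q : (ℝ × ℝ) × ℝ => (q.1.1, q.2) := by fun_prop
    have h2 : Continuous fun q : (ℝ × ℝ) × ℝ => R.kernel ν q.1.2 q.2 :=
      (R.continuous_kernel ν).comp (f := fun q : (ℝ × ℝ) × ℝ => (q.1.2, q.2)) (by fun_prop)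
    exact (hm.comp_measurable h1).mul h2.stronglyMeasurable
  have hH : ∀ ν, Measurable fun p : ℝ × ℝ => ENNReal.ofReal ((1 + (2 * Real.pi * p.2) ^ 2) ^ m) *
      ‖∫ φ in Ioo 0 κ, hw.mk w (p.1, φ) * R.kernel ν p.2 φ‖ₑ ^ 2 := fun ν => by
    have := (hG ν).measurable
    fun_prop
  calc ∫⁻ s, sobNormSq R m σ (fun φ => w (s, φ))
      = ∫⁻ s, ∑' ν : ℤ, ENNReal.ofReal (c ^ ((ν : ℝ) * σ)) *
        ∫⁻ τ : ℝ, ENNReal.ofReal ((1 + (2 * Real.pi * τ) ^ 2) ^ m) *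
          ‖∫ φ in Ioo 0 κ, hw.mk w (s, φ) * R.kernel ν τ φ‖ₑ ^ 2 := by
        refine lintegral_congr_ae ?_
        filter_upwards [hl, hint] with s h1 h2
        simp only [sobNormSq, h1, if_true, besselNormSq, R.fourier_dyadicPiece, h2]
    _ = ∑' ν : ℤ, ENNReal.ofReal (c ^ ((ν : ℝ) * σ)) *
        ∫⁻ τ : ℝ, ENNReal.ofReal ((1 + (2 * Real.pi * τ) ^ 2) ^ m) *
          ∫⁻ s, ‖∫ φ in Ioo 0 κ, hw.mk w (s, φ) * R.kernel ν τ φ‖ₑ ^ 2 := by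
        rw [lintegral_tsum fun ν => ((hH ν).lintegral_prod_right'.const_mul _).aemeasurable]
        refine tsum_congr fun ν => ?_
        rw [lintegral_const_mul' _ _ (by simp), lintegral_lintegral_swap (hH ν).aemeasurable]
        congr 1
        refine lintegral_congr fun τ => ?_
        exact lintegral_const_mul' (ENNReal.ofReal ((1 + (2 * Real.pi * τ) ^ 2) ^ m)) _
          ENNReal.ofReal_ne_top
    _ = _ := by
        refine tsum_congr fun ν => ?_
        congr 1
        refine lintegral_congr fun τ => ?_
        congr 1
        refine lintegral_congr_ae ?_
        filter_upwards [hint] with s h2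
        rw [h2]

/-- The exceptional set of `s` may depend on `b`, and there are uncountably many `b`. Inserting the
kernels into `lintegral_sobNormSq_eq` avoids this: the norm of order zero vanishes for almost every
`s`, and its density does not vanish on `(0,κ)`. -/
theorem ae_eq_zero_of_forall_integral_mul_isTestFun (R : ApproxResolution c (Ioo 0 κ))
    {w : ℝ × ℝ → ℂ} (hw : AEStronglyMeasurable w (cylMeasure univ κ))
    (hl : ∀ᵐ s : ℝ, LocallyIntegrableOn (fun φ => w (s, φ)) (Ioo 0 κ))
    (h : ∀ b, IsTestFun (Ioo 0 κ) b → ∀ᵐ s : ℝ, ∫ φ in Ioo 0 κ, w (s, φ) * b φ = 0) :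
    w =ᵐ[cylMeasure univ κ] 0 := by
  have h1 : ∫⁻ s, sobNormSq R 0 0 (fun φ => w (s, φ)) = 0 := by
    rw [lintegral_sobNormSq_eq R 0 0 hw hl]
    have h2 : ∀ ν τ, ∫⁻ s, ‖∫ φ in Ioo 0 κ, w (s, φ) * R.kernel ν τ φ‖ₑ ^ 2 = 0 := by
      intro ν τ
      rw [lintegral_congr_ae (g := fun _ => 0)]
      · simp
      filter_upwards [h _ (R.isTestFun_kernel ν τ)] with s hs
      simp [hs]
    simp [h2]
  obtain ⟨k, hk⟩ := R.exists_isAdm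
  have hms : AEMeasurable (fun s => sobNormSq R 0 0 (fun φ => w (s, φ))) := by
    have := aemeasurable_sobNormSq_slice_of_cyl R 0 0 hw
    rwa [Measure.restrict_univ] at this
  rw [lintegral_eq_zero_iff' hms] at h1
  have h3 : ∀ᵐ s : ℝ, ∀ᵐ φ ∂volume.restrict (Ioo 0 κ), w (s, φ) = 0 := by
    filter_upwards [h1, hl] with s hs hls
    rw [sobNormSq_eq_famNormSq R 0 0 hls, hk.famNormSq_zero_eq R.one_lt 0 hls] at hs
    simp only [Pi.zero_apply] at hs
    have hmφ : AEMeasurable (fun φ => famWt c R.ξ 0 φ * ‖w (s, φ)‖ₑ ^ 2)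
        (volume.restrict (Ioo 0 κ)) :=
      (measurable_famWt hk 0).aemeasurable.mul (hls.aestronglyMeasurable.enorm.pow_const 2)
    rw [lintegral_eq_zero_iff' hmφ] at hs
    filter_upwards [hs, ae_restrict_mem measurableSet_Ioo] with φ hφ hφI
    simpa [R.famWt_ne_zero 0 hφI] using hφ
  have h4 : ∫⁻ p, ‖w p‖ₑ ∂cylMeasure univ κ = 0 := by
    have hm := hw.enorm
    rw [cylMeasure_univ] at hm ⊢
    rw [lintegral_prod _ hm, lintegral_congr_ae (g := fun _ => 0)]
    · simp
    filter_upwards [h3] with s hs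
    rw [lintegral_congr_ae (g := fun _ => 0)]
    · simp
    filter_upwards [hs] with φ hφ
    simp [hφ]
  rw [lintegral_eq_zero_iff' hw.enorm] at h4
  filter_upwards [h4] with p hp
  simpa using hp

end Swap

/-! ## Functions that are locally square integrable in the angle -/

/-- `U` is square integrable on `ℝ × K` for all compact `K ⊆ (0,κ)`. -/
structure IsLocL2 (κ : ℝ) (U : ℝ × ℝ → ℂ) : Prop where
  meas : AEStronglyMeasurable U (cylMeasure univ κ)
  lt_top : ∀ K, IsCompact K → K ⊆ Ioo 0 κ → ∫⁻ φ in K, ∫⁻ x, ‖U (x, φ)‖ₑ ^ 2 < ⊤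

section LocL2

variable {κ : ℝ} {U V : ℝ × ℝ → ℂ}

theorem aestronglyMeasurable_prod_restrict {K : Set ℝ} (hKI : K ⊆ Ioo 0 κ)
    (h : AEStronglyMeasurable U (cylMeasure univ κ)) :
    AEStronglyMeasurable U ((volume : Measure ℝ).prod (volume.restrict K)) := by
  rw [cylMeasure_univ] at h
  exact h.mono_measure (Measure.prod_mono le_rfl (Measure.restrict_mono hKI le_rfl))

theorem IsLocL2.memLp (h : IsLocL2 κ U) {K : Set ℝ} (hK : IsCompact K) (hKI : K ⊆ Ioo 0 κ) :
    MemLp U 2 ((volume : Measure ℝ).prod (volume.restrict K)) := by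
  have hm := aestronglyMeasurable_prod_restrict hKI h.meas
  rw [memLp_two_iff_lintegral, lintegral_prod_symm _ (hm.enorm.pow_const 2)]
  exact ⟨hm, h.lt_top K hK hKI⟩

theorem IsLocL2.ae_locallyIntegrableOn (h : IsLocL2 κ U) :
    ∀ᵐ x : ℝ, LocallyIntegrableOn (fun φ => U (x, φ)) (Ioo 0 κ) := by
  have h1 : ∀ m, ∀ᵐ x : ℝ, IntegrableOn (fun φ => U (x, φ)) (innerIcc κ m) := by
    intro m
    have h2 := memLp_two_iff_lintegral.1 (h.memLp (isCompact_innerIcc κ m) (innerIcc_subset κ m))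
    rw [lintegral_prod _ (h2.1.enorm.pow_const 2)] at h2
    have : IsFiniteMeasure (volume.restrict (innerIcc κ m)) :=
      ⟨by simpa using (isCompact_innerIcc κ m).measure_lt_top⟩
    filter_upwards [h2.1.prodMk_left, ae_lt_top' (h2.1.enorm.pow_const 2).lintegral_prod_right'
      h2.2.ne] with x h3 h4
    exact (memLp_two_iff_lintegral.2 ⟨h3, h4⟩).integrable (by norm_num)
  filter_upwards [ae_all_iff.2 h1] with x hx
  exact locallyIntegrableOn_Ioo_iff.2 hx

theorem IsLocL2.ae_lintegral_lt_top (h : IsLocL2 κ U) :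
    ∀ᵐ φ ∂volume.restrict (Ioo 0 κ), ∫⁻ x, ‖U (x, φ)‖ₑ ^ 2 < ⊤ := by
  have h1 : ∀ m, ∀ᵐ φ, φ ∈ innerIcc κ m → ∫⁻ x, ‖U (x, φ)‖ₑ ^ 2 < ⊤ := by
    intro m
    rw [← ae_restrict_iff' (isCompact_innerIcc κ m).measurableSet]
    have hm := aestronglyMeasurable_prod_restrict (innerIcc_subset κ m) h.meas
    exact ae_lt_top' (hm.enorm.pow_const 2).lintegral_prod_left'
      (h.lt_top _ (isCompact_innerIcc κ m) (innerIcc_subset κ m)).ne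
  rw [ae_restrict_iff' measurableSet_Ioo]
  filter_upwards [ae_all_iff.2 h1] with φ hφ hφI
  obtain ⟨m, hm⟩ := exists_innerIcc_mem_nhds hφI
  exact hφ m (mem_of_mem_nhds hm)

theorem IsLocL2.locallyIntegrableOn (h : IsLocL2 κ U) :
    LocallyIntegrableOn U (univ ×ˢ Ioo 0 κ) := by
  rintro ⟨x, φ⟩ ⟨-, hφ⟩
  obtain ⟨m, hm⟩ := exists_innerIcc_mem_nhds hφ
  refine ⟨Icc (x - 1) (x + 1) ×ˢ innerIcc κ m, mem_nhdsWithin_of_mem_nhds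
    (prod_mem_nhds (Icc_mem_nhds (by linarith) (by linarith)) hm), ?_⟩
  have h1 := h.memLp (isCompact_innerIcc κ m) (innerIcc_subset κ m)
  have hfin : volume (Icc (x - 1) (x + 1) ×ˢ innerIcc κ m) ≠ ⊤ :=
    (isCompact_Icc.prod (isCompact_innerIcc κ m)).measure_ne_top
  have : IsFiniteMeasure (volume.restrict (Icc (x - 1) (x + 1) ×ˢ innerIcc κ m)) :=
    ⟨by simpa using hfin.lt_top⟩
  refine MemLp.integrable (q := 2) (by norm_num) (h1.mono_measure ?_)
  rw [Measure.volume_eq_prod, ← Measure.prod_restrict]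
  exact Measure.prod_mono Measure.restrict_le_self le_rfl

theorem IsLocL2.memLp_mul (h : IsLocL2 κ U) {b : ℝ → ℂ} (hb : IsTestFun (Ioo 0 κ) b) :
    MemLp (fun p => U p * b p.2) 2 ((volume : Measure ℝ).prod (volume.restrict (Ioo 0 κ))) := by
  obtain ⟨B, hB⟩ := hb.2.1.exists_bound_of_continuous hb.1.continuous
  have hU := h.meas
  rw [cylMeasure_univ] at hU
  have hm : AEStronglyMeasurable (fun p : ℝ × ℝ => U p * b p.2)
      ((volume : Measure ℝ).prod (volume.restrict (Ioo 0 κ))) :=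
    hU.mul (hb.1.continuous.comp continuous_snd).aestronglyMeasurable
  rw [memLp_two_iff_lintegral]
  refine ⟨hm, ?_⟩
  rw [lintegral_prod_symm _ (hm.enorm.pow_const 2)]
  have h1 : ∫⁻ φ in Ioo 0 κ, ∫⁻ x, ‖U (x, φ) * b φ‖ₑ ^ 2 =
      ∫⁻ φ in tsupport b, ∫⁻ x, ‖U (x, φ) * b φ‖ₑ ^ 2 := by
    have hz : (Function.support fun φ => ∫⁻ x, ‖U (x, φ) * b φ‖ₑ ^ 2) ⊆ tsupport b := by
      intro φ hφ
      by_contra hn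
      exact hφ (by simp [image_eq_zero_of_notMem_tsupport hn])
    rw [setLIntegral_eq_of_support_subset hz,
      setLIntegral_eq_of_support_subset (hz.trans hb.2.2)]
  rw [h1]
  calc ∫⁻ φ in tsupport b, ∫⁻ x, ‖U (x, φ) * b φ‖ₑ ^ 2
      ≤ ∫⁻ φ in tsupport b, ENNReal.ofReal B ^ 2 * ∫⁻ x, ‖U (x, φ)‖ₑ ^ 2 := by
        refine lintegral_mono fun φ => ?_
        rw [← lintegral_const_mul' _ _ (by simp)]
        refine lintegral_mono fun x => ?_
        rw [enorm_mul, mul_pow, mul_comm]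
        gcongr
        rw [← ofReal_norm]
        exact ENNReal.ofReal_le_ofReal (hB φ)
    _ < ⊤ := by
        rw [lintegral_const_mul' _ _ (by simp)]
        exact ENNReal.mul_lt_top (by simp) (h.lt_top _ hb.2.1 hb.2.2)

theorem IsRadialFourier.isLocL2 (h : IsRadialFourier κ U V) (hU : IsLocL2 κ U) :
    IsLocL2 κ V := by
  refine ⟨h.right, fun K hK hKI => ?_⟩
  refine lt_of_le_of_lt (le_of_eq ?_) (hU.lt_top K hK hKI)
  refine lintegral_congr_ae ?_
  filter_upwards [ae_restrict_of_ae_restrict_of_subset hKI h.slice] with φ hφ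
  exact hφ.lintegral_sq

theorem IsRadialFourier.integral_mul (h : IsRadialFourier κ U V) (hU : IsLocL2 κ U) {b : ℝ → ℂ}
    (hb : IsTestFun (Ioo 0 κ) b) :
    IsFourierPair (fun x => ∫ φ in Ioo 0 κ, U (x, φ) * b φ)
      fun s => ∫ φ in Ioo 0 κ, V (s, φ) * b φ := by
  have hV := h.right
  rw [cylMeasure_univ] at hV
  refine isFourierPair_integral (hU.memLp_mul hb)
    (Z := fun p => V p * b p.2) (hV.mul (hb.1.continuous.comp continuous_snd).aestronglyMeasurable) ?_
  filter_upwards [h.slice] with φ hφ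
  have := hφ.smul (b φ)
  convert this using 1 <;> · ext; simp [mul_comm]

theorem IsRadialFourier.lintegral_sobNormSq {c : ℝ} (R : ApproxResolution c (Ioo 0 κ)) (m : ℕ)
    (σ : ℝ) (h : IsRadialFourier κ U V) (hU : IsLocL2 κ U) :
    ∫⁻ s, sobNormSq R m σ (fun φ => V (s, φ)) = ∫⁻ x, sobNormSq R m σ (fun φ => U (x, φ)) := by
  rw [lintegral_sobNormSq_eq R m σ h.left hU.ae_locallyIntegrableOn,
    lintegral_sobNormSq_eq R m σ h.right (h.isLocL2 hU).ae_locallyIntegrableOn]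
  simp only [(h.integral_mul hU (R.isTestFun_kernel _ _)).lintegral_sq]

/-- The norm of order zero is the weakest one, and its density is bounded below on compact sets
whatever `σ` is. -/
theorem isLocL2_of_lintegral_sobNormSq_lt_top {c : ℝ} (R : ApproxResolution c (Ioo 0 κ)) {m : ℕ}
    {σ : ℝ} (hU : AEStronglyMeasurable U (cylMeasure univ κ))
    (h : ∫⁻ x, sobNormSq R m σ (fun φ => U (x, φ)) < ⊤) : IsLocL2 κ U := by
  refine ⟨hU, fun K hK hKI => ?_⟩
  obtain ⟨k, hk⟩ := R.exists_isAdm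
  obtain ⟨ε, hε, hεK⟩ := R.exists_famWt_lower σ hK hKI
  have hms : AEMeasurable (fun s => sobNormSq R m σ (fun φ => U (s, φ))) := by
    have := aemeasurable_sobNormSq_slice_of_cyl R m σ hU
    rwa [Measure.restrict_univ] at this
  have hε0 : (ε : ℝ≥0∞) ≠ 0 := by exact_mod_cast hε.ne'
  have hm := aestronglyMeasurable_prod_restrict hKI hU
  have h1 : ε * ∫⁻ φ in K, ∫⁻ x, ‖U (x, φ)‖ₑ ^ 2 ≤
      ∫⁻ x, sobNormSq R m σ (fun φ => U (x, φ)) := by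
    rw [← lintegral_prod_symm _ (hm.enorm.pow_const 2), lintegral_prod _ (hm.enorm.pow_const 2),
      ← lintegral_const_mul' _ _ (by simp)]
    refine lintegral_mono_ae ?_
    filter_upwards [ae_lt_top' hms h.ne] with x hx
    have hl := locallyIntegrableOn_of_sobNormSq_ne_top hx.ne
    refine le_trans ?_ (sobNormSq_mono R (Nat.zero_le m) σ _)
    rw [sobNormSq_eq_famNormSq R 0 σ hl, hk.famNormSq_zero_eq R.one_lt σ hl,
      ← lintegral_const_mul' _ _ (by simp)]
    calc _ ≤ ∫⁻ φ in K, famWt c R.ξ σ φ * ‖U (x, φ)‖ₑ ^ 2 := by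
          refine setLIntegral_mono' hK.measurableSet fun φ hφ => ?_
          gcongr
          exact hεK φ hφ
      _ ≤ _ := lintegral_mono_set hKI
  by_contra hcon
  rw [not_lt_top_iff] at hcon
  rw [hcon, ENNReal.mul_top hε0] at h1
  exact h.not_ge h1

end LocL2

/-! ## Logarithmic coordinates -/

theorem lintegral_Ioi_eq_lintegral_exp (F : ℝ → ℝ≥0∞) :
    ∫⁻ r in Ioi (0 : ℝ), F r = ∫⁻ x, ENNReal.ofReal (Real.exp x) * F (Real.exp x) := by
  have h := lintegral_image_eq_lintegral_abs_deriv_mul (f := Real.exp) (f' := Real.exp)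
    MeasurableSet.univ (fun x _ => (Real.hasDerivAt_exp x).hasDerivWithinAt)
    Real.exp_injective.injOn F
  rw [image_univ, Real.range_exp, Measure.restrict_univ] at h
  rw [h]
  simp only [abs_of_pos (Real.exp_pos _)]

theorem integral_Ioi_eq_integral_exp (F : ℝ → ℂ) :
    ∫ r in Ioi (0 : ℝ), F r = ∫ x, (Real.exp x : ℂ) * F (Real.exp x) := by
  have h := integral_image_eq_integral_abs_deriv_smul (f := Real.exp) (f' := Real.exp)
    MeasurableSet.univ (fun x _ => (Real.hasDerivAt_exp x).hasDerivWithinAt)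
    Real.exp_injective.injOn F
  rw [image_univ, Real.range_exp, Measure.restrict_univ] at h
  rw [h]
  simp only [abs_of_pos (Real.exp_pos _), Complex.real_smul]

/-- Elements of the spaces are classes modulo null sets, so the change of variables has to respect
null sets; `quasiMeasurePreserving_log` is the other direction. -/
theorem quasiMeasurePreserving_exp :
    Measure.QuasiMeasurePreserving Real.exp volume (volume.restrict (Ioi 0)) := by
  refine ⟨Real.measurable_exp, Measure.AbsolutelyContinuous.mk fun s hs h0 => ?_⟩
  rw [Measure.map_apply Real.measurable_exp hs, ← lintegral_indicator_one
    (Real.measurable_exp hs)]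
  rw [Measure.restrict_apply hs, ← lintegral_indicator_one (hs.inter measurableSet_Ioi)] at h0
  have h1 : ∫⁻ r in Ioi (0 : ℝ), s.indicator 1 r = 0 := by
    rw [← h0, ← lintegral_indicator measurableSet_Ioi]
    congr 1
    rw [indicator_indicator, inter_comm]
  rw [lintegral_Ioi_eq_lintegral_exp, lintegral_eq_zero_iff
    (by have := (measurable_one (α := ℝ≥0∞) (β := ℝ)).indicator hs; fun_prop)] at h1
  rw [lintegral_eq_zero_iff (measurable_one.indicator (Real.measurable_exp hs))]
  filter_upwards [h1] with x hx
  simp only [Pi.zero_apply, mul_eq_zero, ENNReal.ofReal_eq_zero, not_le.2 (Real.exp_pos x),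
    false_or] at hx
  exact hx

theorem quasiMeasurePreserving_log :
    Measure.QuasiMeasurePreserving Real.log (volume.restrict (Ioi 0)) volume := by
  refine ⟨Real.measurable_log, Measure.AbsolutelyContinuous.mk fun s hs h0 => ?_⟩
  rw [Measure.map_apply Real.measurable_log hs, ← lintegral_indicator_one
    (Real.measurable_log hs), lintegral_Ioi_eq_lintegral_exp, lintegral_congr_ae (g := fun _ => 0)]
  · simp
  filter_upwards [measure_eq_zero_iff_ae_notMem.1 h0] with x hx
  simp [indicator, hx]

/-- `U(x,φ) = e^{θx/2} u(e^x,φ)`. -/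
def toLog (θ : ℝ) (u : ℝ × ℝ → ℂ) : ℝ × ℝ → ℂ :=
  fun p => (Real.exp (θ / 2 * p.1) : ℂ) * u (Real.exp p.1, p.2)

/-- The inverse of `toLog`. -/
def ofLog (θ : ℝ) (U : ℝ × ℝ → ℂ) : ℝ × ℝ → ℂ :=
  fun p => (Real.exp (-(θ / 2 * Real.log p.1)) : ℂ) * U (Real.log p.1, p.2)

theorem toLog_ofLog (θ : ℝ) (U : ℝ × ℝ → ℂ) : toLog θ (ofLog θ U) = U := by
  funext p
  simp only [toLog, ofLog, Real.log_exp, ← mul_assoc]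
  rw [← Complex.ofReal_mul, ← Real.exp_add, add_neg_cancel, Real.exp_zero, Complex.ofReal_one,
    one_mul]

theorem ofLog_toLog (θ : ℝ) (u : ℝ × ℝ → ℂ) {p : ℝ × ℝ} (hp : 0 < p.1) :
    ofLog θ (toLog θ u) p = u p := by
  simp only [toLog, ofLog, Real.exp_log hp, ← mul_assoc]
  rw [← Complex.ofReal_mul, ← Real.exp_add, neg_add_cancel, Real.exp_zero, Complex.ofReal_one,
    one_mul]

section Transport

variable {κ : ℝ}

theorem quasiMeasurePreserving_exp_prod : Measure.QuasiMeasurePreserving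
    (Prod.map Real.exp id) (cylMeasure univ κ) (cylMeasure (Ioi 0) κ) := by
  rw [cylMeasure_univ]
  exact QuasiMeasurePreserving.prodMap quasiMeasurePreserving_exp (.id _)

theorem quasiMeasurePreserving_log_prod : Measure.QuasiMeasurePreserving
    (Prod.map Real.log id) (cylMeasure (Ioi 0) κ) (cylMeasure univ κ) := by
  rw [cylMeasure_univ]
  exact QuasiMeasurePreserving.prodMap quasiMeasurePreserving_log (.id _)

theorem aestronglyMeasurable_toLog (θ : ℝ) {u : ℝ × ℝ → ℂ}
    (hu : AEStronglyMeasurable u (cylMeasure (Ioi 0) κ)) :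
    AEStronglyMeasurable (toLog θ u) (cylMeasure univ κ) := by
  have h1 : Continuous fun p : ℝ × ℝ => (Real.exp (θ / 2 * p.1) : ℂ) := by fun_prop
  exact h1.aestronglyMeasurable.mul
    (hu.comp_quasiMeasurePreserving quasiMeasurePreserving_exp_prod)

theorem aestronglyMeasurable_ofLog (θ : ℝ) {U : ℝ × ℝ → ℂ}
    (hU : AEStronglyMeasurable U (cylMeasure univ κ)) :
    AEStronglyMeasurable (ofLog θ U) (cylMeasure (Ioi 0) κ) := by
  have h1 : Measurable fun p : ℝ × ℝ => (Real.exp (-(θ / 2 * Real.log p.1)) : ℂ) := by fun_prop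
  exact h1.aestronglyMeasurable.mul
    (hU.comp_quasiMeasurePreserving quasiMeasurePreserving_log_prod)

theorem toLog_congr (θ : ℝ) {u u' : ℝ × ℝ → ℂ} (h : u =ᵐ[cylMeasure (Ioi 0) κ] u') :
    toLog θ u =ᵐ[cylMeasure univ κ] toLog θ u' := by
  filter_upwards [quasiMeasurePreserving_exp_prod.ae h] with p hp
  simp only [toLog]
  exact congrArg _ hp

theorem ae_eq_of_toLog (θ : ℝ) {u u' : ℝ × ℝ → ℂ}
    (h : toLog θ u =ᵐ[cylMeasure univ κ] toLog θ u') : u =ᵐ[cylMeasure (Ioi 0) κ] u' := by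
  have hpos : ∀ᵐ p ∂cylMeasure (Ioi 0) κ, 0 < p.1 := by
    rw [cylMeasure_Ioi]
    filter_upwards [ae_restrict_mem (measurableSet_Ioi.prod measurableSet_Ioo)] with p hp
    exact hp.1
  filter_upwards [quasiMeasurePreserving_log_prod.ae h, hpos] with p hp h0
  rw [← ofLog_toLog θ u h0, ← ofLog_toLog θ u' h0]
  exact congrArg _ hp

end Transport

/-! ### The norms in the variables `x` and `s`. -/

section Norms

variable {c κ : ℝ} (R : ApproxResolution c (Ioo 0 κ)) (m : ℕ) (σ θ : ℝ)

/-- The Jacobian and the weight combine to `e^x e^{(θ-1)x} = e^{θx}`, the square of the factor in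
`toLog`. -/
theorem mixedNormSq_Ioi_eq (u : ℝ × ℝ → ℂ) :
    mixedNormSq R (Ioi 0) (fun r => ENNReal.ofReal (r ^ (θ - 1))) m σ u =
      ∫⁻ x, sobNormSq R m σ fun φ => toLog θ u (x, φ) := by
  rw [mixedNormSq, lintegral_Ioi_eq_lintegral_exp]
  refine lintegral_congr fun x => ?_
  have h1 : (Real.exp (θ / 2 * x) : ℂ) ≠ 0 := by
    exact_mod_cast (Real.exp_pos _).ne'
  have h2 := sobNormSq_smul R m σ h1 fun φ => u (Real.exp x, φ)
  have h3 : (fun φ => toLog θ u (x, φ)) =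
      (Real.exp (θ / 2 * x) : ℂ) • fun φ => u (Real.exp x, φ) := rfl
  rw [h3, h2, ← mul_assoc, ← ENNReal.ofReal_mul (Real.exp_pos _).le, ← ofReal_norm,
    Complex.norm_real, Real.norm_eq_abs, abs_of_pos (Real.exp_pos _),
    ← ENNReal.ofReal_pow (Real.exp_pos _).le, ← Real.exp_nat_mul, ← Real.exp_mul, ← Real.exp_add]
  congr 3
  push_cast
  ring

/-- `V(s,φ) = v(2πs,φ)`. -/
def toFreq (v : ℝ × ℝ → ℂ) : ℝ × ℝ → ℂ := fun p => v (2 * Real.pi * p.1, p.2)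

/-- The substitution `t = 2πs` absorbs `1/(2π)`, and `|λ|^{2j}` moves inside the slice norm wherever
`λ ≠ 0`. -/
theorem mixedNormSq_univ_eq (j : ℕ) (v : ℝ × ℝ → ℂ) :
    mixedNormSq R univ (fun t => ENNReal.ofReal (1 / (2 * Real.pi)) * ‖linePt θ t‖ₑ ^ (2 * j))
      m σ v =
      ∫⁻ s, sobNormSq R m σ fun φ => linePt θ (2 * Real.pi * s) ^ j * toFreq v (s, φ) := by
  have hne : ∀ᵐ s : ℝ, linePt θ (2 * Real.pi * s) ≠ 0 := by
    have h : ∀ᵐ t : ℝ, t ≠ 0 := by simp [ae_iff]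
    filter_upwards [h] with s hs h0
    have := congrArg Complex.im h0
    simp [linePt, Real.pi_ne_zero] at this
    exact hs this
  have h1 := lintegral_comp_const_mul (a := 2 * Real.pi) (by positivity) fun t =>
    ‖linePt θ t‖ₑ ^ (2 * j) * sobNormSq R m σ fun φ => v (t, φ)
  rw [mixedNormSq, Measure.restrict_univ]
  simp only [mul_assoc]
  rw [lintegral_const_mul' _ _ ENNReal.ofReal_ne_top, one_div, ← h1]
  refine lintegral_congr_ae ?_
  filter_upwards [hne] with s hs
  rw [← enorm_pow_sq, ← sobNormSq_smul R m σ (pow_ne_zero j hs)]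
  simp only [toFreq, Pi.smul_def, smul_eq_mul, mul_assoc]

end Norms

section Freq

variable {κ : ℝ}

theorem quasiMeasurePreserving_mul {a : ℝ} (ha : a ≠ 0) : Measure.QuasiMeasurePreserving
    (Prod.map (fun s => a * s) id) (cylMeasure univ κ) (cylMeasure univ κ) := by
  have h1 : Measure.QuasiMeasurePreserving (fun x : ℝ => a * x) volume volume := by
    refine ⟨by fun_prop, ?_⟩
    rw [Real.map_volume_mul_left ha]
    exact (Measure.AbsolutelyContinuous.refl volume).smul_left _
  rw [cylMeasure_univ]
  exact QuasiMeasurePreserving.prodMap h1 (.id _)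

theorem toFreq_congr {v v' : ℝ × ℝ → ℂ} (h : v =ᵐ[cylMeasure univ κ] v') :
    toFreq v =ᵐ[cylMeasure univ κ] toFreq v' :=
  (quasiMeasurePreserving_mul (by positivity : (2 * Real.pi) ≠ 0)).ae h

theorem aestronglyMeasurable_toFreq {v : ℝ × ℝ → ℂ}
    (h : AEStronglyMeasurable v (cylMeasure univ κ)) :
    AEStronglyMeasurable (toFreq v) (cylMeasure univ κ) :=
  h.comp_quasiMeasurePreserving (quasiMeasurePreserving_mul (by positivity : (2 * Real.pi) ≠ 0))

/-- The inverse of `toFreq`. -/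
def ofFreq (V : ℝ × ℝ → ℂ) : ℝ × ℝ → ℂ := fun p => V ((2 * Real.pi)⁻¹ * p.1, p.2)

theorem toFreq_ofFreq (V : ℝ × ℝ → ℂ) : toFreq (ofFreq V) = V := by
  funext p
  simp only [toFreq, ofFreq]
  rw [inv_mul_cancel_left₀ (by positivity)]

theorem ofFreq_toFreq (V : ℝ × ℝ → ℂ) : ofFreq (toFreq V) = V := by
  funext p
  simp only [toFreq, ofFreq]
  rw [mul_inv_cancel_left₀ (by positivity)]

theorem aestronglyMeasurable_ofFreq {v : ℝ × ℝ → ℂ}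
    (h : AEStronglyMeasurable v (cylMeasure univ κ)) :
    AEStronglyMeasurable (ofFreq v) (cylMeasure univ κ) :=
  h.comp_quasiMeasurePreserving (quasiMeasurePreserving_mul (by positivity : (2 * Real.pi)⁻¹ ≠ 0))

theorem ae_eq_of_toFreq {v v' : ℝ × ℝ → ℂ} (h : toFreq v =ᵐ[cylMeasure univ κ] toFreq v') :
    v =ᵐ[cylMeasure univ κ] v' := by
  rw [← ofFreq_toFreq v, ← ofFreq_toFreq v']
  exact (quasiMeasurePreserving_mul (by positivity : (2 * Real.pi)⁻¹ ≠ 0)).ae h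

end Freq

/-! ## Test functions on the half-line -/

/-- `η ∘ log`, extended by zero. -/
def logPull (η : ℝ → ℂ) : ℝ → ℂ := (Ioi 0).indicator fun r => η (Real.log r)

theorem logPull_exp (η : ℝ → ℂ) (x : ℝ) : logPull η (Real.exp x) = η x := by
  rw [logPull, indicator_of_mem (mem_Ioi.2 (Real.exp_pos x)), Real.log_exp]

theorem isTestFun_logPull {η : ℝ → ℂ} (hη : ContDiff ℝ ∞ η) (hc : HasCompactSupport η) :
    IsTestFun (Ioi 0) (logPull η) := by
  have hK : IsCompact (Real.exp '' tsupport η) := IsCompact.image hc Real.continuous_exp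
  have hs : Function.support (logPull η) ⊆ Real.exp '' tsupport η := by
    intro r hr
    by_cases h0 : 0 < r
    · refine ⟨Real.log r, subset_tsupport _ ?_, Real.exp_log h0⟩
      rw [← Real.exp_log h0] at hr
      rwa [Function.mem_support, logPull_exp] at hr
    · exact absurd (indicator_of_notMem (by simpa using h0) _) hr
  have hts : tsupport (logPull η) ⊆ Real.exp '' tsupport η := closure_minimal hs hK.isClosed
  refine ⟨contDiff_iff_contDiffAt.2 fun r => ?_, hK.of_isClosed_subset (isClosed_tsupport _) hts,
    hts.trans ?_⟩
  · by_cases h0 : 0 < r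
    · have h1 : logPull η =ᶠ[𝓝 r] fun r => η (Real.log r) := by
        filter_upwards [Ioi_mem_nhds h0] with y hy
        exact indicator_of_mem hy _
      exact (hη.contDiffAt.comp r (Real.contDiffAt_log.2 h0.ne')).congr_of_eventuallyEq h1
    · have h1 : r ∉ tsupport (logPull η) := by
        intro h
        obtain ⟨x, -, rfl⟩ := hts h
        exact h0 (Real.exp_pos x)
      exact contDiffAt_const.congr_of_eventuallyEq (notMem_tsupport_iff_eventuallyEq.1 h1)
  · rintro _ ⟨x, -, rfl⟩
    exact Real.exp_pos x

/-- `η(x) = e^{(1-θ/2)x} a(e^x)`. -/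
def expPush (θ : ℝ) (a : ℝ → ℂ) : ℝ → ℂ :=
  fun x => (Real.exp ((1 - θ / 2) * x) : ℂ) * a (Real.exp x)

theorem isTestFun_expPush (θ : ℝ) {a : ℝ → ℂ} (ha : IsTestFun (Ioi 0) a) :
    IsTestFun univ (expPush θ a) := by
  have h1 : ContDiff ℝ ∞ fun x : ℝ => (Real.exp ((1 - θ / 2) * x) : ℂ) :=
    Complex.ofRealCLM.contDiff.comp (Real.contDiff_exp.comp (by fun_prop))
  have hK : IsCompact (Real.log '' tsupport a) :=
    IsCompact.image_of_continuousOn ha.2.1 (Real.continuousOn_log.mono fun r hr =>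
      (mem_Ioi.1 (ha.2.2 hr)).ne')
  refine ⟨h1.mul (ha.1.comp Real.contDiff_exp), ?_, subset_univ _⟩
  refine HasCompactSupport.intro hK fun x hx => ?_
  have : a (Real.exp x) = 0 :=
    image_eq_zero_of_notMem_tsupport fun h => hx ⟨_, h, Real.log_exp x⟩
  simp [expPush, this]

theorem exists_isTestFun_expPush (θ : ℝ) {η : ℝ → ℂ} (hη : ContDiff ℝ ∞ η)
    (hc : HasCompactSupport η) : ∃ a, IsTestFun (Ioi 0) a ∧ expPush θ a = η := by
  have h1 : ContDiff ℝ ∞ fun x : ℝ => (Real.exp (-((1 - θ / 2) * x)) : ℂ) :=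
    Complex.ofRealCLM.contDiff.comp (Real.contDiff_exp.comp (by fun_prop))
  refine ⟨_, isTestFun_logPull (h1.mul hη) hc.mul_left, ?_⟩
  funext x
  rw [expPush, logPull_exp, ← mul_assoc, ← Complex.ofReal_mul, ← Real.exp_add, add_neg_cancel,
    Real.exp_zero, Complex.ofReal_one, one_mul]

/-- This dictates the exponent in `expPush`: the Jacobian `e^x` is split into `e^{θx/2}` for `f` and
`e^{(1-θ/2)x}` for the test function. -/
theorem integral_Ioi_mul_eq (θ : ℝ) (f a : ℝ → ℂ) :
    ∫ r in Ioi (0 : ℝ), f r * a r =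
      ∫ x, ((Real.exp (θ / 2 * x) : ℂ) * f (Real.exp x)) * expPush θ a x := by
  rw [integral_Ioi_eq_integral_exp]
  refine integral_congr_ae (.of_forall fun x => ?_)
  have h : (Real.exp x : ℂ) = (Real.exp (θ / 2 * x) : ℂ) * (Real.exp ((1 - θ / 2) * x) : ℂ) := by
    rw [← Complex.ofReal_mul, ← Real.exp_add]
    ring_nf
  simp only [expPush]
  rw [h]
  ring

/-- In logarithmic coordinates `r∂_r` acts as `d/dx - θ/2`, whose formal adjoint is `-d/dx - θ/2`.
-/
theorem expPush_neg_deriv (θ : ℝ) {a : ℝ → ℂ} (ha : Differentiable ℝ a) (x : ℝ) :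
    expPush θ (fun r => -deriv (fun r : ℝ => (r : ℂ) * a r) r) x =
      -deriv (expPush θ a) x - (θ / 2 : ℂ) * expPush θ a x := by
  have h1 : deriv (fun r : ℝ => (r : ℂ) * a r) (Real.exp x) =
      a (Real.exp x) + (Real.exp x : ℂ) * deriv a (Real.exp x) := by
    have h0 : HasDerivAt (fun r : ℝ => (r : ℂ)) 1 (Real.exp x) := by
      simpa using (hasDerivAt_id (Real.exp x)).ofReal_comp
    have := (h0.mul (ha (Real.exp x)).hasDerivAt).deriv
    rw [one_mul] at this
    exact this
  have h2 : HasDerivAt (expPush θ a)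
      (((Real.exp ((1 - θ / 2) * x) * (1 - θ / 2) : ℝ) : ℂ) * a (Real.exp x) +
        (Real.exp ((1 - θ / 2) * x) : ℂ) * (Real.exp x • deriv a (Real.exp x))) x := by
    have h3 : HasDerivAt (fun x => Real.exp ((1 - θ / 2) * x))
        (Real.exp ((1 - θ / 2) * x) * (1 - θ / 2)) x := by
      simpa using ((hasDerivAt_id x).const_mul (1 - θ / 2)).exp
    exact h3.ofReal_comp.mul
      ((ha (Real.exp x)).hasDerivAt.scomp x (Real.hasDerivAt_exp x))
  rw [h2.deriv]
  simp only [expPush, h1, Complex.real_smul]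
  push_cast
  ring

/-! ## The Mellin transform on the half-line -/

/-- With `r = e^x` one has `r^{-λ-1} dr = e^{-λx} dx`, and on the line `e^{-λx} = e^{θx/2}
e^{-2πisx}`; the real exponential cancels against the one in the test function. -/
theorem mellinTest_logPull (θ : ℝ) (η : ℝ → ℂ) (s : ℝ) :
    mellinTest (logPull fun x => (Real.exp (-(θ / 2 * x)) : ℂ) * η x)
      (linePt θ (2 * Real.pi * s)) = 𝓕 η s := by
  rw [mellinTest, integral_Ioi_eq_integral_exp, Real.fourier_eq']
  refine integral_congr_ae (.of_forall fun x => ?_)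
  simp only [logPull_exp, smul_eq_mul]
  rw [← mul_assoc, ← mul_assoc]
  congr 1
  rw [Complex.ofReal_exp, Complex.ofReal_exp, ← Complex.ofReal_exp,
    Complex.cpow_def_of_ne_zero (by exact_mod_cast (Real.exp_pos x).ne'), ← Complex.ofReal_log
    (Real.exp_pos x).le, Real.log_exp, Complex.ofReal_exp, ← Complex.exp_add, ← Complex.exp_add]
  congr 1
  have h2 : (inner ℝ x s : ℝ) = x * s := by simp [mul_comm]
  rw [h2, linePt]
  push_cast
  ring

/-- `C₀^∞(ℝ)` is dense in `L₂(ℝ)`. Pulled back by the logarithm, the approximants become test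
functions on the half-line, and by Plancherel the squared errors on the two sides differ only by the
factor `2π`. -/
theorem IsFourierPair.isMellinL2 {θ : ℝ} {f g : ℝ → ℂ}
    (h : IsFourierPair (fun x => (Real.exp (θ / 2 * x) : ℂ) * f (Real.exp x))
      fun s => g (2 * Real.pi * s)) : IsMellinL2 θ f g := by
  have hd : ∀ n : ℕ, ∃ η : ℝ → ℂ, HasCompactSupport η ∧ ContDiff ℝ ∞ η ∧
      ∫⁻ x, ‖(Real.exp (θ / 2 * x) : ℂ) * f (Real.exp x) - η x‖ₑ ^ 2 ≤
        ENNReal.ofReal (1 / ((n : ℝ) + 1)) ^ 2 := by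
    intro n
    obtain ⟨η, h1, h2, h3⟩ := h.left.exist_eLpNorm_sub_le (by simp) (by norm_num)
      (ε := 1 / ((n : ℝ) + 1)) (by positivity)
    refine ⟨η, h1, h2, ?_⟩
    rw [← eLpNorm_two_sq]
    exact pow_le_pow_left' h3 2
  choose η hηc hη hle using hd
  have hlim : Tendsto (fun n => ∫⁻ x, ‖(Real.exp (θ / 2 * x) : ℂ) * f (Real.exp x) - η n x‖ₑ ^ 2)
      atTop (𝓝 0) := by
    refine tendsto_of_tendsto_of_tendsto_of_le_of_le tendsto_const_nhds ?_ (fun _ => zero_le) hle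
    have h1 := (ENNReal.continuous_ofReal.tendsto 0).comp
      (tendsto_one_div_add_atTop_nhds_zero_nat (𝕜 := ℝ))
    have h2 := ((ENNReal.continuous_pow 2).tendsto _).comp h1
    rw [ENNReal.ofReal_zero, zero_pow two_ne_zero] at h2
    exact h2
  have hexp : ContDiff ℝ ∞ fun x : ℝ => (Real.exp (-(θ / 2 * x)) : ℂ) :=
    Complex.ofRealCLM.contDiff.comp (Real.contDiff_exp.comp (by fun_prop))
  refine ⟨fun n => logPull fun x => (Real.exp (-(θ / 2 * x)) : ℂ) * η n x,
    fun n => isTestFun_logPull (hexp.mul (hη n)) (hηc n).mul_left, ?_, ?_⟩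
  · refine hlim.congr fun n => ?_
    rw [lintegral_Ioi_eq_lintegral_exp]
    refine lintegral_congr fun x => ?_
    beta_reduce
    rw [logPull_exp, ← mul_assoc, ← ENNReal.ofReal_mul (Real.exp_pos _).le]
    have h1 : Real.exp x * Real.exp x ^ (θ - 1) = Real.exp (θ / 2 * x) ^ 2 := by
      rw [← Real.exp_nat_mul, ← Real.exp_mul, ← Real.exp_add]
      congr 1
      push_cast
      ring
    have h2 : (Real.exp (θ / 2 * x) : ℂ) * f (Real.exp x) - η n x = (Real.exp (θ / 2 * x) : ℂ) *
        (f (Real.exp x) - (Real.exp (-(θ / 2 * x)) : ℂ) * η n x) := by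
      rw [mul_sub, ← mul_assoc, ← Complex.ofReal_mul, ← Real.exp_add, add_neg_cancel,
        Real.exp_zero, Complex.ofReal_one, one_mul]
    rw [h1, h2, enorm_mul, mul_pow, ENNReal.ofReal_pow (Real.exp_pos _).le]
    congr 2
    rw [← ofReal_norm, Complex.norm_real, Real.norm_eq_abs, abs_of_pos (Real.exp_pos _)]
  · have h1 : ∀ n, ∫⁻ t, ‖g t - mellinTest (logPull fun x =>
        (Real.exp (-(θ / 2 * x)) : ℂ) * η n x) (linePt θ t)‖ₑ ^ 2 = ENNReal.ofReal (2 * Real.pi) *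
        ∫⁻ x, ‖(Real.exp (θ / 2 * x) : ℂ) * f (Real.exp x) - η n x‖ₑ ^ 2 := by
      intro n
      have hint : Integrable (η n) := (hη n).continuous.integrable_of_hasCompactSupport (hηc n)
      have hη2 : MemLp (η n) 2 := (hη n).continuous.memLp_of_hasCompactSupport (hηc n)
      have h2 := (h.sub (isFourierPair_of_integrable hint hη2)).lintegral_sq
      simp only [Pi.sub_apply] at h2
      have h3 := lintegral_comp_const_mul (a := 2 * Real.pi) (by positivity) fun t =>
        ‖g t - mellinTest (logPull fun x =>
        (Real.exp (-(θ / 2 * x)) : ℂ) * η n x) (linePt θ t)‖ₑ ^ 2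
      simp only [mellinTest_logPull] at h3
      rw [← h2, h3, ← mul_assoc, ← ENNReal.ofReal_mul (by positivity),
        mul_inv_cancel₀ (by positivity), ENNReal.ofReal_one, one_mul]
    simp only [h1]
    have h2 := ENNReal.Tendsto.const_mul hlim
      (Or.inr (ENNReal.ofReal_ne_top (r := 2 * Real.pi)))
    rwa [mul_zero] at h2

/-! ## Euler derivatives and multiplication by the Mellin variable -/

section Euler

variable {κ : ℝ}

theorem IsEulerDeriv.of_succ {j : ℕ} {u w w' : ℝ × ℝ → ℂ} (h : IsEulerDeriv κ j u w)
    (h' : IsEulerDeriv κ (j + 1) u w') : IsEulerDeriv κ 1 w w' := by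
  refine ⟨h'.1, fun ψ hψ => ?_⟩
  rw [h'.2 ψ hψ, Function.iterate_one, h.2 _ hψ.eulerAdj, Function.iterate_succ_apply]

theorem IsEulerDeriv.succ {j : ℕ} {u w w' : ℝ × ℝ → ℂ} (h : IsEulerDeriv κ j u w)
    (h' : IsEulerDeriv κ 1 w w') : IsEulerDeriv κ (j + 1) u w' := by
  refine ⟨h'.1, fun ψ hψ => ?_⟩
  rw [h'.2 ψ hψ, Function.iterate_one, h.2 _ hψ.eulerAdj, Function.iterate_succ_apply]

theorem isEulerDeriv_zero {u : ℝ × ℝ → ℂ}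
    (h : LocallyIntegrableOn u (Ioi 0 ×ˢ Ioo 0 κ) volume) : IsEulerDeriv κ 0 u u :=
  ⟨h, fun _ _ => rfl⟩

theorem IsEulerDeriv.ae_eq {j : ℕ} {u w w' : ℝ × ℝ → ℂ} (h : IsEulerDeriv κ j u w)
    (h' : IsEulerDeriv κ j u w') : w =ᵐ[cylMeasure (Ioi 0) κ] w' := by
  have hO : IsOpen (Ioi (0 : ℝ) ×ˢ Ioo 0 κ) := isOpen_Ioi.prod isOpen_Ioo
  have h1 : ∀ᵐ x, x ∈ Ioi (0 : ℝ) ×ˢ Ioo 0 κ → (w - w') x = 0 := by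
    refine hO.ae_eq_zero_of_integral_contDiff_smul_eq_zero (h.1.sub h'.1) fun η hη hc hs => ?_
    have ht : IsTestFun (Ioi (0 : ℝ) ×ˢ Ioo 0 κ) fun x => (η x : ℂ) := by
      refine ⟨Complex.ofRealCLM.contDiff.comp hη,
        hc.comp_left (g := ((↑) : ℝ → ℂ)) (by simp), ?_⟩
      exact (closure_mono fun x hx => by simpa using hx).trans hs
    have h2 := (h.2 _ ht).trans (h'.2 _ ht).symm
    have hz : ∀ x, x ∉ Ioi (0 : ℝ) ×ˢ Ioo 0 κ → (η x : ℂ) = 0 := fun x hx =>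
      image_eq_zero_of_notMem_tsupport (f := fun x => (η x : ℂ)) fun h => hx (ht.2.2 h)
    rw [setIntegral_eq_integral_of_forall_compl_eq_zero fun x hx => by rw [hz x hx, mul_zero],
      setIntegral_eq_integral_of_forall_compl_eq_zero fun x hx => by rw [hz x hx, mul_zero]] at h2
    simp only [Complex.real_smul, Pi.sub_apply, mul_sub]
    rw [integral_sub]
    · simp only [mul_comm] at h2 ⊢
      rw [h2, sub_self]
    · simpa only [mul_comm] using ht.integrable_mul h.1
    · simpa only [mul_comm] using ht.integrable_mul h'.1
  rw [cylMeasure_Ioi, EventuallyEq, ae_restrict_iff' hO.measurableSet]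
  filter_upwards [h1] with x hx hxO
  exact sub_eq_zero.1 (hx hxO)

theorem IsLocL2.locallyIntegrableOn_ofLog (θ : ℝ) {U : ℝ × ℝ → ℂ} (hU : IsLocL2 κ U) :
    LocallyIntegrableOn (ofLog θ U) (Ioi 0 ×ˢ Ioo 0 κ) := by
  rintro ⟨r, φ⟩ ⟨hr, hφ⟩
  obtain ⟨m, hm⟩ := exists_innerIcc_mem_nhds hφ
  have hr : 0 < r := hr
  have hr2 : 0 < r / 2 := by positivity
  refine ⟨Icc (r / 2) (2 * r) ×ˢ innerIcc κ m, mem_nhdsWithin_of_mem_nhds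
    (prod_mem_nhds (Icc_mem_nhds (by linarith) (by linarith)) hm), ?_⟩
  have hsub : Icc (r / 2) (2 * r) ⊆ Ioi 0 := fun x hx => hr2.trans_le hx.1
  have hmeas : AEStronglyMeasurable (ofLog θ U)
      ((volume.restrict (Icc (r / 2) (2 * r))).prod (volume.restrict (innerIcc κ m))) :=
    (aestronglyMeasurable_ofLog θ hU.meas).mono_measure (Measure.prod_mono
      (Measure.restrict_mono hsub le_rfl) (Measure.restrict_mono (innerIcc_subset κ m) le_rfl))
  obtain ⟨C, hC⟩ := (isCompact_Icc (a := Real.log (r / 2)) (b := Real.log (2 * r))).exists_bound_of_continuousOn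
    (f := fun x : ℝ => Real.exp x * Real.exp (-(θ / 2 * x))) (by fun_prop)
  have hlog : ∀ x, Real.exp x ∈ Icc (r / 2) (2 * r) →
      x ∈ Icc (Real.log (r / 2)) (Real.log (2 * r)) := fun x hx =>
    ⟨(Real.log_le_iff_le_exp hr2).2 hx.1, (Real.le_log_iff_exp_le (by positivity)).2 hx.2⟩
  have hbox : IntegrableOn U
      (Icc (Real.log (r / 2)) (Real.log (2 * r)) ×ˢ innerIcc κ m) :=
    hU.locallyIntegrableOn.integrableOn_compact_subset
      (prod_mono (subset_univ _) (innerIcc_subset κ m))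
      (isCompact_Icc.prod (isCompact_innerIcc κ m))
  rw [IntegrableOn, Measure.volume_eq_prod, ← Measure.prod_restrict] at hbox ⊢
  refine ⟨hmeas, ?_⟩
  rw [HasFiniteIntegral, lintegral_prod_symm _ hmeas.enorm]
  have h2 := hbox.2
  rw [HasFiniteIntegral, lintegral_prod_symm _ hbox.1.enorm] at h2
  refine lt_of_le_of_lt ?_ (ENNReal.mul_lt_top (ENNReal.ofReal_lt_top (r := C)) h2)
  rw [← lintegral_const_mul' _ _ ENNReal.ofReal_ne_top]
  refine lintegral_mono fun φ => ?_
  rw [← lintegral_const_mul' _ _ ENNReal.ofReal_ne_top, ← lintegral_indicator measurableSet_Icc,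
    ← lintegral_indicator measurableSet_Icc]
  calc ∫⁻ x, (Icc (r / 2) (2 * r)).indicator (fun x => ‖ofLog θ U (x, φ)‖ₑ) x
      = ∫⁻ x in Ioi 0, (Icc (r / 2) (2 * r)).indicator (fun x => ‖ofLog θ U (x, φ)‖ₑ) x := by
        rw [← lintegral_indicator measurableSet_Ioi, indicator_indicator,
          inter_eq_self_of_subset_right hsub]
    _ = ∫⁻ x, ENNReal.ofReal (Real.exp x) *
          (Icc (r / 2) (2 * r)).indicator (fun x => ‖ofLog θ U (x, φ)‖ₑ) (Real.exp x) :=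
        lintegral_Ioi_eq_lintegral_exp _
    _ ≤ _ := by
        refine lintegral_mono fun x => ?_
        by_cases hx : Real.exp x ∈ Icc (r / 2) (2 * r)
        · beta_reduce
          rw [indicator_of_mem hx, indicator_of_mem (hlog x hx)]
          simp only [ofLog, Real.log_exp]
          rw [enorm_mul, ← mul_assoc]
          gcongr
          rw [← ofReal_norm, Complex.norm_real, Real.norm_eq_abs, abs_of_pos (Real.exp_pos _),
            ← ENNReal.ofReal_mul (Real.exp_pos _).le]
          exact ENNReal.ofReal_le_ofReal ((le_abs_self _).trans (hC x (hlog x hx)))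
        · beta_reduce
          rw [indicator_of_notMem hx, mul_zero]
          exact zero_le

/-- Integration by parts read off from the transforms: pairing `G = 2πis F` with `𝓕⁻ η` lets the
factor `2πis` fall on `η` as a derivative. -/
theorem IsFourierPair.integral_mul_deriv {f F g G : ℝ → ℂ} (h : IsFourierPair f F)
    (h' : IsFourierPair g G) (hG : ∀ᵐ s : ℝ, G s = 2 * Real.pi * Complex.I * s * F s)
    {η : ℝ → ℂ} (hη : ContDiff ℝ ∞ η) (hc : HasCompactSupport η) :
    ∫ x, g x * η x = -∫ x, f x * deriv η x := by
  obtain ⟨ψ, hψ⟩ := exists_schwartzMap_eq hη hc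
  have hψ' : ∀ x, (SchwartzMap.derivCLM ℂ ℂ ψ : 𝓢(ℝ, ℂ)) x = deriv η x := fun x => by
    rw [SchwartzMap.derivCLM_apply]
    exact congrArg (fun f => deriv f x) (funext hψ)
  have h1 := h'.pairing (𝓕⁻ ψ)
  have h2 := h.pairing (𝓕⁻ (SchwartzMap.derivCLM ℂ ℂ ψ))
  rw [FourierTransform.fourier_fourierInv_eq] at h1 h2
  simp only [hψ, hψ'] at h1 h2
  rw [← h1, ← h2, ← integral_neg]
  refine integral_congr_ae ?_
  filter_upwards [hG] with s hs
  rw [hs, fourierInv_derivCLM_apply]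
  ring

theorem linePt_two_pi_mul (θ s : ℝ) :
    linePt θ (2 * Real.pi * s) = 2 * Real.pi * Complex.I * s - θ / 2 := by
  rw [linePt]
  push_cast
  ring

variable {θ : ℝ} {w w' V V' : ℝ × ℝ → ℂ}

theorem isTestFun_slice {ψ : ℝ × ℝ → ℂ} (hψ : IsTestFun (Ioi 0 ×ˢ Ioo 0 κ) ψ) (φ : ℝ) :
    IsTestFun (Ioi 0) fun r => ψ (r, φ) := by
  have hK : IsCompact (Prod.fst '' tsupport ψ) := IsCompact.image hψ.2.1 continuous_fst
  have hs : tsupport (fun r => ψ (r, φ)) ⊆ Prod.fst '' tsupport ψ :=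
    closure_minimal (fun r hr => ⟨(r, φ), subset_tsupport _ hr, rfl⟩) hK.isClosed
  refine ⟨hψ.1.comp (by fun_prop), hK.of_isClosed_subset (isClosed_tsupport _) hs, hs.trans ?_⟩
  rintro _ ⟨p, hp, rfl⟩
  exact (hψ.2.2 hp).1

theorem isTestFun_prod {a b : ℝ → ℂ} (ha : IsTestFun (Ioi 0) a) (hb : IsTestFun (Ioo 0 κ) b) :
    IsTestFun (Ioi 0 ×ˢ Ioo 0 κ) fun p => a p.1 * b p.2 := by
  have hK : IsCompact (tsupport a ×ˢ tsupport b) := IsCompact.prod ha.2.1 hb.2.1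
  have hs : tsupport (fun p : ℝ × ℝ => a p.1 * b p.2) ⊆ tsupport a ×ˢ tsupport b := by
    refine closure_minimal (fun p hp => ?_) hK.isClosed
    exact ⟨subset_tsupport _ (left_ne_zero_of_mul hp), subset_tsupport _ (right_ne_zero_of_mul hp)⟩
  exact ⟨(ha.1.comp contDiff_fst).mul (hb.1.comp contDiff_snd),
    hK.of_isClosed_subset (isClosed_tsupport _) hs, hs.trans (prod_mono ha.2.2 hb.2.2)⟩

theorem setIntegral_prod_test {ψ : ℝ × ℝ → ℂ} (hψ : IsTestFun (Ioi 0 ×ˢ Ioo 0 κ) ψ)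
    (hw : LocallyIntegrableOn w (Ioi 0 ×ˢ Ioo 0 κ)) :
    ∫ p in Ioi 0 ×ˢ Ioo 0 κ, w p * ψ p =
      ∫ φ in Ioo 0 κ, ∫ r in Ioi (0 : ℝ), w (r, φ) * ψ (r, φ) := by
  have h1 := (hψ.integrable_mul hw).integrableOn (s := Ioi 0 ×ˢ Ioo 0 κ)
  rw [IntegrableOn, ← cylMeasure_Ioi, cylMeasure] at h1
  rw [← cylMeasure_Ioi, cylMeasure, integral_prod_symm _ h1]

/-- Here the relation is known on almost every slice in `φ`, where it says that `toLog θ w` has the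
weak derivative `toLog θ w' + (θ/2) toLog θ w`. Slicing the two-variable test function and using
Fubini gives the claim. -/
theorem isEulerDeriv_one_of_isRadialFourier (hw : LocallyIntegrableOn w (Ioi 0 ×ˢ Ioo 0 κ))
    (hw' : LocallyIntegrableOn w' (Ioi 0 ×ˢ Ioo 0 κ)) (h : IsRadialFourier κ (toLog θ w) V)
    (h' : IsRadialFourier κ (toLog θ w') V')
    (hV : V' =ᵐ[cylMeasure univ κ] fun p => linePt θ (2 * Real.pi * p.1) * V p) :
    IsEulerDeriv κ 1 w w' := by
  refine ⟨hw', fun ψ hψ => ?_⟩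
  rw [Function.iterate_one, setIntegral_prod_test hψ hw', setIntegral_prod_test hψ.eulerAdj hw]
  rw [cylMeasure_univ] at hV
  refine integral_congr_ae ?_
  filter_upwards [h.slice, h'.slice, ae_ae_of_ae_prod_swap hV] with φ h1 h2 h3
  have ha := isTestFun_slice hψ φ
  have hη := isTestFun_expPush θ ha
  -- Adding `θ/2` times the first transform turns the symbol `λ` into `2πis`.
  have h4 := h1.integral_mul_deriv (h2.add (h1.smul (θ / 2 : ℂ))) (by
    filter_upwards [h3] with s hs
    simp only [Pi.add_apply, Pi.smul_apply, smul_eq_mul]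
    rw [hs, linePt_two_pi_mul]
    ring) hη.1 hη.2.1
  have hi1 : Integrable fun x => toLog θ w' (x, φ) * expPush θ (fun r => ψ (r, φ)) x :=
    hη.integrable_mul (h2.left.locallyIntegrable_two.locallyIntegrableOn _)
  have hi2 : Integrable fun x => toLog θ w (x, φ) * expPush θ (fun r => ψ (r, φ)) x :=
    hη.integrable_mul (h1.left.locallyIntegrable_two.locallyIntegrableOn _)
  have hi3 : Integrable fun x => toLog θ w (x, φ) * deriv (expPush θ (fun r => ψ (r, φ))) x := by
    have := (hη.iteratedDeriv 1).integrable_mul (h1.left.locallyIntegrable_two.locallyIntegrableOn _)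
    rwa [iteratedDeriv_one] at this
  rw [integral_Ioi_mul_eq θ, integral_Ioi_mul_eq θ]
  have h5 : ∀ x, expPush θ (fun r => eulerAdj ψ (r, φ)) x = _ :=
    expPush_neg_deriv θ (ha.1.differentiable (by simp))
  simp only [h5]
  change ∫ x, toLog θ w' (x, φ) * _ = ∫ x, toLog θ w (x, φ) * _
  simp only [Pi.add_apply, Pi.smul_apply, smul_eq_mul, add_mul, mul_assoc] at h4
  rw [integral_add hi1 (hi2.const_mul _), integral_const_mul] at h4
  simp only [mul_sub, mul_neg]
  have h6 : ∀ x, toLog θ w (x, φ) * ((θ / 2 : ℂ) * expPush θ (fun r => ψ (r, φ)) x) =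
      (θ / 2 : ℂ) * (toLog θ w (x, φ) * expPush θ (fun r => ψ (r, φ)) x) := fun x => by ring
  simp only [h6]
  have hi3' : Integrable fun x =>
      -(toLog θ w (x, φ) * deriv (expPush θ (fun r => ψ (r, φ))) x) := hi3.neg
  rw [integral_sub hi3' (hi2.const_mul _), integral_neg, integral_const_mul, ← h4]
  ring

theorem setIntegral_prod_tensor {a b : ℝ → ℂ} (ha : IsTestFun (Ioi 0) a)
    (hb : IsTestFun (Ioo 0 κ) b) (hw : LocallyIntegrableOn w (Ioi 0 ×ˢ Ioo 0 κ)) :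
    ∫ p in Ioi 0 ×ˢ Ioo 0 κ, w p * (a p.1 * b p.2) =
      ∫ x, (∫ φ in Ioo 0 κ, toLog θ w (x, φ) * b φ) * expPush θ a x := by
  have h1 := ((isTestFun_prod ha hb).integrable_mul hw).integrableOn (s := Ioi 0 ×ˢ Ioo 0 κ)
  rw [IntegrableOn, ← cylMeasure_Ioi, cylMeasure] at h1
  rw [← cylMeasure_Ioi, cylMeasure, integral_prod _ h1]
  have h2 : ∀ r, ∫ φ in Ioo 0 κ, w (r, φ) * (a r * b φ) =
      (∫ φ in Ioo 0 κ, w (r, φ) * b φ) * a r := fun r => by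
    rw [← integral_mul_const]
    exact integral_congr_ae (.of_forall fun φ => by ring)
  simp only [h2]
  rw [integral_Ioi_mul_eq θ]
  refine integral_congr_ae (.of_forall fun x => ?_)
  beta_reduce
  rw [← integral_const_mul]
  congr 2
  funext φ
  simp only [toLog, mul_assoc]

/-- The distributional relation in two variables is tested with products `a(r) b(φ)`. For fixed `b`
it becomes a weak derivative relation in `x` between integrals over `φ`, whose Fourier transform
says that `V' - λV` is orthogonal to `b` for almost every `s`;
`ae_eq_zero_of_forall_integral_mul_isTestFun` then removes `b`. -/
theorem IsEulerDeriv.ae_eq_linePt_mul {c : ℝ} (R : ApproxResolution c (Ioo 0 κ))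
    (he : IsEulerDeriv κ 1 w w') (hw : LocallyIntegrableOn w (Ioi 0 ×ˢ Ioo 0 κ))
    (hL : IsLocL2 κ (toLog θ w)) (hL' : IsLocL2 κ (toLog θ w'))
    (h : IsRadialFourier κ (toLog θ w) V) (h' : IsRadialFourier κ (toLog θ w') V') :
    V' =ᵐ[cylMeasure univ κ] fun p => linePt θ (2 * Real.pi * p.1) * V p := by
  have hVl := h.isLocL2 hL
  have hVl' := h'.isLocL2 hL'
  have hcont : Continuous fun p : ℝ × ℝ => linePt θ (2 * Real.pi * p.1) :=
    (continuous_linePt θ).comp (by fun_prop)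
  have key := ae_eq_zero_of_forall_integral_mul_isTestFun R
    (w := fun p => V' p - linePt θ (2 * Real.pi * p.1) * V p)
    (h'.right.sub (hcont.aestronglyMeasurable.mul h.right)) (by
      filter_upwards [hVl.ae_locallyIntegrableOn, hVl'.ae_locallyIntegrableOn] with s h1 h2
      exact h2.sub (h1.smul (linePt θ (2 * Real.pi * s)))) fun b hb => by
    have hX := h.integral_mul hL hb
    have hX' := h'.integral_mul hL' hb
    have hwd : IsWeakDeriv univ 1 (fun x => ∫ φ in Ioo 0 κ, toLog θ w (x, φ) * b φ)
        ((fun x => ∫ φ in Ioo 0 κ, toLog θ w' (x, φ) * b φ) +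
          (θ / 2 : ℂ) • fun x => ∫ φ in Ioo 0 κ, toLog θ w (x, φ) * b φ) := by
      have l1 := hX.left.locallyIntegrable_two.locallyIntegrableOn univ
      have l2 := hX'.left.locallyIntegrable_two.locallyIntegrableOn univ
      refine ⟨l1, l2.add (l1.smul _), fun η hη => ?_⟩
      obtain ⟨a, ha, rfl⟩ := exists_isTestFun_expPush θ hη.1 hη.2.1
      have e1 := he.2 _ (isTestFun_prod ha hb)
      have e2 : ∀ p : ℝ × ℝ, eulerAdj (fun p => a p.1 * b p.2) p =
          -deriv (fun r : ℝ => (r : ℂ) * a r) p.1 * b p.2 := fun p => by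
        simp only [eulerAdj, ← mul_assoc]
        rw [deriv_mul_const_field, neg_mul]
      have hadj : IsTestFun (Ioi 0) fun r => -deriv (fun r : ℝ => (r : ℂ) * a r) r := by
        have h3 := (ha.mul_contDiff (ψ := fun r : ℝ => (r : ℂ)) Complex.ofRealCLM.contDiff)
        have h4 := h3.iteratedDeriv 1
        rw [iteratedDeriv_one] at h4
        simp only [mul_comm (a _)] at h4
        exact ⟨h4.1.neg, h4.2.1.neg, by
          rw [show (fun r => -deriv (fun r : ℝ => (r : ℂ) * a r) r) =
            -deriv (fun r : ℝ => (r : ℂ) * a r) from rfl, tsupport_neg]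
          exact h4.2.2⟩
      rw [Function.iterate_one] at e1
      simp only [e2] at e1
      rw [setIntegral_prod_tensor (θ := θ) ha hb he.1,
        setIntegral_prod_tensor (θ := θ) hadj hb hw] at e1
      simp only [expPush_neg_deriv θ (ha.1.differentiable (by simp))] at e1
      have i1 := hη.integrable_mul l1
      have i2 := hη.integrable_mul l2
      have i3 := (hη.iteratedDeriv 1).integrable_mul l1
      rw [iteratedDeriv_one] at i3
      simp only [setIntegral_univ, iteratedDeriv_one, pow_one, neg_one_mul, Pi.add_apply,
        Pi.smul_apply, smul_eq_mul, add_mul, mul_assoc]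
      rw [integral_add i2 (i1.const_mul _), integral_const_mul, e1]
      simp only [mul_sub, mul_neg]
      have e3 : ∀ x, (∫ φ in Ioo 0 κ, toLog θ w (x, φ) * b φ) * ((θ / 2 : ℂ) * expPush θ a x) =
          (θ / 2 : ℂ) * ((∫ φ in Ioo 0 κ, toLog θ w (x, φ) * b φ) * expPush θ a x) :=
        fun x => by ring
      simp only [e3]
      have i3' : Integrable fun x =>
          -((∫ φ in Ioo 0 κ, toLog θ w (x, φ) * b φ) * deriv (expPush θ a) x) := i3.neg
      rw [integral_sub i3' (i1.const_mul _), integral_neg, integral_const_mul]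
      ring
    have hp := hwd.isFourierPair_right (hX'.left.add (hX.left.const_smul _)) hX
    have hu := hp.unique (hX'.add (hX.smul (θ / 2 : ℂ))) .rfl
    filter_upwards [hu, hVl.ae_locallyIntegrableOn, hVl'.ae_locallyIntegrableOn] with s hs h1 h2
    simp only [Pi.add_apply, Pi.smul_apply, smul_eq_mul] at hs
    have e : ∀ φ, (V' (s, φ) - linePt θ (2 * Real.pi * s) * V (s, φ)) * b φ =
        V' (s, φ) * b φ - linePt θ (2 * Real.pi * s) * (V (s, φ) * b φ) := fun φ => by ring
    simp only [e]
    rw [integral_sub (hb.integrable_mul h2).integrableOn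
      ((hb.integrable_mul h1).integrableOn.const_mul _), integral_const_mul, linePt_two_pi_mul,
      sub_mul, hs]
    ring
  filter_upwards [key] with p hp
  exact sub_eq_zero.1 hp

end Euler

/-! ## The Mellin transform between the spaces `P` and `Y` -/

section Pairs

variable {κ : ℝ} {U U' V V' : ℝ × ℝ → ℂ}

theorem IsRadialFourier.add (h : IsRadialFourier κ U V) (h' : IsRadialFourier κ U' V') :
    IsRadialFourier κ (U + U') (V + V') := by
  refine ⟨h.left.add h'.left, h.right.add h'.right, ?_⟩
  filter_upwards [h.slice, h'.slice] with φ h1 h2 using h1.add h2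

theorem IsRadialFourier.smul (a : ℂ) (h : IsRadialFourier κ U V) :
    IsRadialFourier κ (a • U) (a • V) := by
  refine ⟨h.left.const_smul a, h.right.const_smul a, ?_⟩
  filter_upwards [h.slice] with φ h1 using h1.smul a

/-- The Fourier transform has order four, so three further transforms lead from `V` back to `U`, and
uniqueness holds at each of them. -/
theorem IsRadialFourier.unique_left (h : IsRadialFourier κ U V) (h' : IsRadialFourier κ U' V')
    (hV : V =ᵐ[cylMeasure univ κ] V') : U =ᵐ[cylMeasure univ κ] U' := by
  have h1 := h.symm.unique h'.symm hV
  have h2 := h.symm.symm.unique h'.symm.symm h1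
  simpa only [neg_neg] using h.symm.symm.symm.unique h'.symm.symm.symm h2

/-- For the same reason the inverse transform is the third power of the transform, that is, the
reflection of the transform of `V`. -/
theorem IsLocL2.exists_isRadialFourier_inv (hV : IsLocL2 κ V) :
    ∃ U, IsLocL2 κ U ∧ IsRadialFourier κ U V := by
  obtain ⟨F, hF⟩ := exists_isRadialFourier hV.meas hV.ae_lintegral_lt_top
  have h3 := hF.symm.symm.symm
  simp only [neg_neg] at h3
  exact ⟨_, hF.symm.symm.isLocL2 (hF.symm.isLocL2 (hF.isLocL2 hV)), h3⟩

variable {θ : ℝ}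

/-- `v` is the radial Mellin transform of `u`, in logarithmic coordinates. -/
def IsMellinPair (κ θ : ℝ) (u v : ℝ × ℝ → ℂ) : Prop :=
  IsRadialFourier κ (toLog θ u) (toFreq v)

variable {u u' v v' : ℝ × ℝ → ℂ}

theorem IsMellinPair.isRadialMellin (h : IsMellinPair κ θ u v) : IsRadialMellin κ θ u v := by
  filter_upwards [h.slice] with φ hφ
  exact IsFourierPair.isMellinL2 (f := fun r => u (r, φ)) (g := fun t => v (t, φ)) hφ

theorem IsMellinPair.congr (h : IsMellinPair κ θ u v) (hu : u =ᵐ[cylMeasure (Ioi 0) κ] u')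
    (hv : v =ᵐ[cylMeasure univ κ] v') : IsMellinPair κ θ u' v' :=
  IsRadialFourier.congr h (toLog_congr θ hu) (toFreq_congr hv)

theorem IsMellinPair.add (h : IsMellinPair κ θ u v) (h' : IsMellinPair κ θ u' v') :
    IsMellinPair κ θ (u + u') (v + v') := by
  have h1 := IsRadialFourier.add h h'
  have h2 : toLog θ u + toLog θ u' = toLog θ (u + u') := by
    funext p
    simp [toLog, mul_add]
  rwa [h2] at h1

theorem IsMellinPair.smul (a : ℂ) (h : IsMellinPair κ θ u v) :
    IsMellinPair κ θ (a • u) (a • v) := by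
  have h1 := IsRadialFourier.smul a h
  have h2 : a • toLog θ u = toLog θ (a • u) := by
    funext p
    simp only [toLog, Pi.smul_apply, smul_eq_mul]
    ring
  rwa [h2] at h1

theorem IsMellinPair.unique (h : IsMellinPair κ θ u v) (h' : IsMellinPair κ θ u' v')
    (hu : u =ᵐ[cylMeasure (Ioi 0) κ] u') : v =ᵐ[cylMeasure univ κ] v' :=
  ae_eq_of_toFreq (IsRadialFourier.unique h h' (toLog_congr θ hu))

theorem IsMellinPair.unique_left (h : IsMellinPair κ θ u v) (h' : IsMellinPair κ θ u' v')
    (hv : v =ᵐ[cylMeasure univ κ] v') : u =ᵐ[cylMeasure (Ioi 0) κ] u' :=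
  ae_eq_of_toLog θ (IsRadialFourier.unique_left h h' (toFreq_congr hv))

end Pairs

/-! ### The transform on the two spaces. -/

section Spaces

variable {c κ : ℝ} (R : ApproxResolution c (Ioo 0 κ)) (γ : ℕ) (Θ θ : ℝ)

theorem yNormSq_congr {v v' : ℝ × ℝ → ℂ} (h : v =ᵐ[cylMeasure univ κ] v') :
    yNormSq R γ Θ θ v = yNormSq R γ Θ θ v' :=
  Finset.sum_congr rfl fun _ _ => mixedNormSq_congr R _ _ _ h

theorem iInf_mixedNormSq_eq {j m : ℕ} {σ : ℝ} {u w : ℝ × ℝ → ℂ} (hw : IsEulerDeriv κ j u w)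
    (wt : ℝ → ℝ≥0∞) : ⨅ (w' : ℝ × ℝ → ℂ) (_ : IsEulerDeriv κ j u w'),
      mixedNormSq R (Ioi 0) wt m σ w' = mixedNormSq R (Ioi 0) wt m σ w :=
  le_antisymm (iInf₂_le w hw) (le_iInf₂ fun _ hw' =>
    (mixedNormSq_congr R wt m σ (hw.ae_eq hw')).le)

/-- By induction on `j` the transform of `(rD_r)^j u` is `λ^j` times that of `u`, so the two norms
agree summand by summand. -/
theorem MemP.exists_isMellinPair {u : ℝ × ℝ → ℂ} (hu : MemP R γ Θ θ u) :
    ∃ v, AEStronglyMeasurable v (cylMeasure univ κ) ∧ IsMellinPair κ θ u v ∧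
      yNormSq R γ Θ θ v = pNormSq R γ Θ θ u := by
  have h1 : ∀ j, ∃ w, j ≤ γ → IsEulerDeriv κ j u w ∧ mixedNormSq R (Ioi 0)
      (fun r => ENNReal.ofReal (r ^ (θ - 1))) (γ - j) (Θ - 1 + 2 * j) w < ⊤ := by
    intro j
    by_cases hj : j ≤ γ
    · obtain ⟨w, hw⟩ := (pNormSq_lt_top_iff ..).1 hu.2 j (Finset.mem_range.2 (by omega))
      exact ⟨w, fun _ => hw⟩
    · exact ⟨0, fun h => absurd h hj⟩
  choose w hw using h1
  have hL : ∀ j ≤ γ, IsLocL2 κ (toLog θ (w j)) := by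
    intro j hj
    have h2 := (hw j hj).2
    rw [mixedNormSq_Ioi_eq] at h2
    refine isLocL2_of_lintegral_sobNormSq_lt_top R (aestronglyMeasurable_toLog θ ?_) h2
    rw [cylMeasure_Ioi]
    exact (hw j hj).1.1.aestronglyMeasurable
  have h2 : ∀ j, ∃ V, j ≤ γ → IsRadialFourier κ (toLog θ (w j)) V := by
    intro j
    by_cases hj : j ≤ γ
    · obtain ⟨V, hV⟩ := exists_isRadialFourier (hL j hj).meas (hL j hj).ae_lintegral_lt_top
      exact ⟨V, fun _ => hV⟩
    · exact ⟨0, fun h => absurd h hj⟩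
  choose V hV using h2
  have hpow : ∀ j ≤ γ, V j =ᵐ[cylMeasure univ κ]
      fun p => linePt θ (2 * Real.pi * p.1) ^ j * V 0 p := by
    intro j
    induction j with
    | zero => exact fun _ => .of_forall fun p => by simp
    | succ j ih =>
      intro hj
      have hj' : j ≤ γ := by omega
      have he := (hw j hj').1.of_succ (hw (j + 1) hj).1
      have h3 := he.ae_eq_linePt_mul R (hw j hj').1.1 (hL j hj') (hL _ hj) (hV j hj') (hV _ hj)
      filter_upwards [h3, ih hj'] with p hp hp'
      rw [hp, hp', pow_succ]
      ring
  have h0 : w 0 =ᵐ[cylMeasure (Ioi 0) κ] u :=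
    (hw 0 (Nat.zero_le _)).1.ae_eq (isEulerDeriv_zero hu.1)
  refine ⟨ofFreq (V 0), aestronglyMeasurable_ofFreq (hV 0 (Nat.zero_le _)).right, ?_, ?_⟩
  · rw [IsMellinPair, toFreq_ofFreq]
    exact (hV 0 (Nat.zero_le _)).congr (toLog_congr θ h0) .rfl
  · refine Finset.sum_congr rfl fun j hj => ?_
    have hj' : j ≤ γ := by simpa [Nat.lt_succ_iff] using hj
    rw [iInf_mixedNormSq_eq R (hw j hj').1, mixedNormSq_Ioi_eq, mixedNormSq_univ_eq,
      toFreq_ofFreq, ← (hV j hj').lintegral_sobNormSq R _ _ (hL j hj')]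
    have h3 := Measure.ae_ae_of_ae_prod (hpow j hj')
    rw [Measure.restrict_univ] at h3
    refine lintegral_congr_ae ?_
    filter_upwards [h3] with s hs
    exact (sobNormSq_congr R _ _ hs).symm

/-- Every `λ^j v` is inverted separately, which gives a candidate for `(rD_r)^j u` with the correct
norm. That the candidates are the Euler derivatives of the first one is then read off from their
transforms. -/
theorem exists_memP_isMellinPair {v : ℝ × ℝ → ℂ}
    (hv : AEStronglyMeasurable v (cylMeasure univ κ)) (hfin : yNormSq R γ Θ θ v < ⊤) :
    ∃ u, MemP R γ Θ θ u ∧ IsMellinPair κ θ u v := by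
  have hcont : ∀ j : ℕ, Continuous fun p : ℝ × ℝ => linePt θ (2 * Real.pi * p.1) ^ j := fun j =>
    ((continuous_linePt θ).comp (by fun_prop)).pow j
  have hVm : ∀ j : ℕ, AEStronglyMeasurable
      (fun p => linePt θ (2 * Real.pi * p.1) ^ j * toFreq v p) (cylMeasure univ κ) := fun j =>
    (hcont j).aestronglyMeasurable.mul (aestronglyMeasurable_toFreq hv)
  have hVfin : ∀ j ≤ γ, ∫⁻ s, sobNormSq R (γ - j) (Θ - 1 + 2 * j)
      (fun φ => linePt θ (2 * Real.pi * s) ^ j * toFreq v (s, φ)) < ⊤ := by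
    intro j hj
    have := ENNReal.sum_lt_top.1 hfin j (Finset.mem_range.2 (by omega))
    rwa [mixedNormSq_univ_eq] at this
  have h1 : ∀ j : ℕ, ∃ U, j ≤ γ → IsLocL2 κ U ∧
      IsRadialFourier κ U fun p => linePt θ (2 * Real.pi * p.1) ^ j * toFreq v p := by
    intro j
    by_cases hj : j ≤ γ
    · obtain ⟨U, hU⟩ := (isLocL2_of_lintegral_sobNormSq_lt_top R (hVm j)
        (hVfin j hj)).exists_isRadialFourier_inv
      exact ⟨U, fun _ => hU⟩
    · exact ⟨0, fun h => absurd h hj⟩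
  choose U hU using h1
  have hloc : ∀ j ≤ γ, LocallyIntegrableOn (ofLog θ (U j)) (Ioi 0 ×ˢ Ioo 0 κ) := fun j hj =>
    (hU j hj).1.locallyIntegrableOn_ofLog θ
  have hpair : ∀ j ≤ γ, IsRadialFourier κ (toLog θ (ofLog θ (U j)))
      fun p => linePt θ (2 * Real.pi * p.1) ^ j * toFreq v p := fun j hj => by
    rw [toLog_ofLog]
    exact (hU j hj).2
  have he : ∀ j ≤ γ, IsEulerDeriv κ j (ofLog θ (U 0)) (ofLog θ (U j)) := by
    intro j
    induction j with
    | zero => exact fun hj => isEulerDeriv_zero (hloc 0 hj)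
    | succ j ih =>
      intro hj
      have hj' : j ≤ γ := by omega
      refine (ih hj').succ (isEulerDeriv_one_of_isRadialFourier (hloc j hj') (hloc _ hj)
        (hpair j hj') (hpair _ hj) (.of_forall fun p => ?_))
      beta_reduce
      rw [pow_succ]
      ring
  refine ⟨ofLog θ (U 0), ⟨hloc 0 (Nat.zero_le _), (pNormSq_lt_top_iff ..).2 fun j hj => ?_⟩, ?_⟩
  · have hj' : j ≤ γ := by simpa [Nat.lt_succ_iff] using hj
    refine ⟨_, he j hj', ?_⟩
    rw [mixedNormSq_Ioi_eq, toLog_ofLog, ← (hU j hj').2.lintegral_sobNormSq R _ _ (hU j hj').1]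
    exact hVfin j hj'
  · have h0 := hpair 0 (Nat.zero_le _)
    simp only [pow_zero, one_mul] at h0
    exact h0

theorem exists_mellinPair_YSpace (u : PSpace R γ Θ θ) : ∃ v : YSpace R γ Θ θ,
    IsMellinPair κ θ (u : (ℝ × ℝ) →ₘ[cylMeasure (Ioi 0) κ] ℂ)
      (v : (ℝ × ℝ) →ₘ[cylMeasure univ κ] ℂ) ∧
    yNormSq R γ Θ θ (v : (ℝ × ℝ) →ₘ[cylMeasure univ κ] ℂ) =
      pNormSq R γ Θ θ (u : (ℝ × ℝ) →ₘ[cylMeasure (Ioi 0) κ] ℂ) := by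
  have hu : MemP R γ Θ θ (u : (ℝ × ℝ) →ₘ[cylMeasure (Ioi 0) κ] ℂ) := u.2
  obtain ⟨v, hv, hp, hn⟩ := hu.exists_isMellinPair
  have hY := memY_of_yNormSq_lt_top R γ Θ θ hv (hn ▸ hu.2)
  have hmk := (AEEqFun.coeFn_mk v hv).symm
  exact ⟨⟨AEEqFun.mk v hv, hY.congr hmk⟩, hp.congr .rfl hmk,
    (yNormSq_congr R γ Θ θ hmk).symm.trans hn⟩

theorem exists_mellinPair_PSpace (v : YSpace R γ Θ θ) : ∃ u : PSpace R γ Θ θ,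
    IsMellinPair κ θ (u : (ℝ × ℝ) →ₘ[cylMeasure (Ioi 0) κ] ℂ)
      (v : (ℝ × ℝ) →ₘ[cylMeasure univ κ] ℂ) := by
  have hv : MemY R γ Θ θ (v : (ℝ × ℝ) →ₘ[cylMeasure univ κ] ℂ) := v.2
  obtain ⟨u, hu, hp⟩ := exists_memP_isMellinPair R γ Θ θ
    (AEEqFun.aestronglyMeasurable (v : (ℝ × ℝ) →ₘ[cylMeasure univ κ] ℂ)) hv.yNormSq_lt_top
  have hm : AEStronglyMeasurable u (cylMeasure (Ioi 0) κ) := by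
    rw [cylMeasure_Ioi]
    exact hu.1.aestronglyMeasurable
  have hmk := (AEEqFun.coeFn_mk u hm).symm
  exact ⟨⟨AEEqFun.mk u hm, hu.congr hmk⟩, hp.congr hmk .rfl⟩

end Spaces

end

theorem theorem3p20 (κ : ℝ) (hκ : 0 < κ) (hκ' : κ < 2 * Real.pi) (c : ℝ)
    (R : ApproxResolution c (Ioo 0 κ)) (γ : ℕ) (Θ θ : ℝ) :
    ∃ M : PSpace R γ Θ θ ≃ₗ[ℂ] YSpace R γ Θ θ,
      (∀ u : PSpace R γ Θ θ, IsRadialMellin κ θ (u : (ℝ × ℝ) →ₘ[cylMeasure (Ioi 0) κ] ℂ)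
        (M u : (ℝ × ℝ) →ₘ[cylMeasure univ κ] ℂ)) ∧
      ∃ C : ℝ≥0, ∀ u : PSpace R γ Θ θ,
        yNorm R γ Θ θ (M u : (ℝ × ℝ) →ₘ[cylMeasure univ κ] ℂ) ≤
          C * pNorm R γ Θ θ (u : (ℝ × ℝ) →ₘ[cylMeasure (Ioi 0) κ] ℂ) ∧
        pNorm R γ Θ θ (u : (ℝ × ℝ) →ₘ[cylMeasure (Ioi 0) κ] ℂ) ≤
          C * yNorm R γ Θ θ (M u : (ℝ × ℝ) →ₘ[cylMeasure univ κ] ℂ) := by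
  -- The partner is merely chosen; since each member of a Mellin pair determines the other almost
  -- everywhere, the choice is automatically additive, homogeneous and injective.
  choose M hM hn using exists_mellinPair_YSpace R γ Θ θ
  let L : PSpace R γ Θ θ →ₗ[ℂ] YSpace R γ Θ θ :=
    { toFun := M
      map_add' := fun u u' => Subtype.ext (AEEqFun.ext
        (((hM (u + u')).unique ((hM u).add (hM u')) (AEEqFun.coeFn_add _ _)).trans
          (AEEqFun.coeFn_add _ _).symm))
      map_smul' := fun a u => Subtype.ext (AEEqFun.ext
        (((hM (a • u)).unique ((hM u).smul a) (AEEqFun.coeFn_smul _ _)).trans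
          (AEEqFun.coeFn_smul _ _).symm)) }
  have hL : Function.Bijective L := by
    refine ⟨fun u u' h => Subtype.ext (AEEqFun.ext ((hM u).unique_left (hM u') ?_)), fun v => ?_⟩
    · have h' : M u = M u' := h
      rw [h']
    · obtain ⟨u, hu⟩ := exists_mellinPair_PSpace R γ Θ θ v
      exact ⟨u, Subtype.ext (AEEqFun.ext ((hM u).unique hu .rfl))⟩
  -- The constant is `1` because the norms coincide.
  refine ⟨LinearEquiv.ofBijective L hL, fun u => (hM u).isRadialMellin, 1, fun u => ?_⟩
  have h : yNorm R γ Θ θ (M u : (ℝ × ℝ) →ₘ[cylMeasure univ κ] ℂ) =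
      pNorm R γ Θ θ (u : (ℝ × ℝ) →ₘ[cylMeasure (Ioi 0) κ] ℂ) := by
    rw [yNorm, pNorm, hn]
  rw [ENNReal.coe_one, one_mul, one_mul]
  exact ⟨h.le, h.ge⟩
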